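/- Let $0<b<1$ with $b^2\notin\mathbb Q$, $q=e^{\pi i b^2}$, $Q=b+b^{-1}$, $[w]_q=\frac{q^w-q^{-w}}{q-q^{-1}}$ with $q^w=e^{\pi i b^2w}$. Let $S_b(w)=e^{\pi i w(Q-w)/2}G_b(w)$, where $G_b$ is the meromorphic continuation to $\mathbb C$ of $$G_b(w)=\overline{\zeta_b}\,\exp\Big(-\int_{\mathcal C}\frac{e^{\pi t w}}{(e^{\pi b t}-1)(e^{\pi b^{-1}t}-1)}\frac{dt}{t}\Big),\qquad 0<\operatorname{Re}w<Q,\qquad \zeta_b=e^{\frac{\pi i}{2}\left(\frac{b^2+b^{-2}}{6}+\frac12\right)},$$ and $\mathcal C$ runs along $\mathbb R$ and passes above $t=0$. For $\lambda\ge 0$ let $\mathcal P_\lambda$ be the representation on $L^2(\mathbb R)$ given by $$E=\Big[\tfrac{Q}{2b}+\tfrac ib(\lambda-x)\Big]_q e^{-2\pi b p},\qquad F=\Big[\tfrac{Q}{2b}+\tfrac ib(\lambda+x)\Big]_q e^{2\pi b p},\qquad K=e^{-2\pi b x},\qquad p=\tfrac{1}{2\pi i}\tfrac{d}{dx},$$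 so that $e^{\mp2\pi bp}f(x)=f(x\pm ib)$ for functions that continue analytically past the closed strip between $\mathbb R$ and $\mathbb R\pm ib$, with uniformly bounded $L^2$ norms on the horizontal lines of that strip. On $\mathcal P_{\lambda_1}\otimes\mathcal P_{\lambda_2}$ (functions of $(x,y)$) the generators act by $\Delta(E)=E\otimes1+K\otimes E$, $\Delta(F)=1\otimes F+F\otimes K^{-1}$, $\Delta(K)=K\otimes K$, each one-variable operator being applied for every fixed value of the other variable. Let $\lambda_1,\lambda_2\ge 0$. For $x,y,z\in\mathbb R$ and $\alpha>0$ let $$\begin{aligned}C(x,y,\alpha,z)=\ &\delta(x+y-z)\,\frac{S_b(\frac Q2+i\alpha-iz)\,S_b(\frac Q2+i\alpha-i\lambda_1+i\lambda_2)}{S_b(\frac Q2-iy+i\lambda_2)\,S_b(2i\alpha)}\\ &\cdot\int\frac{e^{\pi(\frac Q2+ix+i\lambda_1)(r+\alpha-\lambda_1-y)}\,S_b(i\alpha-iy-i\lambda_1+ir)\,S_b(ir)\,S_b(2i\alpha+ir)}{S_b(\frac Q2+i\alpha-iz+ir)\,S_b(\frac Q2+i\alpha-i\lambda_1-i\lambda_2+ir)\,S_b(\frac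 Q2+i\alpha-i\lambda_1+i\lambda_2+ir)}\,dr,\end{aligned}$$ where $r$ runs over a line $\operatorname{Im}r=-s$ with $0<s<\frac Q2$; such a line lies below all poles of the $S_b$ in the numerator and above all poles coming from the zeros of the $S_b$ in the denominator. Then: 1. (Replacement rule.) Let $z=x+y$, $\alpha>0$ and $-\frac Q2<\operatorname{Im}r<0$. The prefactor times the integrand at $r$ is obtained from the summand $$(-q)^{\rho+m-k}\,q^{(\rho+m-k)(M-m)}\binom{k}{\rho}_q\binom{\rho+d}{k-m+d}_q\binom{N-d}{\rho}_q\binom{S}{\rho}_q^{-1},\qquad d=\tfrac{M+N-S}{2},$$ of the Clebsch–Gordan coefficient (normalized by $c_0=1$) of $V_S\subset V_M\otimes V_N$ for the compact quantum group $\mathcal U_q(\mathfrak{sl}_2)$ by replacing every factorial $[n]!$ in the $q$-binomials by $S_b(Q+bn)$ and every power $(-q)^w$ by $e^{\pi i bQw}$, and by the substitution $M=-\frac Qb+\frac{2i\lambda_1}{b}$, $N=-\frac Qb+\frac{2i\lambda_2}{b}$, $S=-\frac Qb+\frac{2i\alpha}{b}$, $x=-\frac{ib(M-2m)}{2}$,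 $z=-\frac{ib(S-2k)}{2}$, $\rho=\frac{r}{ib}$. 2. (Convergence.) The contour integral converges absolutely and does not depend on $s\in(0,\frac Q2)$. 3. (Intertwining.) Let $\mathcal W$ be the set of functions $e^{-cu^2+su}P(u)$ with $c>0$, $s\in\mathbb C$ and $P$ a polynomial, and let $\mathcal W_\alpha\otimes\mathcal W_z$ be the linear span of the products $\varphi(\alpha)\psi(z)$ with $\varphi,\psi\in\mathcal W$. For $f\in\mathcal W_\alpha\otimes\mathcal W_z$ the integral $$(Cf)(x,y)=\int_0^\infty\!\!\int_{\mathbb R} C(x,y,\alpha,z)f(\alpha,z)\,dz\,d\alpha$$ converges absolutely (as an integral over $\alpha$, after evaluating the delta function) for all $x,y\in\mathbb R$. For each $X\in\{E,F,K\}$ the function $Xf$, where $X$ acts on $f(\alpha,\cdot)$ as in $\mathcal P_\alpha$ for each $\alpha>0$, is again in $\mathcal W_\alpha\otimes\mathcal W_z$, the function $Cf$ lies in the domain of $\Delta(X)$ acting on $\mathcal P_{\lambda_1}\otimes\mathcal P_{\lambda_2}$ as above, and $$\Delta(X)(Cf)=C(Xf).$$ -/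

import Mathlib

open MeasureTheory
open scoped NNReal

namespace SplitReal

/-! ### The quantum dilogarithm -/

/-- `Q = b + b⁻¹`. -/
noncomputable def bigQ (b : ℝ) : ℝ := b + b⁻¹

/-- `ζ_b = exp((πi/2)((b² + b⁻²)/6 + 1/2))`. -/
noncomputable def zetaB (b : ℝ) : ℂ :=
  Complex.exp (Real.pi * Complex.I / 2 * (((b : ℂ) ^ 2 + ((b : ℂ)⁻¹) ^ 2) / 6 + 1 / 2))

/-- The integrand `e^{πtz} / ((e^{πbt} - 1)(e^{πt/b} - 1) t)` of the quantum dilogarithm. -/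
noncomputable def dilogIntegrand (b : ℝ) (z t : ℂ) : ℂ :=
  Complex.exp (Real.pi * t * z) /
    ((Complex.exp (Real.pi * b * t) - 1) * (Complex.exp (Real.pi * (b : ℂ)⁻¹ * t) - 1) * t)

/-- `G_b(z)` for `0 < Re z < Q`:
`conj ζ_b * exp(-∫_C e^{πtz} / ((e^{πbt} - 1)(e^{πt/b} - 1)) dt/t)`.
The contour `C` runs along the real line and passes above the pole `t = 0`. It is realized as the
line `Im t = b`; the first poles above `t = 0` have imaginary part `2b` (recall `b < 1`). -/
noncomputable def dilogStrip (b : ℝ) (z : ℂ) : ℂ :=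
  (starRingEnd ℂ) (zetaB b) *
    Complex.exp (-∫ u : ℝ, dilogIntegrand b z ((u : ℂ) + b * Complex.I))

/-- `G_b` on the whole complex plane: the meromorphic continuation of `dilogStrip`, written out
through the functional equation `G_b(z + b) = (1 - e^{2πibz}) G_b(z)`, applied as many times as it
takes to move the argument into the strip `0 < Re z < Q` (value `0` at the poles). -/
noncomputable def dilogG (b : ℝ) (z : ℂ) : ℂ :=
  if z.re ≤ 0 then
    dilogStrip b (z + ((⌊-z.re / b⌋₊ + 1 : ℕ) : ℂ) * b) /
      ∏ j ∈ Finset.range (⌊-z.re / b⌋₊ + 1),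
        (1 - Complex.exp (2 * Real.pi * Complex.I * b * (z + j * b)))
  else if z.re < bigQ b then
    dilogStrip b z
  else
    dilogStrip b (z - ((⌊(z.re - bigQ b) / b⌋₊ + 1 : ℕ) : ℂ) * b) *
      ∏ j ∈ Finset.range (⌊(z.re - bigQ b) / b⌋₊ + 1),
        (1 - Complex.exp (2 * Real.pi * Complex.I * b * (z - (j + 1) * b)))

/-- `S_b(z) = e^{πiz(Q-z)/2} G_b(z)`. -/
noncomputable def dilogS (b : ℝ) (z : ℂ) : ℂ :=
  Complex.exp (Real.pi * Complex.I * z * (bigQ b - z) / 2) * dilogG b z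

/-! ### `q`-numbers -/

/-- `q^z` for `q = e^{πib²}`. -/
noncomputable def qPow (b : ℝ) (z : ℂ) : ℂ :=
  Complex.exp (Real.pi * Complex.I * (b : ℂ) ^ 2 * z)

/-- `[z]_q = (q^z - q^{-z}) / (q - q⁻¹)`. -/
noncomputable def qNum (b : ℝ) (z : ℂ) : ℂ :=
  (qPow b z - qPow b (-z)) / (qPow b 1 - qPow b (-1))

/-! ### Positive representations on `L²(ℝ)`

Unbounded operators are described by their graphs: `T f g` means that `f` lies in the domain and
is mapped to `g`. With `p = (2πi)⁻¹ d/dx`, the operator `e^{-2πap}` is the shift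
`f(x) ↦ f(x + ia)`. -/

/-- `e^{-2πap} f = g`: the function `f` extends analytically past the closed strip between
`Im w = 0` and `Im w = a`, with uniformly bounded `L²` norms on the horizontal lines of the strip,
and `g(x)` is the value of the extension at `x + ia`. -/
def ShiftGraph (a : ℝ) (f g : ℝ → ℂ) : Prop :=
  ∃ Φ : ℂ → ℂ, AnalyticOnNhd ℂ Φ {w : ℂ | w.im ∈ Set.uIcc 0 a} ∧
    (∀ x : ℝ, Φ x = f x) ∧
    (∀ x : ℝ, Φ ((x : ℂ) + a * Complex.I) = g x) ∧
    ∃ M : ℝ≥0, ∀ t ∈ Set.uIcc 0 a,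
      eLpNorm (fun x : ℝ => Φ ((x : ℂ) + t * Complex.I)) 2 volume ≤ M

/-- Graph of `E = [Q/(2b) + (i/b)(l - x)]_q e^{-2πbp}` in the positive representation `P_l`. -/
def GraphE (b l : ℝ) (f g : ℝ → ℂ) : Prop :=
  MemLp g 2 volume ∧ ∃ h : ℝ → ℂ, ShiftGraph b f h ∧
    ∀ x : ℝ, g x = qNum b (bigQ b / (2 * b) + Complex.I / b * (l - x)) * h x

/-- Graph of `F = [Q/(2b) + (i/b)(l + x)]_q e^{2πbp}` in the positive representation `P_l`. -/
def GraphF (b l : ℝ) (f g : ℝ → ℂ) : Prop :=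
  MemLp g 2 volume ∧ ∃ h : ℝ → ℂ, ShiftGraph (-b) f h ∧
    ∀ x : ℝ, g x = qNum b (bigQ b / (2 * b) + Complex.I / b * (l + x)) * h x

/-- Graph of `K = e^{-2πbx}` (the same in every `P_l`). -/
def GraphK (b : ℝ) (f g : ℝ → ℂ) : Prop :=
  MemLp f 2 volume ∧ MemLp g 2 volume ∧
    ∀ x : ℝ, g x = Complex.exp (-2 * Real.pi * b * x) * f x

/-- Graph of `K⁻¹ = e^{2πbx}`. -/
def GraphKinv (b : ℝ) (f g : ℝ → ℂ) : Prop := GraphK b g f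

/-- `T ⊗ 1`: the operator `T` acting in the first variable. -/
def OnFirst (T : (ℝ → ℂ) → (ℝ → ℂ) → Prop) (F G : ℝ → ℝ → ℂ) : Prop :=
  ∀ y : ℝ, T (fun x => F x y) (fun x => G x y)

/-- `1 ⊗ T`: the operator `T` acting in the second variable. -/
def OnSecond (T : (ℝ → ℂ) → (ℝ → ℂ) → Prop) (F G : ℝ → ℝ → ℂ) : Prop :=
  ∀ x : ℝ, T (F x) (G x)

/-- `Δ(K) = K ⊗ K` on `P_{l₁} ⊗ P_{l₂}`. -/
def CoprodK (b : ℝ) (F G : ℝ → ℝ → ℂ) : Prop :=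
  ∃ H : ℝ → ℝ → ℂ, OnSecond (GraphK b) F H ∧ OnFirst (GraphK b) H G

/-- `Δ(E) = E ⊗ 1 + K ⊗ E` on `P_{l₁} ⊗ P_{l₂}`. -/
def CoprodE (b l₁ l₂ : ℝ) (F G : ℝ → ℝ → ℂ) : Prop :=
  ∃ G₁ H G₂ : ℝ → ℝ → ℂ, OnFirst (GraphE b l₁) F G₁ ∧
    OnSecond (GraphE b l₂) F H ∧ OnFirst (GraphK b) H G₂ ∧
    ∀ x y : ℝ, G x y = G₁ x y + G₂ x y

/-- `Δ(F) = 1 ⊗ F + F ⊗ K⁻¹` on `P_{l₁} ⊗ P_{l₂}`. -/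
def CoprodF (b l₁ l₂ : ℝ) (F G : ℝ → ℝ → ℂ) : Prop :=
  ∃ G₁ H G₂ : ℝ → ℝ → ℂ, OnSecond (GraphF b l₂) F G₁ ∧
    OnFirst (GraphF b l₁) F H ∧ OnSecond (GraphKinv b) H G₂ ∧
    ∀ x y : ℝ, G x y = G₁ x y + G₂ x y

/-! ### The split real Clebsch-Gordan kernel -/

/-- The factor in front of the contour integral (it does not involve `x`):
`S_b(Q/2 + iα - iz) S_b(Q/2 + iα - il₁ + il₂) / (S_b(Q/2 - iy + il₂) S_b(2iα))`. -/
noncomputable def cgPrefactor (b l₁ l₂ y α z : ℝ) : ℂ :=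
  dilogS b (bigQ b / 2 + Complex.I * α - Complex.I * z) *
      dilogS b (bigQ b / 2 + Complex.I * α - Complex.I * l₁ + Complex.I * l₂) /
    (dilogS b (bigQ b / 2 - Complex.I * y + Complex.I * l₂) * dilogS b (2 * Complex.I * α))

/-- The integrand of the contour integral over `r`. -/
noncomputable def cgIntegrand (b l₁ l₂ x y α z : ℝ) (r : ℂ) : ℂ :=
  Complex.exp (Real.pi * (bigQ b / 2 + Complex.I * x + Complex.I * l₁) * (r + α - l₁ - y)) *
      dilogS b (Complex.I * α - Complex.I * y - Complex.I * l₁ + Complex.I * r) *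
      dilogS b (Complex.I * r) * dilogS b (2 * Complex.I * α + Complex.I * r) /
    (dilogS b (bigQ b / 2 + Complex.I * α - Complex.I * z + Complex.I * r) *
      dilogS b (bigQ b / 2 + Complex.I * α - Complex.I * l₁ - Complex.I * l₂ + Complex.I * r) *
      dilogS b (bigQ b / 2 + Complex.I * α - Complex.I * l₁ + Complex.I * l₂ + Complex.I * r))

/-- The density `c` of the kernel `C(x,y,α,z) = δ(x+y-z) c(x,y,α,z)`. The contour runs along the
real line, below all poles of the `S_b` in the numerator (they have `Im r ≥ 0`) and above all poles
coming from the zeros of the `S_b` in the denominator (they have `Im r ≤ -Q/2`). It is realized as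
the line `Im r = -Q/4`. -/
noncomputable def cgDensity (b l₁ l₂ x y α z : ℝ) : ℂ :=
  cgPrefactor b l₁ l₂ y α z *
    ∫ u : ℝ, cgIntegrand b l₁ l₂ x y α z ((u : ℂ) - (bigQ b / 4 : ℝ) * Complex.I)

/-- The integral transformation `f(α,z) ↦ F(x,y) = ∬ C(x,y,α,z) f(α,z) dα dz` over `α > 0`; the
measure `δ(x+y-z) dz` is the Dirac measure at `x + y`. -/
noncomputable def cgTransform (b l₁ l₂ : ℝ) (f : ℝ → ℝ → ℂ) (x y : ℝ) : ℂ :=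
  ∫ α in Set.Ioi (0 : ℝ),
    ∫ z : ℝ, cgDensity b l₁ l₂ x y α z * f α z ∂(Measure.dirac (x + y))

/-- The functions `e^{-rz² + sz} P(z)` with `r > 0`, `s ∈ ℂ` and `P` a polynomial. -/
def coreW : Set (ℝ → ℂ) :=
  {φ | ∃ (r : ℝ) (s : ℂ) (P : Polynomial ℂ), 0 < r ∧
    ∀ z : ℝ, φ z = Complex.exp (-(r : ℂ) * (z : ℂ) ^ 2 + s * z) * P.eval (z : ℂ)}

/-- The test space `W_α ⊗ W_z` (algebraic tensor product) of functions `f(α,z)`. -/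
def testSpace : Submodule ℂ (ℝ → ℝ → ℂ) :=
  Submodule.span ℂ {f | ∃ φ ∈ coreW, ∃ ψ ∈ coreW, f = fun α z => φ α * ψ z}

/-- The transformation with kernel `C` intertwines an operator acting as `A α` on each slice `P_α`
of the direct integral with an operator `T` on functions of `(x,y)`: for every test function `f`
the slicewise image `g` of `f` exists (it is again a test function) and `T` maps `C f` to `C g`. -/
def Intertwines (b l₁ l₂ : ℝ) (A : ℝ → (ℝ → ℂ) → (ℝ → ℂ) → Prop)
    (T : (ℝ → ℝ → ℂ) → (ℝ → ℝ → ℂ) → Prop) : Prop :=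
  ∀ f ∈ testSpace, ∃ g ∈ testSpace,
    (∀ α : ℝ, 0 < α → A α (f α) (g α)) ∧
      T (cgTransform b l₁ l₂ f) (cgTransform b l₁ l₂ g)

/-! ### The replacement rule -/

/-- The `r`-th summand of the Clebsch-Gordan coefficients, normalized by `c₀ = 1`,
`(-q)^{r+m-k} q^{(r+m-k)(M-m)} [k, r] [r+d, k-m+d] [N-d, r] [S, r]⁻¹`,
as a function of the powers `s ↦ (-q)^s`, `s ↦ q^s` and of the binomial `[·, ·]`. With `A = ℤ` and
the usual powers and `q`-binomials, summing over `0 ≤ r ≤ k` gives the coefficients of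
`V_S ⊆ V_M ⊗ V_N`, where `d = (M + N - S)/2`. -/
noncomputable def cgSummand {A : Type*} [CommRing A] (negqPow qpow : A → ℂ) (binom : A → A → ℂ)
    (M N S d m k r : A) : ℂ :=
  negqPow (r + m - k) * qpow ((r + m - k) * (M - m)) *
    binom k r * binom (r + d) (k - m + d) * binom (N - d) r * (binom S r)⁻¹

/-- The binomial obtained by replacing each factorial `[n]!` by `S_b(Q + bn)`. -/
noncomputable def binomS (b : ℝ) (n k : ℂ) : ℂ :=
  dilogS b (bigQ b + b * n) / (dilogS b (bigQ b + b * k) * dilogS b (bigQ b + b * (n - k)))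

/-- The virtual highest weight `N = -Q/b + 2il/b` of `P_l`. -/
noncomputable def virtualWeight (b l : ℝ) : ℂ :=
  -(bigQ b : ℂ) / b + 2 * Complex.I * l / b

/-- The index `n` determined by `x = -ib(N - 2n)/2`, where `N` is the virtual highest weight. -/
noncomputable def virtualIndex (b l x : ℝ) : ℂ :=
  virtualWeight b l / 2 - Complex.I * x / b

/-- The summand after the replacement: `[n]!` becomes `S_b(Q + bn)`, `(-q)^s` becomes
`e^{πibQs}`, the weights and indices become the virtual ones, and `r` becomes `r/(ib)`. -/
noncomputable def cgReplaced (b l₁ l₂ x α z : ℝ) (r : ℂ) : ℂ :=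
  cgSummand (fun s : ℂ => Complex.exp (Real.pi * Complex.I * b * bigQ b * s)) (qPow b) (binomS b)
    (virtualWeight b l₁) (virtualWeight b l₂) (virtualWeight b α)
    ((virtualWeight b l₁ + virtualWeight b l₂ - virtualWeight b α) / 2)
    (virtualIndex b l₁ x) (virtualIndex b α z) (r / (Complex.I * b))

end SplitReal

/-! Everything rests on three properties of `dilogS` in the strip 0 < Re z < Q. The functional
equation is S_b(z+b) = 2 sin(πbz) S_b(z) (`dilogS_add`), the reflection formula is S_b(z) S_b(Q-z) =
1 (`dilogS_mul_reflect`), and S_b(z) has size e^{π|Im z|(Re z - Q/2)} up to constants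
(`exists_norm_dilogS_bounds`). The first two are residue computations at t = 0 for the integral in
the exponent. The third holds because that integral stays bounded as Im z → +∞, and reflection
treats the lower half plane.

The replacement rule is substitution followed by three reflections. In the contour integral the
growth rates of the six dilogarithms and of the exponential add up to -πQ|Re r| for real x, y, z.
This gives absolute convergence, and Cauchy's theorem gives independence of the contour.

For the intertwining property, Cf is written as an integral over (α, Re r) and continued to complex
x and y. The kernel grows at most exponentially in α, x and y, so the Gaussian decay of f in α and
in z = x + y makes the continuation holomorphic and square integrable along lines. The shifts by ±ib
may therefore be carried out under the integral, with the contour placed at a height for which no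
shifted argument leaves the strip.

For K the relation is e^{-2πbz} = e^{-2πbx} e^{-2πby}. For E the functional equation expresses both
shifted kernels through the unshifted one, and the relation holds pointwise in r
(`kernel_identity_raising`). For F it holds only up to a difference Φ(r+ib) - Φ(r)
(`kernel_identity_lowering`), the continuous analogue of a telescoping sum over ρ = r/(ib). This
difference integrates to zero by Cauchy's theorem (`integral_loweringPrimitive_sub`). Both
identities reduce to identities of rational functions in exponentials e^{πb(·)}. -/

namespace SplitReal

open Filter Topology Complex

/-! ### Cauchy's theorem and residues on horizontal strips; holomorphic parameter integrals. -/

section HorizontalContours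

/-- Cauchy's theorem for two horizontal lines. -/
theorem integral_sub_horizontal_eq_zero {f : ℂ → ℂ} {a b : ℝ} (hab : a ≤ b)
    (hd : DifferentiableOn ℂ f {w | w.im ∈ Set.Icc a b}) {g : ℝ → ℝ}
    (hg : Tendsto g atTop (𝓝 0))
    (hbound : ∀ u : ℝ, 1 ≤ |u| → ∀ t ∈ Set.Icc a b, ‖f (u + t * I)‖ ≤ g |u|)
    (hint : Integrable fun u : ℝ => f (u + a * I) - f (u + b * I)) :
    ∫ u : ℝ, (f (u + a * I) - f (u + b * I)) = 0 := by
  have hlim := intervalIntegral_tendsto_integral hint tendsto_neg_atTop_atBot tendsto_id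
  have hcont : ∀ t ∈ Set.Icc a b, Continuous fun u : ℝ => f (u + t * I) := by
    intro t ht
    refine hd.continuousOn.comp_continuous (by fun_prop) fun u => ?_
    simpa using ht
  have hzero : Tendsto (fun R : ℝ => ∫ u in -R..id R, (f (u + a * I) - f (u + b * I)))
      atTop (𝓝 0) := by
    refine squeeze_zero_norm' (a := fun R => g R * |b - a| + g R * |b - a|) ?_ ?_
    · filter_upwards [eventually_ge_atTop 1] with R hR
      have hrect := integral_boundary_rect_eq_zero_of_differentiableOn f
        (-R + a * I) (R + b * I) (hd.mono (by
          intro w hw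
          have := hw.2
          simpa [Set.uIcc_of_le hab] using this))
      simp only [add_re, neg_re, ofReal_re, mul_re, I_re, mul_zero, ofReal_im, I_im, mul_one,
        sub_self, add_zero, add_im, neg_im, neg_zero, mul_im, zero_add, ofReal_neg] at hrect
      have h1 : ∫ u in -R..id R, (f (u + a * I) - f (u + b * I)) =
          (∫ u in -R..R, f (u + a * I)) - ∫ u in -R..R, f (u + b * I) :=
        intervalIntegral.integral_sub
          ((hcont a ⟨le_rfl, hab⟩).intervalIntegrable _ _)
          ((hcont b ⟨hab, le_rfl⟩).intervalIntegrable _ _)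
      have h2 : ∫ u in -R..id R, (f (u + a * I) - f (u + b * I)) =
          I • (∫ y : ℝ in a..b, f (-R + y * I)) - I • (∫ y : ℝ in a..b, f (R + y * I)) := by
        rw [h1]; linear_combination hrect
      rw [h2]
      refine (norm_sub_le _ _).trans (add_le_add ?_ ?_)
      · rw [norm_smul, norm_I, one_mul]
        refine intervalIntegral.norm_integral_le_of_norm_le_const fun t ht => ?_
        rw [Set.uIoc_of_le hab] at ht
        have := hbound (-R) (by rw [abs_neg, abs_of_nonneg (by linarith)]; exact hR) t
          ⟨ht.1.le, ht.2⟩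
        rwa [abs_neg, abs_of_nonneg (by linarith), ofReal_neg] at this
      · rw [norm_smul, norm_I, one_mul]
        refine intervalIntegral.norm_integral_le_of_norm_le_const fun t ht => ?_
        rw [Set.uIoc_of_le hab] at ht
        have := hbound R (by rw [abs_of_nonneg (by linarith)]; exact hR) t ⟨ht.1.le, ht.2⟩
        rwa [abs_of_nonneg (by linarith)] at this
    · simpa using (hg.mul_const |b - a|).add (hg.mul_const |b - a|)
  exact tendsto_nhds_unique hlim hzero

theorem integral_horizontal_eq {f : ℂ → ℂ} {a b : ℝ} (hab : a ≤ b)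
    (hd : DifferentiableOn ℂ f {w | w.im ∈ Set.Icc a b}) {g : ℝ → ℝ}
    (hg : Tendsto g atTop (𝓝 0))
    (hbound : ∀ u : ℝ, 1 ≤ |u| → ∀ t ∈ Set.Icc a b, ‖f (u + t * I)‖ ≤ g |u|)
    (ha : Integrable fun u : ℝ => f (u + a * I)) (hb : Integrable fun u : ℝ => f (u + b * I)) :
    ∫ u : ℝ, f (u + a * I) = ∫ u : ℝ, f (u + b * I) := by
  rw [← sub_eq_zero, ← integral_sub ha hb]
  exact integral_sub_horizontal_eq_zero hab hd hg hbound (ha.sub hb)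

/-- The principal part `A/t³ + B/t² + C/t`. -/
noncomputable def principalPart (A B C t : ℂ) : ℂ := A / t ^ 3 + B / t ^ 2 + C / t

theorem ofReal_add_mul_I_ne_zero {β : ℝ} (hβ : β ≠ 0) (u : ℝ) : (u : ℂ) + β * I ≠ 0 := by
  intro h
  have := congrArg Complex.im h
  simp at this
  exact hβ this

theorem tendsto_inv_ofReal_add_cocompact (c : ℂ) {l : Filter ℝ} (hl : Tendsto (fun u : ℝ => |u|) l atTop) :
    Tendsto (fun u : ℝ => ((u : ℂ) + c)⁻¹) l (𝓝 0) := by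
  apply tendsto_inv₀_cobounded.comp
  rw [← tendsto_norm_atTop_iff_cobounded]
  refine tendsto_atTop_mono (f := fun u : ℝ => |u| + -‖c‖) ?_ (tendsto_atTop_add_const_right _ _ hl)
  intro u
  have := norm_sub_le ((u : ℂ) + c) c
  simp at this
  linarith

/-- The term C/t is integrable on neither line, but the difference is O(1/u²), so only the
difference is integrated. The poles of order two and three have decaying antiderivatives and
contribute nothing. For the simple pole the difference is 2iβC/(u²+β²), with antiderivative 2iC
arctan(u/β), whose total increment is 2πiC. -/
theorem integral_principalPart {β : ℝ} (hβ : 0 < β) (A B C : ℂ) :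
    Integrable (fun u : ℝ => principalPart A B C (u + (-β : ℝ) * I) -
      principalPart A B C (u + β * I)) ∧
    ∫ u : ℝ, (principalPart A B C (u + (-β : ℝ) * I) - principalPart A B C (u + β * I)) =
      2 * Real.pi * I * C := by
  set m : ℝ → ℂ := fun u => u + (-β : ℝ) * I with hm
  set p : ℝ → ℂ := fun u => u + β * I with hp
  have hm0 : ∀ u, m u ≠ 0 := fun u => ofReal_add_mul_I_ne_zero (neg_ne_zero.2 hβ.ne') u
  have hp0 : ∀ u, p u ≠ 0 := fun u => ofReal_add_mul_I_ne_zero hβ.ne' u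
  have hmp : ∀ u, m u * p u = ((u ^ 2 + β ^ 2 : ℝ) : ℂ) := by
    intro u; simp only [hm, hp]; push_cast; ring_nf; simp
  have hmd : ∀ u, HasDerivAt m 1 u := fun u =>
    (Complex.ofRealCLM.hasDerivAt (x := u)).add_const _
  have hpd : ∀ u, HasDerivAt p 1 u := fun u =>
    (Complex.ofRealCLM.hasDerivAt (x := u)).add_const _
  have hmn : ∀ u, ‖m u‖ ^ 2 = u ^ 2 + β ^ 2 := by
    intro u
    rw [← Complex.normSq_eq_norm_sq, Complex.normSq_apply]; simp [hm]; ring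
  have hpn : ∀ u, ‖p u‖ ^ 2 = u ^ 2 + β ^ 2 := by
    intro u
    rw [← Complex.normSq_eq_norm_sq, Complex.normSq_apply]; simp [hp]; ring
  have hbase : Integrable fun u : ℝ => (u ^ 2 + β ^ 2)⁻¹ := by
    have h := (integrable_inv_one_add_sq.comp_div hβ.ne').const_mul (β ^ 2)⁻¹
    refine h.congr (Eventually.of_forall fun u => ?_)
    have : u ^ 2 + β ^ 2 ≠ 0 := by positivity
    have h2 : (1 + (u / β) ^ 2) ≠ 0 := by positivity
    simp only
    field_simp
    ring
  have hmc : Continuous m := by simp only [hm]; fun_prop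
  have hpc : Continuous p := by simp only [hp]; fun_prop
  have hint : Integrable (fun u : ℝ => principalPart A B C (m u) - principalPart A B C (p u)) := by
    refine Integrable.mono' (hbase.const_mul (2 * (‖A‖ / β + ‖B‖ + ‖C‖ * β))) ?_ ?_
    · apply Continuous.aestronglyMeasurable
      unfold principalPart
      exact ((((continuous_const.div (hmc.pow 3) fun u => pow_ne_zero _ (hm0 u)).add
        (continuous_const.div (hmc.pow 2) fun u => pow_ne_zero _ (hm0 u))).add
        (continuous_const.div hmc hm0))).sub
        ((((continuous_const.div (hpc.pow 3) fun u => pow_ne_zero _ (hp0 u)).add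
        (continuous_const.div (hpc.pow 2) fun u => pow_ne_zero _ (hp0 u))).add
        (continuous_const.div hpc hp0)))
    · refine Eventually.of_forall fun u => ?_
      have e : principalPart A B C (m u) - principalPart A B C (p u) =
          A / m u ^ 3 - A / p u ^ 3 + (B / m u ^ 2 - B / p u ^ 2)
            + C * (2 * β * I) / (m u * p u) := by
        have h1 : p u - m u = 2 * β * I := by simp [hm, hp]; ring
        unfold principalPart
        have := hm0 u
        have := hp0 u
        rw [← h1]
        field_simp
        ring
      have hpos : 0 < u ^ 2 + β ^ 2 := by positivity
      have key : ∀ w : ℂ, ‖w‖ ^ 2 = u ^ 2 + β ^ 2 →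
          ‖A / w ^ 3‖ ≤ ‖A‖ / β * (u ^ 2 + β ^ 2)⁻¹ ∧ ‖B / w ^ 2‖ = ‖B‖ * (u ^ 2 + β ^ 2)⁻¹ := by
        intro w hw
        have hwβ : β ≤ ‖w‖ := by
          refine le_of_sq_le_sq ?_ (norm_nonneg _)
          rw [hw]; nlinarith
        refine ⟨?_, ?_⟩
        · rw [norm_div, norm_pow, pow_succ, hw, div_eq_mul_inv, div_mul_eq_mul_div, div_eq_mul_inv,
            mul_inv, ← mul_assoc]
          gcongr
        · rw [norm_div, norm_pow, hw, div_eq_mul_inv]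
      rw [e]
      have hA1 := key _ (hmn u)
      have hA2 := key _ (hpn u)
      have hC : ‖C * (2 * β * I) / (m u * p u)‖ = 2 * (‖C‖ * β) * (u ^ 2 + β ^ 2)⁻¹ := by
        rw [hmp, norm_div, Complex.norm_real, Real.norm_of_nonneg hpos.le]
        simp [abs_of_pos hβ]
        ring
      calc _ ≤ ‖A / m u ^ 3‖ + ‖A / p u ^ 3‖ + (‖B / m u ^ 2‖ + ‖B / p u ^ 2‖)
            + ‖C * (2 * β * I) / (m u * p u)‖ := by
              refine (norm_add_le _ _).trans (add_le_add_left ((norm_add_le _ _).trans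
                (add_le_add (norm_sub_le _ _) (norm_sub_le _ _))) _)
        _ ≤ _ := by
          rw [hC, hA1.2, hA2.2]
          linarith [hA1.1, hA2.1]
  refine ⟨hint, ?_⟩
  set G : ℝ → ℂ := fun u => -(A / 2) * ((m u ^ 2)⁻¹ - (p u ^ 2)⁻¹) - B * ((m u)⁻¹ - (p u)⁻¹)
    + C * (2 * I) * (Real.arctan (u / β) : ℂ) with hG
  have hderiv : ∀ u, HasDerivAt G (principalPart A B C (m u) - principalPart A B C (p u)) u := by
    intro u
    have h1 := ((hmd u).pow 2).inv (pow_ne_zero 2 (hm0 u))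
    have h2 := ((hpd u).pow 2).inv (pow_ne_zero 2 (hp0 u))
    have h3 := (hmd u).inv (hm0 u)
    have h4 := (hpd u).inv (hp0 u)
    have h5 : HasDerivAt (fun u : ℝ => (Real.arctan (u / β) : ℂ))
        ((1 / (1 + (u / β) ^ 2) * (1 / β) : ℝ) : ℂ) u :=
      (((hasDerivAt_id u).div_const β).arctan).ofReal_comp
    have h := (((h1.sub h2).const_mul (-(A / 2))).sub ((h3.sub h4).const_mul B)).add
      (h5.const_mul (C * (2 * I)))
    have h' : HasDerivAt G _ u := h
    refine h'.congr_deriv ?_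
    simp only [Pi.pow_apply]
    have e5 : ((1 / (1 + (u / β) ^ 2) * (1 / β) : ℝ) : ℂ) = β / (m u * p u) := by
      rw [hmp, ← ofReal_div]
      congr 1
      have : u ^ 2 + β ^ 2 ≠ 0 := by positivity
      have : 1 + (u / β) ^ 2 ≠ 0 := by positivity
      field_simp
      ring
    rw [e5]
    have h1 : (2 * I) * (β : ℂ) = p u - m u := by simp [hm, hp]; ring
    have h6 : C * (2 * I) * (β / (m u * p u)) = C * (p u - m u) / (m u * p u) := by
      rw [← h1]; ring
    rw [h6]
    unfold principalPart
    have := hm0 u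
    have := hp0 u
    field_simp
    ring
  have hlimit : ∀ (l : Filter ℝ) (L : ℝ), Tendsto (fun u : ℝ => |u|) l atTop →
      Tendsto (fun u => Real.arctan (u / β)) l (𝓝 L) →
      Tendsto G l (𝓝 (C * (2 * I) * L)) := by
    intro l L hl hL
    have h1 : Tendsto (fun u => (m u)⁻¹) l (𝓝 0) := tendsto_inv_ofReal_add_cocompact _ hl
    have h2 : Tendsto (fun u => (p u)⁻¹) l (𝓝 0) := tendsto_inv_ofReal_add_cocompact _ hl
    have h3 : Tendsto (fun u => (Real.arctan (u / β) : ℂ)) l (𝓝 (L : ℂ)) :=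
      (continuous_ofReal.tendsto _).comp hL
    have h := ((((h1.pow 2).sub (h2.pow 2)).const_mul (-(A / 2))).sub
      ((h1.sub h2).const_mul B)).add (h3.const_mul (C * (2 * I)))
    simpa [hG] using h
  have htop := hlimit atTop (Real.pi / 2) tendsto_abs_atTop_atTop
    ((Real.tendsto_arctan_atTop.mono_right nhdsWithin_le_nhds).comp
      (tendsto_id.atTop_div_const hβ))
  have hbot := hlimit atBot (-(Real.pi / 2)) tendsto_abs_atBot_atTop
    ((Real.tendsto_arctan_atBot.mono_right nhdsWithin_le_nhds).comp
      (tendsto_id.atBot_div_const hβ))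
  rw [integral_of_hasDerivAt_of_tendsto hderiv hint hbot htop]
  push_cast
  ring

/-- The residue theorem for the strip `|Im t| ≤ β` and a pole of order at most three at `0`. -/
theorem integral_sub_horizontal_eq_residue {f : ℂ → ℂ} {β : ℝ} (hβ : 0 < β) {A B C : ℂ}
    (hd : DifferentiableOn ℂ f ({w | w.im ∈ Set.Icc (-β) β} \ {0}))
    (hres : Tendsto (fun t => t * (f t - principalPart A B C t)) (𝓝[≠] 0) (𝓝 0))
    {g : ℝ → ℝ} (hg : Tendsto g atTop (𝓝 0))
    (hbound : ∀ u : ℝ, 1 ≤ |u| → ∀ t ∈ Set.Icc (-β) β, ‖f (u + t * I)‖ ≤ g |u|)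
    (ha : Integrable fun u : ℝ => f (u + (-β : ℝ) * I))
    (hb : Integrable fun u : ℝ => f (u + β * I)) :
    (∫ u : ℝ, f (u + (-β : ℝ) * I)) - ∫ u : ℝ, f (u + β * I) = 2 * Real.pi * I * C := by
  obtain ⟨hPi, hP⟩ := integral_principalPart hβ A B C
  set S : Set ℂ := {w | w.im ∈ Set.Icc (-β) β}
  have hS : S ∈ 𝓝 (0 : ℂ) := by
    have h0 : (0 : ℂ) ∈ im ⁻¹' Set.Ioo (-β) β := by simp [hβ]
    refine mem_of_superset ((isOpen_Ioo.preimage continuous_im).mem_nhds h0) ?_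
    intro w hw
    exact ⟨hw.1.le, hw.2.le⟩
  set h : ℂ → ℂ := fun t => f t - principalPart A B C t with hh
  have hhd : DifferentiableOn ℂ h (S \ {0}) := by
    refine hd.sub fun t ht => ?_
    have ht0 : t ≠ 0 := ht.2
    refine DifferentiableAt.differentiableWithinAt ?_
    unfold principalPart
    fun_prop (disch := positivity)
  -- By `hres` the function without its principal part is o(1/t), so the singularity is removable
  -- and Cauchy's theorem applies to the extension `H`.
  have hlo : (fun t => h t - h 0) =o[𝓝[≠] 0] fun t => (t - 0)⁻¹ := by
    rw [Asymptotics.isLittleO_iff_tendsto' (by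
      filter_upwards [self_mem_nhdsWithin] with t ht h0
      exact absurd (by simpa using h0) ht)]
    have h1 : Tendsto (fun t : ℂ => t * h 0) (𝓝[≠] 0) (𝓝 0) := by
      have : Tendsto (fun t : ℂ => t * h 0) (𝓝 0) (𝓝 (0 * h 0)) :=
        (continuous_id.mul continuous_const).tendsto _
      rw [zero_mul] at this
      exact this.mono_left nhdsWithin_le_nhds
    have := hres.sub h1
    rw [sub_zero] at this
    refine this.congr fun t => ?_
    simp [hh]; ring
  have hH := differentiableOn_update_limUnder_of_isLittleO hS hhd hlo
  set H := Function.update h 0 (limUnder (𝓝[≠] 0) h)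
  have hHe : ∀ t : ℂ, t ≠ 0 → H t = f t - principalPart A B C t := fun t ht => by
    simp [H, Function.update_of_ne ht, hh]
  have eL : ∀ u : ℝ, H (u + (-β : ℝ) * I) - H (u + β * I) =
      (f (u + (-β : ℝ) * I) - f (u + β * I)) - (principalPart A B C (u + (-β : ℝ) * I) -
      principalPart A B C (u + β * I)) := by
    intro u
    rw [hHe _ (ofReal_add_mul_I_ne_zero (neg_ne_zero.2 hβ.ne') u),
      hHe _ (ofReal_add_mul_I_ne_zero hβ.ne' u)]
    ring
  have key := integral_sub_horizontal_eq_zero (f := H) (a := -β) (b := β) (by linarith) hH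
    (g := fun u => g u + (‖A‖ * u⁻¹ ^ 3 + ‖B‖ * u⁻¹ ^ 2 + ‖C‖ * u⁻¹)) (by
      have hinv : Tendsto (fun u : ℝ => u⁻¹) atTop (𝓝 0) := tendsto_inv_atTop_zero
      simpa using hg.add ((((hinv.pow 3).const_mul ‖A‖).add ((hinv.pow 2).const_mul ‖B‖)).add
        (hinv.const_mul ‖C‖))) (by
      intro u hu t ht
      have hw : |u| ≤ ‖(u : ℂ) + t * I‖ := by
        simpa using Complex.abs_re_le_norm ((u : ℂ) + t * I)
      have hu0 : 0 < |u| := by linarith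
      have hw0 : (u : ℂ) + t * I ≠ 0 := norm_pos_iff.1 (hu0.trans_le hw)
      rw [hHe _ hw0]
      refine (norm_sub_le _ _).trans (add_le_add (hbound u hu t ht) ?_)
      have hi : ‖(u : ℂ) + t * I‖⁻¹ ≤ |u|⁻¹ := inv_anti₀ hu0 hw
      unfold principalPart
      refine (norm_add_le _ _).trans (add_le_add ((norm_add_le _ _).trans (add_le_add ?_ ?_)) ?_)
      all_goals
        rw [div_eq_mul_inv, norm_mul, norm_inv]
        try rw [norm_pow, ← inv_pow]
        gcongr) (by
      simp_rw [eL]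
      exact (ha.sub hb).sub hPi)
  simp_rw [eL] at key
  have hfi : Integrable fun u : ℝ => f (u + (-β : ℝ) * I) - f (u + β * I) := ha.sub hb
  rw [integral_sub hfi hPi, hP, integral_sub ha hb, sub_eq_zero] at key
  exact key

/-- Differentiation of a dominated holomorphic family under the integral sign. -/
theorem hasDerivAt_integral_of_dominated_holomorphic {P : Type*} [MeasurableSpace P]
    {μ : Measure P} {U : Set ℂ} (hU : IsOpen U) {F : ℂ → P → ℂ} {B : P → ℝ}
    (hmeas : ∀ w ∈ U, AEStronglyMeasurable (F w) μ)
    (hdiff : ∀ᵐ p ∂μ, DifferentiableOn ℂ (fun w => F w p) U)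
    (hB : Integrable B μ) (hbound : ∀ᵐ p ∂μ, ∀ w ∈ U, ‖F w p‖ ≤ B p) {w₀ : ℂ} (hw₀ : w₀ ∈ U) :
    HasDerivAt (fun w => ∫ p, F w p ∂μ) (∫ p, deriv (fun w => F w p) w₀ ∂μ) w₀ := by
  obtain ⟨R, hR, hRU⟩ := Metric.isOpen_iff.1 hU w₀ hw₀
  have hR2 : 0 < R / 2 := by positivity
  have hsub : Metric.ball w₀ (R / 2) ⊆ U :=
    (Metric.ball_subset_ball (by linarith)).trans hRU
  refine (hasDerivAt_integral_of_dominated_loc_of_deriv_le (Metric.ball_mem_nhds w₀ hR2)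
    (F' := fun w p => deriv (fun w => F w p) w) (bound := fun p => B p / (R / 4)) ?_ ?_ ?_ ?_ ?_
    ?_).2
  · filter_upwards [hU.mem_nhds hw₀] with w hw using hmeas w hw
  · exact hB.mono' (hmeas w₀ hw₀) (hbound.mono fun p hp => hp w₀ hw₀)
  -- Measurability of the derivative in the parameter: it is a limit of difference quotients along a
  -- sequence tending to `w₀`.
  · have hseq : ∀ n : ℕ, w₀ + ((R / 2 / (n + 2) : ℝ) : ℂ) ∈ U := by
      intro n
      apply hsub
      rw [Metric.mem_ball, dist_eq_norm, add_sub_cancel_left, Complex.norm_real, Real.norm_of_nonneg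
        (by positivity)]
      exact div_lt_self hR2 (by linarith [Nat.cast_nonneg (α := ℝ) n])
    refine aestronglyMeasurable_of_tendsto_ae atTop
      (f := fun (n : ℕ) p => (((R / 2 / (n + 2) : ℝ) : ℂ))⁻¹ •
        (F (w₀ + ((R / 2 / (n + 2) : ℝ) : ℂ)) p - F w₀ p))
      (fun n => ((hmeas _ (hseq n)).sub (hmeas w₀ hw₀)).const_smul
        (((R / 2 / (n + 2) : ℝ) : ℂ))⁻¹) ?_
    filter_upwards [hdiff] with p hp
    have hder := ((hp.differentiableAt (hU.mem_nhds hw₀)).hasDerivAt).tendsto_slope_zero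
    refine hder.comp (tendsto_nhdsWithin_iff.2 ⟨?_, Eventually.of_forall fun n => ?_⟩)
    · have h1 : Tendsto (fun n : ℕ => (R / 2 / ((n : ℝ) + 2) : ℝ)) atTop (𝓝 0) :=
        Tendsto.const_div_atTop (tendsto_atTop_add_const_right _ _ tendsto_natCast_atTop_atTop) _
      simpa [Function.comp_def] using (continuous_ofReal.tendsto 0).comp h1
    · have : (R / 2 / ((n : ℝ) + 2) : ℝ) ≠ 0 := by positivity
      simpa only [Set.mem_compl_iff, Set.mem_singleton_iff, ofReal_eq_zero] using this
  -- Cauchy's estimate on circles of radius R/4, which remain in `U` for centres within R/2 of `w₀`.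
  · filter_upwards [hdiff, hbound] with p hp hb w hw
    have hcb : Metric.closedBall w (R / 4) ⊆ U := by
      intro v hv
      apply hRU
      rw [Metric.mem_ball] at hw ⊢
      rw [Metric.mem_closedBall] at hv
      linarith [dist_triangle v w w₀]
    refine norm_deriv_le_of_forall_mem_sphere_norm_le (by positivity) ?_ fun v hv =>
      hb v (hcb (Metric.sphere_subset_closedBall hv))
    exact (hp.mono (by rw [closure_ball _ (by positivity)]; exact hcb)).diffContOnCl
  · exact hB.div_const _
  · filter_upwards [hdiff] with p hp w hw
    exact (hp.differentiableAt (hU.mem_nhds (hsub hw))).hasDerivAt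

theorem differentiableOn_integral_of_dominated_holomorphic {P : Type*} [MeasurableSpace P]
    {μ : Measure P} {U : Set ℂ} (hU : IsOpen U) {F : ℂ → P → ℂ} {B : P → ℝ}
    (hmeas : ∀ w ∈ U, AEStronglyMeasurable (F w) μ)
    (hdiff : ∀ᵐ p ∂μ, DifferentiableOn ℂ (fun w => F w p) U)
    (hB : Integrable B μ) (hbound : ∀ᵐ p ∂μ, ∀ w ∈ U, ‖F w p‖ ≤ B p) :
    DifferentiableOn ℂ (fun w => ∫ p, F w p ∂μ) U := fun _ hw =>
  (hasDerivAt_integral_of_dominated_holomorphic hU hmeas hdiff hB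
    hbound hw).differentiableAt.differentiableWithinAt

end HorizontalContours

/-! ### Bounds for the dilogarithm integrand and holomorphy of its integral. -/

section StripEstimates

theorem integrable_exp_neg_mul_abs {c : ℝ} (hc : 0 < c) :
    Integrable fun u : ℝ => Real.exp (-c * |u|) := by
  refine Integrable.mono' (integrable_inv_one_add_sq.const_mul (1 + 2 / c ^ 2))
    (by fun_prop) (Eventually.of_forall fun u => ?_)
  rw [Real.norm_of_nonneg (Real.exp_pos _).le, neg_mul, Real.exp_neg, ← div_eq_mul_inv,
    inv_le_comm₀ (Real.exp_pos _) (by positivity)]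
  have h := Real.quadratic_le_exp_of_nonneg (x := c * |u|) (by positivity)
  rw [inv_div, div_le_iff₀ (by positivity)]
  rw [mul_pow, sq_abs] at h
  have h1 : 1 + c ^ 2 * u ^ 2 / 2 ≤ Real.exp (c * |u|) := by
    have : 0 ≤ c * |u| := by positivity
    linarith
  calc 1 + u ^ 2 ≤ (1 + c ^ 2 * u ^ 2 / 2) * (1 + 2 / c ^ 2) := by
        have : (1 + c ^ 2 * u ^ 2 / 2) * (1 + 2 / c ^ 2) =
          1 + u ^ 2 + 2 / c ^ 2 + c ^ 2 * u ^ 2 / 2 := by field_simp; ring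
        rw [this]
        have : 0 ≤ 2 / c ^ 2 + c ^ 2 * u ^ 2 / 2 := by positivity
        linarith
    _ ≤ _ := by gcongr

theorem tendsto_exp_neg_mul_atTop {c : ℝ} (hc : 0 < c) :
    Tendsto (fun u : ℝ => Real.exp (-c * u)) atTop (𝓝 0) := by
  refine Real.tendsto_exp_atBot.comp ?_
  exact tendsto_id.const_mul_atTop_of_neg (by linarith)

/-- Both bounds are imaginary parts: of e^{v+iφ} - 1 itself, and of the same number rotated by
e^{-iφ}. -/
theorem abs_sin_mul_max_le_norm_exp_sub_one (v φ : ℝ) :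
    |Real.sin φ| * max 1 (Real.exp v) ≤ ‖exp (v + φ * I) - 1‖ := by
  have him : (exp (v + φ * I) - 1).im = Real.exp v * Real.sin φ := by
    simp [Complex.exp_im]
  have h2 : exp (v + φ * I) - 1 = exp (φ * I) * (exp v - exp (-(φ * I))) := by
    rw [mul_sub, ← Complex.exp_add, ← Complex.exp_add]; simp [add_comm]
  rw [mul_max_of_nonneg _ _ (abs_nonneg _), max_le_iff]
  constructor
  · rw [h2, norm_mul, norm_exp_ofReal_mul_I, one_mul, mul_one]
    have : (exp (v : ℂ) - exp (-(φ * I))).im = Real.sin φ := by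
      simp [Complex.exp_im]
    rw [← this]
    exact abs_im_le_norm _
  · have := abs_im_le_norm (exp (v + φ * I) - 1)
    rw [him, abs_mul, Real.abs_exp] at this
    linarith

theorem mul_max_le_norm_exp_sub_one {v₀ v : ℝ} (hv : v₀ ≤ |v|) (φ : ℝ) :
    (1 - Real.exp (-v₀)) * max 1 (Real.exp v) ≤ ‖exp (v + φ * I) - 1‖ := by
  have h1 : |Real.exp v - 1| ≤ ‖exp (v + φ * I) - 1‖ := by
    have := abs_norm_sub_norm_le (exp (v + φ * I)) 1
    simpa [Complex.norm_exp] using this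
  refine le_trans ?_ h1
  rcases le_total 0 v with h | h
  · rw [abs_of_nonneg h] at hv
    rw [max_eq_right (Real.one_le_exp h), abs_of_nonneg (by linarith [Real.one_le_exp h])]
    have : Real.exp (-v₀) * Real.exp v = Real.exp (v - v₀) := by rw [← Real.exp_add]; ring_nf
    have : 1 ≤ Real.exp (v - v₀) := Real.one_le_exp (by linarith)
    linarith
  · rw [abs_of_nonpos h] at hv
    have h3 : Real.exp v ≤ 1 := Real.exp_le_one_iff.2 h
    rw [max_eq_left h3, abs_of_nonpos (by linarith)]
    have : Real.exp v ≤ Real.exp (-v₀) := Real.exp_le_exp.2 (by linarith)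
    linarith

theorem max_le_norm_exp_sub_one {φ : ℝ} (hφ : exp (φ * I) = -1) (v : ℝ) :
    max 1 (Real.exp v) ≤ ‖exp (v + φ * I) - 1‖ := by
  have : exp (v + φ * I) - 1 = -((Real.exp v + 1 : ℝ) : ℂ) := by
    rw [Complex.exp_add, hφ]; push_cast; ring
  rw [this, norm_neg, Complex.norm_real, Real.norm_of_nonneg (by positivity)]
  exact max_le (by linarith [Real.exp_pos v]) (by linarith)

/-- The points `u + iτ` at which the denominators of the dilogarithm integrand are under control:
the lines `τ = ±b`, and everything away from the imaginary axis. -/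
def Controlled (b u τ : ℝ) : Prop := 1 ≤ |u| ∨ |τ| = b

theorem sin_pi_mul_sq_pos {b : ℝ} (hb0 : 0 < b) (hb1 : b < 1) : 0 < Real.sin (Real.pi * b ^ 2) := by
  refine Real.sin_pos_of_pos_of_lt_pi (by positivity) ?_
  have : b ^ 2 < 1 := by nlinarith
  nlinarith [Real.pi_pos]

/-- On the lines τ = ±b the two exponentials have constant phases: ±πb², whose sine does not vanish
because 0 < b² < 1, and ±π, where the exponential is negative. For |u| ≥ 1 the moduli of the
exponentials stay away from 1 whatever the phase. -/
theorem exists_le_norm_exp_sub_one {b : ℝ} (hb0 : 0 < b) (hb1 : b < 1) :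
    ∃ c > 0, ∀ u τ : ℝ, Controlled b u τ →
      c * max 1 (Real.exp (Real.pi * b * u)) ≤ ‖exp (Real.pi * b * (u + τ * I)) - 1‖ ∧
      c * max 1 (Real.exp (Real.pi * b⁻¹ * u)) ≤
        ‖exp (Real.pi * (b : ℂ)⁻¹ * (u + τ * I)) - 1‖ := by
  have hs := sin_pi_mul_sq_pos hb0 hb1
  have hπ := Real.pi_pos
  have h1 : 0 < 1 - Real.exp (-(Real.pi * b)) := by
    simpa using (by positivity : 0 < Real.pi * b)
  have h2 : 0 < 1 - Real.exp (-(Real.pi * b⁻¹)) := by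
    simpa using (by positivity : 0 < Real.pi * b⁻¹)
  set c := min (min (Real.sin (Real.pi * b ^ 2)) 1)
    (min (1 - Real.exp (-(Real.pi * b))) (1 - Real.exp (-(Real.pi * b⁻¹)))) with hc
  have e1 : ∀ u τ : ℝ, (Real.pi * b * (u + τ * I) : ℂ) =
      ((Real.pi * b * u : ℝ) : ℂ) + ((Real.pi * b * τ : ℝ) : ℂ) * I := by
    intro u τ; push_cast; ring
  have e2 : ∀ u τ : ℝ, (Real.pi * (b : ℂ)⁻¹ * (u + τ * I) : ℂ) =
      ((Real.pi * b⁻¹ * u : ℝ) : ℂ) + ((Real.pi * b⁻¹ * τ : ℝ) : ℂ) * I := by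
    intro u τ; push_cast; ring
  refine ⟨c, by positivity, fun u τ h => ?_⟩
  rw [e1, e2]
  rcases h with h | h
  · constructor
    · refine le_trans ?_ (mul_max_le_norm_exp_sub_one (v₀ := Real.pi * b) ?_ _)
      · gcongr
        exact (min_le_right _ _).trans (min_le_left _ _)
      · rw [abs_mul, abs_of_pos (by positivity)]
        exact le_mul_of_one_le_right (by positivity) h
    · refine le_trans ?_ (mul_max_le_norm_exp_sub_one (v₀ := Real.pi * b⁻¹) ?_ _)
      · gcongr
        exact (min_le_right _ _).trans (min_le_right _ _)
      · rw [abs_mul, abs_of_pos (by positivity)]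
        exact le_mul_of_one_le_right (by positivity) h
  · have hτ : τ = b ∨ τ = -b := eq_or_eq_neg_of_abs_eq h
    constructor
    · refine le_trans ?_ (abs_sin_mul_max_le_norm_exp_sub_one _ _)
      gcongr
      refine ((min_le_left _ _).trans (min_le_left _ _)).trans ?_
      rcases hτ with rfl | rfl
      · rw [mul_assoc, ← sq]; exact le_abs_self _
      · rw [mul_neg, Real.sin_neg, abs_neg, mul_assoc, ← sq]; exact le_abs_self _
    · refine le_trans ?_ (max_le_norm_exp_sub_one ?_ _)
      · refine mul_le_of_le_one_left (by positivity) ?_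
        exact (min_le_left _ _).trans (min_le_right _ _)
      · have hb : (b : ℂ) ≠ 0 := by exact_mod_cast hb0.ne'
        rcases hτ with rfl | rfl
        · rw [mul_assoc, inv_mul_cancel₀ hb0.ne', mul_one, exp_pi_mul_I]
        · rw [mul_assoc, mul_neg, inv_mul_cancel₀ hb0.ne', mul_neg, mul_one, ofReal_neg, neg_mul,
            exp_neg_pi_mul_I]

/-- For ε > 0 the quotient decays at both ends: x < κ is responsible for u → +∞ and x > 0 for u →
-∞. It is used with κ = Q and κ = 1/b. -/
theorem exp_div_max_le {x κ ε : ℝ} (h1 : ε ≤ x) (h2 : x ≤ κ - ε) (u : ℝ) :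
    Real.exp (Real.pi * u * x) ≤
      Real.exp (-(Real.pi * ε) * |u|) * max 1 (Real.exp (Real.pi * κ * u)) := by
  have hπ := Real.pi_pos
  rcases le_total 0 u with h | h
  · refine le_trans ?_ (mul_le_mul_of_nonneg_left (le_max_right _ _) (Real.exp_pos _).le)
    rw [← Real.exp_add, abs_of_nonneg h]
    apply Real.exp_le_exp.2
    nlinarith [mul_nonneg (mul_nonneg hπ.le h) (sub_nonneg.2 h2)]
  · refine le_trans ?_ (mul_le_mul_of_nonneg_left (le_max_left _ _) (Real.exp_pos _).le)
    rw [mul_one, abs_of_nonpos h]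
    apply Real.exp_le_exp.2
    nlinarith [mul_nonneg (mul_nonneg hπ.le (neg_nonneg.2 h)) (sub_nonneg.2 h1)]

theorem norm_exp_pi_mul (z : ℂ) (u τ : ℝ) :
    ‖exp (Real.pi * (u + τ * I) * z)‖ =
      Real.exp (Real.pi * u * z.re) * Real.exp (-(Real.pi * τ * z.im)) := by
  rw [Complex.norm_exp, ← Real.exp_add]
  congr 1
  simp
  ring

theorem bigQ_pos {b : ℝ} (hb0 : 0 < b) : 0 < bigQ b := by unfold bigQ; positivity

theorem b_mul_bigQ {b : ℝ} (hb0 : 0 < b) : b * bigQ b = b ^ 2 + 1 := by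
  unfold bigQ; field_simp

theorem b_lt_half_bigQ {b : ℝ} (hb0 : 0 < b) (hb1 : b < 1) : b < bigQ b / 2 := by
  have h : 1 < b⁻¹ := (one_lt_inv₀ hb0).2 hb1
  unfold bigQ; linarith

/-- The derivative in `z` of the difference of two neighbouring dilogarithm integrands. -/
noncomputable def logIntegrand (b : ℝ) (z t : ℂ) : ℂ :=
  exp (Real.pi * t * z) / (exp (Real.pi * (b : ℂ)⁻¹ * t) - 1)

/-- The factor e^{-πτ Im z} records the height of the contour. On τ = b it decays as Im z → +∞,
which gives the asymptotics of the dilogarithm in the upper half plane. -/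
theorem exists_norm_integrand_le {b : ℝ} (hb0 : 0 < b) (hb1 : b < 1) :
    ∃ C > 0, ∀ (ε : ℝ) (z : ℂ) (u τ : ℝ), Controlled b u τ → ε ≤ z.re →
      (z.re ≤ bigQ b - ε → ‖dilogIntegrand b z (u + τ * I)‖ ≤
        C * Real.exp (-(Real.pi * τ * z.im)) * Real.exp (-(Real.pi * ε) * |u|)) ∧
      (z.re ≤ b⁻¹ - ε → ‖logIntegrand b z (u + τ * I)‖ ≤
        C * Real.exp (-(Real.pi * τ * z.im)) * Real.exp (-(Real.pi * ε) * |u|)) := by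
  obtain ⟨c, hc, h⟩ := exists_le_norm_exp_sub_one hb0 hb1
  refine ⟨max (1 / (c ^ 2 * b)) (1 / c), by positivity, fun ε z u τ hcon h1 =>
    ⟨fun h2 => ?_, fun h2 => ?_⟩⟩
  · obtain ⟨h3, h4⟩ := h u τ hcon
    -- Either |u| ≥ 1 > b or |τ| = b.
    have ht : b ≤ ‖(u : ℂ) + τ * I‖ := by
      rcases hcon with hu | hτ
      · exact hb1.le.trans (hu.trans (by simpa using abs_re_le_norm ((u : ℂ) + τ * I)))
      · exact hτ.symm.le.trans (by simpa using abs_im_le_norm ((u : ℂ) + τ * I))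
    have hm : max 1 (Real.exp (Real.pi * bigQ b * u)) ≤
        max 1 (Real.exp (Real.pi * b * u)) * max 1 (Real.exp (Real.pi * b⁻¹ * u)) := by
      refine max_le ?_ ?_
      · exact one_le_mul_of_one_le_of_one_le (le_max_left _ _) (le_max_left _ _)
      · rw [bigQ, mul_add, add_mul, Real.exp_add]
        gcongr <;> exact le_max_right _ _
    have hnum := exp_div_max_le h1 h2 u
    unfold dilogIntegrand
    rw [norm_div, norm_exp_pi_mul, norm_mul, norm_mul]
    have hden : c ^ 2 * b * max 1 (Real.exp (Real.pi * bigQ b * u)) ≤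
        ‖exp (Real.pi * b * (u + τ * I)) - 1‖ *
          ‖exp (Real.pi * (b : ℂ)⁻¹ * (u + τ * I)) - 1‖ * ‖(u : ℂ) + τ * I‖ := by
      calc _ ≤ c ^ 2 * b * (max 1 (Real.exp (Real.pi * b * u)) *
              max 1 (Real.exp (Real.pi * b⁻¹ * u))) := by gcongr
        _ = (c * max 1 (Real.exp (Real.pi * b * u))) *
              (c * max 1 (Real.exp (Real.pi * b⁻¹ * u))) * b := by ring
        _ ≤ _ := by gcongr
    rw [div_le_iff₀ (lt_of_lt_of_le (by positivity) hden)]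
    calc _ ≤ Real.exp (-(Real.pi * ε) * |u|) * max 1 (Real.exp (Real.pi * bigQ b * u)) *
            Real.exp (-(Real.pi * τ * z.im)) := by gcongr
      _ = 1 / (c ^ 2 * b) * Real.exp (-(Real.pi * τ * z.im)) * Real.exp (-(Real.pi * ε) * |u|) *
            (c ^ 2 * b * max 1 (Real.exp (Real.pi * bigQ b * u))) := by field_simp
      _ ≤ _ := by
        gcongr
        exact le_max_left _ _
  · obtain ⟨-, h4⟩ := h u τ hcon
    have hnum := exp_div_max_le h1 h2 u
    unfold logIntegrand
    rw [norm_div, norm_exp_pi_mul, div_le_iff₀ (lt_of_lt_of_le (by positivity) h4)]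
    calc _ ≤ Real.exp (-(Real.pi * ε) * |u|) * max 1 (Real.exp (Real.pi * b⁻¹ * u)) *
            Real.exp (-(Real.pi * τ * z.im)) := by gcongr
      _ = 1 / c * Real.exp (-(Real.pi * τ * z.im)) * Real.exp (-(Real.pi * ε) * |u|) *
            (c * max 1 (Real.exp (Real.pi * b⁻¹ * u))) := by field_simp
      _ ≤ _ := by
        gcongr
        exact le_max_right _ _

theorem exp_sub_one_ne_zero_of_controlled {b : ℝ} (hb0 : 0 < b) (hb1 : b < 1) {u τ : ℝ}
    (h : Controlled b u τ) : exp (Real.pi * b * (u + τ * I)) - 1 ≠ 0 ∧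
      exp (Real.pi * (b : ℂ)⁻¹ * (u + τ * I)) - 1 ≠ 0 ∧ (u : ℂ) + τ * I ≠ 0 := by
  obtain ⟨c, hc, h'⟩ := exists_le_norm_exp_sub_one hb0 hb1
  obtain ⟨h1, h2⟩ := h' u τ h
  refine ⟨norm_pos_iff.1 (lt_of_lt_of_le (by positivity) h1),
    norm_pos_iff.1 (lt_of_lt_of_le (by positivity) h2), fun h0 => ?_⟩
  have hu : u = 0 := by simpa using congrArg re h0
  have hτ : τ = 0 := by simpa using congrArg im h0
  subst hu hτ
  rcases h with h | h
  · simp at h; linarith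
  · simp at h; exact hb0.ne h

theorem continuous_integrand_line {b : ℝ} (hb0 : 0 < b) (hb1 : b < 1) {τ : ℝ} (hτ : |τ| = b)
    (z : ℂ) : Continuous (fun u : ℝ => dilogIntegrand b z (u + τ * I)) ∧
      Continuous (fun u : ℝ => logIntegrand b z (u + τ * I)) := by
  have h := fun u : ℝ => exp_sub_one_ne_zero_of_controlled hb0 hb1 (u := u) (Or.inr hτ)
  unfold dilogIntegrand logIntegrand
  constructor
  · refine Continuous.div (by fun_prop) (by fun_prop) fun u => ?_
    exact mul_ne_zero (mul_ne_zero (h u).1 (h u).2.1) (h u).2.2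
  · exact Continuous.div (by fun_prop) (by fun_prop) fun u => (h u).2.1

theorem integrable_dilogIntegrand {b : ℝ} (hb0 : 0 < b) (hb1 : b < 1) {τ : ℝ} (hτ : |τ| = b)
    {z : ℂ} (h1 : 0 < z.re) (h2 : z.re < bigQ b) :
    Integrable fun u : ℝ => dilogIntegrand b z (u + τ * I) := by
  obtain ⟨C, hC, h⟩ := exists_norm_integrand_le hb0 hb1
  set ε := min z.re (bigQ b - z.re)
  have hε : 0 < ε := lt_min h1 (by linarith)
  refine ((integrable_exp_neg_mul_abs (c := Real.pi * ε) (by positivity)).const_mul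
    (C * Real.exp (-(Real.pi * τ * z.im)))).mono'
    (continuous_integrand_line hb0 hb1 hτ z).1.aestronglyMeasurable
    (Eventually.of_forall fun u => (h ε z u τ (Or.inr hτ) (min_le_left _ _)).1 ?_)
  linarith [min_le_right z.re (bigQ b - z.re)]

theorem integrable_logIntegrand {b : ℝ} (hb0 : 0 < b) (hb1 : b < 1) {τ : ℝ} (hτ : |τ| = b)
    {z : ℂ} (h1 : 0 < z.re) (h2 : z.re < b⁻¹) :
    Integrable fun u : ℝ => logIntegrand b z (u + τ * I) := by
  obtain ⟨C, hC, h⟩ := exists_norm_integrand_le hb0 hb1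
  set ε := min z.re (b⁻¹ - z.re)
  have hε : 0 < ε := lt_min h1 (by linarith)
  refine ((integrable_exp_neg_mul_abs (c := Real.pi * ε) (by positivity)).const_mul
    (C * Real.exp (-(Real.pi * τ * z.im)))).mono'
    (continuous_integrand_line hb0 hb1 hτ z).2.aestronglyMeasurable
    (Eventually.of_forall fun u => (h ε z u τ (Or.inr hτ) (min_le_left _ _)).2 ?_)
  linarith [min_le_right z.re (b⁻¹ - z.re)]

/-- The contour integral in the exponent of the dilogarithm. -/
noncomputable def dilogExponent (b : ℝ) (z : ℂ) : ℂ :=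
  ∫ u : ℝ, dilogIntegrand b z ((u : ℂ) + b * I)

theorem exists_norm_dilogExponent_le {b : ℝ} (hb0 : 0 < b) (hb1 : b < 1) {ε : ℝ} (hε : 0 < ε) :
    ∃ C > 0, ∀ z : ℂ, ε ≤ z.re → z.re ≤ bigQ b - ε →
      ‖dilogExponent b z‖ ≤ C * Real.exp (-(Real.pi * b * z.im)) := by
  obtain ⟨C, hC, h⟩ := exists_norm_integrand_le hb0 hb1
  have hi := integrable_exp_neg_mul_abs (c := Real.pi * ε) (by positivity)
  have hnn : 0 ≤ ∫ u : ℝ, Real.exp (-(Real.pi * ε) * |u|) :=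
    integral_nonneg fun u => (Real.exp_pos _).le
  refine ⟨C * (∫ u : ℝ, Real.exp (-(Real.pi * ε) * |u|)) + 1, by positivity,
    fun z h1 h2 => ?_⟩
  have := norm_integral_le_of_norm_le (hi.const_mul (C * Real.exp (-(Real.pi * b * z.im))))
    (Eventually.of_forall fun u : ℝ => (h ε z u b (Or.inr (abs_of_pos hb0)) h1).1 h2)
  rw [integral_const_mul] at this
  refine this.trans ?_
  nlinarith [Real.exp_pos (-(Real.pi * b * z.im))]

theorem isOpen_substrip (x₁ x₂ y : ℝ) :
    IsOpen {z : ℂ | x₁ < z.re ∧ z.re < x₂ ∧ y < z.im} :=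
  (isOpen_lt continuous_const continuous_re).inter
    ((isOpen_lt continuous_re continuous_const).inter (isOpen_lt continuous_const continuous_im))

theorem differentiableAt_dilogExponent {b : ℝ} (hb0 : 0 < b) (hb1 : b < 1) {z : ℂ}
    (h1 : 0 < z.re) (h2 : z.re < bigQ b) : DifferentiableAt ℂ (dilogExponent b) z := by
  obtain ⟨C, hC, h⟩ := exists_norm_integrand_le hb0 hb1
  set ε := min z.re (bigQ b - z.re) / 2
  have hε : 0 < ε := half_pos (lt_min h1 (by linarith))
  have hε1 : ε < z.re := by
    have := min_le_left z.re (bigQ b - z.re); simp only [ε]; linarith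
  have hε2 : z.re < bigQ b - ε := by
    have := min_le_right z.re (bigQ b - z.re); simp only [ε]; linarith
  have hU := isOpen_substrip ε (bigQ b - ε) (z.im - 1)
  refine (hasDerivAt_integral_of_dominated_holomorphic hU
    (B := fun u => C * Real.exp (-(Real.pi * b * (z.im - 1))) * Real.exp (-(Real.pi * ε) * |u|))
    ?_ ?_ ?_ ?_ (w₀ := z) ⟨hε1, hε2, by linarith⟩).differentiableAt
  · intro w _
    exact (continuous_integrand_line hb0 hb1 (abs_of_pos hb0) w).1.aestronglyMeasurable
  · refine Eventually.of_forall fun u => ?_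
    unfold dilogIntegrand
    fun_prop
  · exact (integrable_exp_neg_mul_abs (c := Real.pi * ε) (by positivity)).const_mul _
  · refine Eventually.of_forall fun u w hw => ?_
    refine ((h ε w u b (Or.inr (abs_of_pos hb0)) hw.1.le).1 hw.2.1.le).trans ?_
    gcongr
    exact hw.2.2.le

end StripEstimates

/-! ### The functional equation under z ↦ z + b. -/

section FunctionalEquation

/-- The zeros are the points 2in/κ with n an integer; only n = 0 satisfies the bound on the
imaginary part. -/
theorem exp_mul_sub_one_ne_zero {κ : ℝ} (hκ : 0 < κ) {t : ℂ} (ht : t ≠ 0) (him : κ * |t.im| < 2) :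
    exp (Real.pi * κ * t) - 1 ≠ 0 := by
  intro h
  obtain ⟨n, hn⟩ := Complex.exp_eq_one_iff.1 (sub_eq_zero.1 h)
  have hπ : (Real.pi : ℂ) ≠ 0 := by exact_mod_cast Real.pi_ne_zero
  have h2 : (κ : ℂ) * t = ((2 * n : ℝ) : ℂ) * I := by
    apply mul_left_cancel₀ hπ
    push_cast
    linear_combination hn
  have hre := congrArg re h2
  have him' := congrArg im h2
  simp only [mul_re, ofReal_re, ofReal_im, zero_mul, sub_zero, mul_im, I_re, I_im, mul_zero,
    mul_one, add_zero] at hre him'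
  have h3 : |κ * t.im| < 2 := by rwa [abs_mul, abs_of_pos hκ]
  rw [him', abs_mul, abs_two] at h3
  have h4 : |n| < 1 := by
    have : |(n : ℝ)| < 1 := by linarith
    exact_mod_cast this
  rw [Int.abs_lt_one_iff] at h4
  subst h4
  simp at hre him'
  exact ht (Complex.ext (by simpa [hκ.ne'] using hre) (by simpa [hκ.ne'] using him'))

theorem denominators_ne_zero {b : ℝ} (hb0 : 0 < b) (hb1 : b < 1) {t : ℂ}
    (ht : t ∈ ({w | w.im ∈ Set.Icc (-b) b} : Set ℂ) \ {0}) :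
    exp (Real.pi * b * t) - 1 ≠ 0 ∧ exp (Real.pi * (b : ℂ)⁻¹ * t) - 1 ≠ 0 ∧ t ≠ 0 := by
  have h0 : t ≠ 0 := ht.2
  have him : |t.im| ≤ b := abs_le.2 ht.1
  refine ⟨exp_mul_sub_one_ne_zero hb0 h0 (by nlinarith), ?_, h0⟩
  rw [← ofReal_inv]
  refine exp_mul_sub_one_ne_zero (inv_pos.2 hb0) h0 ?_
  calc b⁻¹ * |t.im| ≤ b⁻¹ * b := by gcongr
    _ < 2 := by rw [inv_mul_cancel₀ hb0.ne']; norm_num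

theorem tendsto_ofReal_mul_exp_remainder (c : ℂ) (n : ℕ) :
    Tendsto (fun t : ℂ => (exp (c * t) - ∑ i ∈ Finset.range (n + 1), (c * t) ^ i / i.factorial) /
      t ^ n) (𝓝[≠] 0) (𝓝 0) := by
  have h := Complex.exp_sub_sum_range_succ_isLittleO_pow n
  have hc : Tendsto (fun t : ℂ => c * t) (𝓝[≠] 0) (𝓝 0) := by
    have : Tendsto (fun t : ℂ => c * t) (𝓝 0) (𝓝 (c * 0)) :=
      (continuous_const.mul continuous_id).tendsto _
    rw [mul_zero] at this
    exact this.mono_left nhdsWithin_le_nhds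
  have h2 := h.comp_tendsto hc
  have h3 : (fun t : ℂ => (c * t) ^ n) =O[𝓝[≠] 0] fun t => t ^ n := by
    simp_rw [mul_pow]
    exact Asymptotics.isBigO_const_mul_self _ _ _
  have h4 := h2.trans_isBigO h3
  exact h4.tendsto_div_nhds_zero

theorem tendsto_logIntegrand_residue {b : ℝ} (hb0 : 0 < b) (z : ℂ) :
    Tendsto (fun t => t * (logIntegrand b z t - principalPart 0 0 (b / Real.pi) t))
      (𝓝[≠] 0) (𝓝 0) := by
  have hπ : (Real.pi : ℂ) ≠ 0 := by exact_mod_cast Real.pi_ne_zero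
  have hb : (b : ℂ) ≠ 0 := by exact_mod_cast hb0.ne'
  set c : ℂ := Real.pi * (b : ℂ)⁻¹ with hc
  have hc0 : c ≠ 0 := by simp [hc, hπ, hb]
  have h1 := tendsto_ofReal_mul_exp_remainder c 1
  have h2 : Tendsto (fun t : ℂ => exp (Real.pi * t * z)) (𝓝[≠] 0) (𝓝 1) := by
    have : Tendsto (fun t : ℂ => exp (Real.pi * t * z)) (𝓝 0) (𝓝 (exp (Real.pi * 0 * z))) :=
      Continuous.tendsto (by fun_prop) _
    simp only [mul_zero, zero_mul, Complex.exp_zero] at this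
    exact this.mono_left nhdsWithin_le_nhds
  have h3 := h2.div (h1.const_add c) (by simpa using hc0)
  have h4 := h3.sub_const (b / Real.pi : ℂ)
  have e : (1 : ℂ) / (c + 0) - b / Real.pi = 0 := by
    simp [hc, div_eq_mul_inv, mul_comm]
  rw [e] at h4
  refine h4.congr' ?_
  filter_upwards [self_mem_nhdsWithin] with t ht
  have ht : t ≠ 0 := ht
  have e2 : c + (exp (c * t) - ∑ i ∈ Finset.range (1 + 1), (c * t) ^ i / i.factorial) / t ^ 1 =
      (exp (c * t) - 1) / t := by
    simp [Finset.sum_range_succ]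
    field_simp
    ring
  simp only [Pi.div_apply]
  rw [e2]
  unfold logIntegrand principalPart
  rw [← hc]
  by_cases h0 : exp (c * t) - 1 = 0
  · simp [h0]
    field_simp
  · field_simp
    ring

/-- The denominator of `logIntegrand` has period 2ib, exactly the distance between the lines Im t =
±b. The two line integrals are therefore proportional, with ratio e^{-2πibz}, and the residue b/π at
0 determines them. The right side is minus the derivative of 1 - e^{2πibz}. -/
theorem integral_logIntegrand {b : ℝ} (hb0 : 0 < b) (hb1 : b < 1) {z : ℂ}
    (h1 : 0 < z.re) (h2 : z.re < b⁻¹) :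
    (1 - exp (2 * Real.pi * I * b * z)) * (Real.pi * ∫ u : ℝ, logIntegrand b z (u + b * I)) =
      2 * Real.pi * I * b * exp (2 * Real.pi * I * b * z) := by
  have hπ : (Real.pi : ℂ) ≠ 0 := by exact_mod_cast Real.pi_ne_zero
  have hb : (b : ℂ) ≠ 0 := by exact_mod_cast hb0.ne'
  obtain ⟨C, hC, h⟩ := exists_norm_integrand_le hb0 hb1
  set ε := min z.re (b⁻¹ - z.re)
  have hε : 0 < ε := lt_min h1 (by linarith)
  have hgt : Tendsto (fun u => C * Real.exp (Real.pi * b * |z.im|) * Real.exp (-(Real.pi * ε) * u))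
      atTop (𝓝 0) := by
    simpa using (tendsto_exp_neg_mul_atTop (c := Real.pi * ε) (by positivity)).const_mul
      (C * Real.exp (Real.pi * b * |z.im|))
  have key := integral_sub_horizontal_eq_residue hb0 (A := 0) (B := 0) (C := b / Real.pi)
    (f := logIntegrand b z) (by
      intro t ht
      obtain ⟨-, h3, -⟩ := denominators_ne_zero hb0 hb1 ht
      refine DifferentiableAt.differentiableWithinAt ?_
      unfold logIntegrand
      fun_prop (disch := exact h3)) (tendsto_logIntegrand_residue hb0 z)
    (g := fun u => C * Real.exp (Real.pi * b * |z.im|) * Real.exp (-(Real.pi * ε) * u))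
    hgt
    (by
      intro u hu t ht
      refine ((h ε z u t (Or.inl hu) (min_le_left _ _)).2 ?_).trans ?_
      · linarith [min_le_right z.re (b⁻¹ - z.re)]
      · gcongr
        have : |t * z.im| ≤ b * |z.im| := by
          rw [abs_mul]; gcongr; exact abs_le.2 ht
        nlinarith [neg_abs_le (t * z.im), Real.pi_pos])
    (integrable_logIntegrand hb0 hb1 (by rw [abs_neg, abs_of_pos hb0]) h1 h2)
    (integrable_logIntegrand hb0 hb1 (abs_of_pos hb0) h1 h2)
  have e : ∀ u : ℝ, logIntegrand b z (u + (-b : ℝ) * I) =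
      exp (-(2 * Real.pi * I * b * z)) * logIntegrand b z (u + b * I) := by
    intro u
    unfold logIntegrand
    have e1 : (Real.pi * (b : ℂ)⁻¹ * (u + b * I) : ℂ) =
        Real.pi * (b : ℂ)⁻¹ * (u + (-b : ℝ) * I) + 2 * Real.pi * I := by
      push_cast; field_simp; ring
    rw [e1, Complex.exp_add, Complex.exp_two_pi_mul_I, mul_one, ← mul_div_assoc, ← Complex.exp_add]
    congr 2
    push_cast
    ring
  simp_rw [e] at key
  rw [integral_const_mul] at key
  set M := ∫ u : ℝ, logIntegrand b z (u + b * I)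
  have hE : exp (-(2 * Real.pi * I * b * z)) * exp (2 * Real.pi * I * b * z) = 1 := by
    rw [← Complex.exp_add]; simp
  have key2 : exp (-(2 * Real.pi * I * b * z)) * M - M = 2 * I * b := by
    rw [key]; field_simp
  linear_combination (Real.pi : ℂ) * exp (2 * Real.pi * I * b * z) * key2 - Real.pi * M * hE

theorem dilogIntegrand_add_sub {b : ℝ} (hb0 : 0 < b) (hb1 : b < 1) (z : ℂ) (u : ℝ) :
    dilogIntegrand b (z + b) (u + b * I) - dilogIntegrand b z (u + b * I) =
      logIntegrand b z (u + b * I) / (u + b * I) := by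
  obtain ⟨h1, h2, h3⟩ := exp_sub_one_ne_zero_of_controlled hb0 hb1 (u := u) (τ := b)
    (Or.inr (abs_of_pos hb0))
  unfold dilogIntegrand logIntegrand
  set t : ℂ := u + b * I
  have e : exp (Real.pi * t * (z + b)) = exp (Real.pi * t * z) * exp (Real.pi * b * t) := by
    rw [← Complex.exp_add]; ring_nf
  rw [e]
  generalize exp (Real.pi * b * t) = X at *
  generalize exp (Real.pi * (b : ℂ)⁻¹ * t) = Y at *
  field_simp

/-- The shift by b cancels the factor e^{πbt} - 1 of the denominator, and differentiation in z
cancels 1/t. What remains has a simple pole and can be integrated by residues. -/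
theorem hasDerivAt_dilogExponent_add_sub {b : ℝ} (hb0 : 0 < b) (hb1 : b < 1) {z : ℂ}
    (h1 : 0 < z.re) (h2 : z.re < b⁻¹) :
    HasDerivAt (fun z => dilogExponent b (z + b) - dilogExponent b z)
      (Real.pi * ∫ u : ℝ, logIntegrand b z (u + b * I)) z := by
  obtain ⟨C, hC, h⟩ := exists_norm_integrand_le hb0 hb1
  set ε := min z.re (b⁻¹ - z.re) / 2
  have hε : 0 < ε := half_pos (lt_min h1 (by linarith))
  have hε1 : ε < z.re := by
    have := min_le_left z.re (b⁻¹ - z.re); simp only [ε]; linarith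
  have hε2 : z.re < b⁻¹ - ε := by
    have := min_le_right z.re (b⁻¹ - z.re); simp only [ε]; linarith
  have hU := isOpen_substrip ε (b⁻¹ - ε) (z.im - 1)
  have hzU : z ∈ {z' : ℂ | ε < z'.re ∧ z'.re < b⁻¹ - ε ∧ z.im - 1 < z'.im} :=
    ⟨hε1, hε2, by linarith⟩
  have key := hasDerivAt_integral_of_dominated_holomorphic hU
    (F := fun w (u : ℝ) => dilogIntegrand b (w + b) (u + b * I) - dilogIntegrand b w (u + b * I))
    (μ := volume)
    (B := fun u => C * Real.exp (-(Real.pi * b * (z.im - 1))) * Real.exp (-(Real.pi * ε) * |u|) +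
      C * Real.exp (-(Real.pi * b * (z.im - 1))) * Real.exp (-(Real.pi * ε) * |u|))
    (by
      intro w _
      exact ((continuous_integrand_line hb0 hb1 (abs_of_pos hb0) _).1.sub
        (continuous_integrand_line hb0 hb1 (abs_of_pos hb0) _).1).aestronglyMeasurable)
    (by
      refine Eventually.of_forall fun u => ?_
      unfold dilogIntegrand
      fun_prop)
    (by
      have := (integrable_exp_neg_mul_abs (c := Real.pi * ε) (by positivity)).const_mul
        (C * Real.exp (-(Real.pi * b * (z.im - 1))))
      exact this.add this)
    (by
      refine Eventually.of_forall fun u w hw => (norm_sub_le _ _).trans (add_le_add ?_ ?_)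
      · have h3 := hw.1
        have h4 := hw.2.1
        have h5 := hw.2.2
        refine ((h ε (w + b) u b (Or.inr (abs_of_pos hb0)) (by simp; linarith)).1
          (by simp [bigQ]; linarith)).trans ?_
        have : (w + b).im = w.im := by simp
        rw [this]
        gcongr
      · have h3 := hw.1
        have h4 := hw.2.1
        have h5 := hw.2.2
        refine ((h ε w u b (Or.inr (abs_of_pos hb0)) hw.1.le).1
          (by simp [bigQ]; linarith)).trans ?_
        gcongr) hzU
  have ederiv : ∀ u : ℝ, deriv (fun w => dilogIntegrand b (w + b) (u + b * I) -
      dilogIntegrand b w (u + b * I)) z = Real.pi * logIntegrand b z (u + b * I) := by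
    intro u
    simp_rw [dilogIntegrand_add_sub hb0 hb1]
    obtain ⟨-, h4, h3⟩ := exp_sub_one_ne_zero_of_controlled hb0 hb1 (u := u) (τ := b)
      (Or.inr (abs_of_pos hb0))
    unfold logIntegrand
    set t : ℂ := u + b * I
    have hd : HasDerivAt (fun w => exp (Real.pi * t * w)) (exp (Real.pi * t * z) * (Real.pi * t)) z := by
      simpa using ((hasDerivAt_id z).const_mul (Real.pi * t : ℂ)).cexp
    rw [((hd.div_const _).div_const _).deriv]
    field_simp
  simp_rw [ederiv] at key
  rw [integral_const_mul] at key
  refine key.congr_of_eventuallyEq ?_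
  filter_upwards [hU.mem_nhds hzU] with w hw
  have h3 := hw.1
  have h4 := hw.2.1
  refine (integral_sub (integrable_dilogIntegrand hb0 hb1 (abs_of_pos hb0) ?_ ?_)
    (integrable_dilogIntegrand hb0 hb1 (abs_of_pos hb0) ?_ ?_)).symm
  · simp; linarith
  · simp [bigQ]; linarith
  · linarith
  · simp [bigQ]; linarith

theorem tendsto_dilogExponent_vertical {b : ℝ} (hb0 : 0 < b) (hb1 : b < 1) {x : ℝ}
    (h1 : 0 < x) (h2 : x < bigQ b) :
    Tendsto (fun y : ℝ => dilogExponent b (x + y * I)) atTop (𝓝 0) := by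
  obtain ⟨C, hC, h⟩ := exists_norm_dilogExponent_le hb0 hb1 (ε := min x (bigQ b - x))
    (lt_min h1 (by linarith))
  refine squeeze_zero_norm (a := fun y => C * Real.exp (-(Real.pi * b) * y)) (fun y => ?_) ?_
  · have := h (x + y * I) (by simp) (by
      simp only [add_re, ofReal_re, mul_re, I_re, mul_zero, ofReal_im, I_im, mul_one, sub_self,
        add_zero]
      linarith [min_le_right x (bigQ b - x)])
    simpa using this
  · simpa using (tendsto_exp_neg_mul_atTop (c := Real.pi * b) (by positivity)).const_mul C

/-- The product of 1 - e^{2πibz} with the exponential of the difference of exponents has derivative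
zero by `integral_logIntegrand`. It is constant on the strip 0 < Re z < 1/b, and the constant is 1,
the limit as Im z → +∞. -/
theorem exp_dilogExponent_add {b : ℝ} (hb0 : 0 < b) (hb1 : b < 1) {z : ℂ}
    (h1 : 0 < z.re) (h2 : z.re < b⁻¹) :
    exp (-dilogExponent b (z + b)) =
      (1 - exp (2 * Real.pi * I * b * z)) * exp (-dilogExponent b z) := by
  set K : ℂ → ℂ := fun z => dilogExponent b (z + b) - dilogExponent b z with hK
  set W : ℂ → ℂ := fun z => (1 - exp (2 * Real.pi * I * b * z)) * exp (K z) with hW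
  set S : Set ℂ := re ⁻¹' Set.Ioo 0 b⁻¹ with hS
  have hSo : IsOpen S := isOpen_Ioo.preimage continuous_re
  have hSc : Convex ℝ S := (convex_Ioo 0 b⁻¹).linear_preimage reLm
  have hder : ∀ w ∈ S, HasDerivAt W 0 w := by
    intro w hw
    have hd1 := hasDerivAt_dilogExponent_add_sub hb0 hb1 hw.1 hw.2
    have hd2 : HasDerivAt (fun w => 1 - exp (2 * Real.pi * I * b * w))
        (-(exp (2 * Real.pi * I * b * w) * (2 * Real.pi * I * b))) w := by
      simpa using (((hasDerivAt_id w).const_mul (2 * Real.pi * I * b : ℂ)).cexp).const_sub 1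
    refine (hd2.mul hd1.cexp).congr_deriv ?_
    linear_combination exp (K w) * integral_logIntegrand hb0 hb1 hw.1 hw.2
  have hconst : ∀ w ∈ S, W w = W z := by
    intro w hw
    refine hSc.is_const_of_fderivWithin_eq_zero (𝕜 := ℂ)
      (fun v hv => (hder v hv).differentiableAt.differentiableWithinAt) (fun v hv => ?_) hw ⟨h1, h2⟩
    rw [fderivWithin_of_isOpen hSo hv]
    have := (hder v hv).hasFDerivAt.fderiv
    rw [this]
    ext
    simp
  have hlim : Tendsto (fun y : ℝ => W (z.re + y * I)) atTop (𝓝 1) := by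
    have hlt : z.re + b < bigQ b := by unfold bigQ; linarith
    have l1 := tendsto_dilogExponent_vertical hb0 hb1 (x := z.re + b) (by linarith) hlt
    have l2 := tendsto_dilogExponent_vertical hb0 hb1 (x := z.re) h1 (by linarith)
    have l3 : Tendsto (fun y : ℝ => K (z.re + y * I)) atTop (𝓝 0) := by
      have := l1.sub l2
      rw [sub_zero] at this
      refine this.congr fun y => ?_
      simp only [hK]
      congr 2
      push_cast
      ring
    have l4 : Tendsto (fun y : ℝ => exp (2 * Real.pi * I * b * (z.re + y * I))) atTop (𝓝 0) := by
      refine squeeze_zero_norm (a := fun y => Real.exp (-(2 * Real.pi * b) * y)) (fun y => ?_)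
        (tendsto_exp_neg_mul_atTop (c := 2 * Real.pi * b) (by positivity))
      rw [Complex.norm_exp]
      simp
    have l5 := ((l4.const_sub 1).mul ((continuous_exp.tendsto 0).comp l3))
    simpa using l5
  have hone : W z = 1 := by
    refine tendsto_nhds_unique (tendsto_const_nhds.congr fun y => (hconst _ ?_).symm) hlim
    simpa [hS] using ⟨h1, h2⟩
  have hexp : exp (-dilogExponent b (z + b)) = exp (-K z) * exp (-dilogExponent b z) := by
    rw [← Complex.exp_add]; simp only [hK]; ring_nf
  have h3 : exp (K z) * exp (-K z) = 1 := by rw [← Complex.exp_add]; simp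
  rw [hexp]
  simp only [hW] at hone
  linear_combination -(exp (-K z) * exp (-dilogExponent b z)) * hone + (1 - exp (2 * Real.pi * I * b * z)) * exp (-dilogExponent b z) * h3

end FunctionalEquation

/-! ### Reflection formula, functional equation and growth of S_b. -/

section QuantumDilogarithm

/-- The hypotheses `hA`, `hB`, `hC` equate the coefficients of 1, t and t² in numerator =
denominator · (A + Bt + Ct²). The error is o(t²), while the denominator tends to a₀b₀ ≠ 0. -/
theorem tendsto_expansion_quotient {l : Filter ℂ} (hl : l ≤ 𝓝[≠] 0)
    {a₀ a₁ a₂ b₀ b₁ b₂ A B C n₁ n₂ : ℂ} (hA : A * (a₀ * b₀) = 1)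
    (hB : A * (a₀ * b₁ + a₁ * b₀) + B * (a₀ * b₀) = n₁)
    (hC : A * (a₀ * b₂ + a₁ * b₁ + a₂ * b₀) + B * (a₀ * b₁ + a₁ * b₀) + C * (a₀ * b₀) = n₂)
    {N r₁ r₂ : ℂ → ℂ} (hN : Tendsto N l (𝓝 0)) (h₁ : Tendsto r₁ l (𝓝 0))
    (h₂ : Tendsto r₂ l (𝓝 0)) :
    Tendsto (fun t => ((1 + n₁ * t + n₂ * t ^ 2 + t ^ 2 * N t) -
      (a₀ + a₁ * t + a₂ * t ^ 2 + t ^ 2 * r₁ t) * (b₀ + b₁ * t + b₂ * t ^ 2 + t ^ 2 * r₂ t) *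
        (A + B * t + C * t ^ 2)) / t ^ 2 /
      ((a₀ + a₁ * t + a₂ * t ^ 2 + t ^ 2 * r₁ t) * (b₀ + b₁ * t + b₂ * t ^ 2 + t ^ 2 * r₂ t)))
      l (𝓝 0) := by
  have ht : Tendsto (fun t : ℂ => t) l (𝓝 0) := (hl.trans nhdsWithin_le_nhds)
  have hP : ∀ (c₀ c₁ c₂ : ℂ) (r : ℂ → ℂ), Tendsto r l (𝓝 0) →
      Tendsto (fun t => c₀ + c₁ * t + c₂ * t ^ 2 + t ^ 2 * r t) l (𝓝 c₀) := by
    intro c₀ c₁ c₂ r hr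
    simpa using (((ht.const_mul c₁).const_add c₀).add ((ht.pow 2).const_mul c₂)).add
      ((ht.pow 2).mul hr)
  have hab : a₀ * b₀ ≠ 0 := right_ne_zero_of_mul_eq_one hA
  have hden := (hP a₀ a₁ a₂ r₁ h₁).mul (hP b₀ b₁ b₂ r₂ h₂)
  have hR : Tendsto (fun t => N t - t * ((C * (a₀ * b₁ + a₁ * b₀) +
      B * (a₀ * b₂ + a₁ * b₁ + a₂ * b₀) + A * (a₁ * b₂ + a₂ * b₁)) +
      (C * (a₀ * b₂ + a₁ * b₁ + a₂ * b₀) + B * (a₁ * b₂ + a₂ * b₁) + A * (a₂ * b₂)) * t +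
      (C * (a₁ * b₂ + a₂ * b₁) + B * (a₂ * b₂)) * t ^ 2 + t ^ 2 * (C * (a₂ * b₂) * t)) -
      (r₁ t * (b₀ + b₁ * t + b₂ * t ^ 2 + t ^ 2 * r₂ t) + r₂ t * (a₀ + a₁ * t + a₂ * t ^ 2 + t ^ 2 * 0)) *
        (A + B * t + C * t ^ 2 + t ^ 2 * 0)) l (𝓝 0) := by
    have h0 : Tendsto (fun _ : ℂ => (0 : ℂ)) l (𝓝 0) := tendsto_const_nhds
    have q1 := hP (C * (a₀ * b₁ + a₁ * b₀) +
      B * (a₀ * b₂ + a₁ * b₁ + a₂ * b₀) + A * (a₁ * b₂ + a₂ * b₁))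
      (C * (a₀ * b₂ + a₁ * b₁ + a₂ * b₀) + B * (a₁ * b₂ + a₂ * b₁) + A * (a₂ * b₂))
      (C * (a₁ * b₂ + a₂ * b₁) + B * (a₂ * b₂)) (fun t => C * (a₂ * b₂) * t)
      (by simpa using ht.const_mul (C * (a₂ * b₂)))
    have q2 := ((h₁.mul (hP b₀ b₁ b₂ r₂ h₂)).add (h₂.mul (hP a₀ a₁ a₂ _ h0))).mul (hP A B C _ h0)
    simpa using (hN.sub (ht.mul q1)).sub q2
  have hq := hR.div hden hab
  rw [zero_div] at hq
  refine hq.congr' ?_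
  filter_upwards [hl self_mem_nhdsWithin] with t ht0
  have ht0 : t ≠ 0 := ht0
  simp only [Pi.div_apply]
  congr 1
  rw [eq_div_iff (pow_ne_zero 2 ht0)]
  linear_combination hA + t * hB + t ^ 2 * hC

/-- The denominator factors are expanded as (e^{ct} - 1)/t = c + c²t/2 + c³t²/6 + … for c = πb and c
= π/b, the numerator as e^{πzt}. Centring at z = Q/2 gives the coefficients the displayed form. -/
theorem tendsto_dilogIntegrand_residue {b : ℝ} (hb0 : 0 < b) (z : ℂ) :
    Tendsto (fun t => t * (dilogIntegrand b z t - principalPart (1 / Real.pi ^ 2)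
      ((z - bigQ b / 2) / Real.pi) ((z - bigQ b / 2) ^ 2 / 2 -
        ((b : ℂ) ^ 2 + ((b : ℂ)⁻¹) ^ 2) / 24) t)) (𝓝[≠] 0) (𝓝 0) := by
  have hπ : (Real.pi : ℂ) ≠ 0 := by exact_mod_cast Real.pi_ne_zero
  have hb : (b : ℂ) ≠ 0 := by exact_mod_cast hb0.ne'
  set c₁ : ℂ := Real.pi * b with hc₁
  set c₂ : ℂ := Real.pi * (b : ℂ)⁻¹ with hc₂
  have hQ : (bigQ b : ℂ) = b + (b : ℂ)⁻¹ := by simp [bigQ]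
  have key := tendsto_expansion_quotient (l := 𝓝[≠] 0) le_rfl
    (a₀ := c₁) (a₁ := c₁ ^ 2 / 2) (a₂ := c₁ ^ 3 / 6) (b₀ := c₂) (b₁ := c₂ ^ 2 / 2)
    (b₂ := c₂ ^ 3 / 6) (A := 1 / Real.pi ^ 2) (B := (z - bigQ b / 2) / Real.pi)
    (C := (z - bigQ b / 2) ^ 2 / 2 - ((b : ℂ) ^ 2 + ((b : ℂ)⁻¹) ^ 2) / 24)
    (n₁ := Real.pi * z) (n₂ := (Real.pi * z) ^ 2 / 2)
    (by rw [hc₁, hc₂]; field_simp)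
    (by rw [hc₁, hc₂, hQ]; field_simp; ring)
    (by rw [hc₁, hc₂, hQ]; field_simp; ring)
    (tendsto_ofReal_mul_exp_remainder (Real.pi * z) 2)
    (tendsto_ofReal_mul_exp_remainder c₁ 3) (tendsto_ofReal_mul_exp_remainder c₂ 3)
  have hne : ∀ κ : ℝ, 0 < κ → ∀ᶠ t : ℂ in 𝓝[≠] 0, exp (Real.pi * κ * t) - 1 ≠ 0 := by
    intro κ hκ
    have h1 : ∀ᶠ t : ℂ in 𝓝 0, κ * |t.im| < 2 := by
      have : ContinuousAt (fun t : ℂ => κ * |t.im|) 0 := by fun_prop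
      exact this.eventually_lt continuousAt_const (by simp)
    filter_upwards [h1.filter_mono nhdsWithin_le_nhds, self_mem_nhdsWithin] with t h2 h3
    exact exp_mul_sub_one_ne_zero hκ h3 h2
  have hne2 := hne b⁻¹ (inv_pos.2 hb0)
  rw [ofReal_inv] at hne2
  refine key.congr' ?_
  filter_upwards [self_mem_nhdsWithin, hne b hb0, hne2] with t ht hX hY
  have ht : t ≠ 0 := ht
  have e : ∀ c : ℂ, c + c ^ 2 / 2 * t + c ^ 3 / 6 * t ^ 2 + t ^ 2 *
      ((exp (c * t) - ∑ i ∈ Finset.range (3 + 1), (c * t) ^ i / i.factorial) / t ^ 3) =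
      (exp (c * t) - 1) / t := by
    intro c
    simp [Finset.sum_range_succ, Nat.factorial]
    field_simp
    ring
  have e2 : 1 + Real.pi * z * t + (Real.pi * z) ^ 2 / 2 * t ^ 2 + t ^ 2 *
      ((exp (Real.pi * z * t) - ∑ i ∈ Finset.range (2 + 1), (Real.pi * z * t) ^ i / i.factorial) /
        t ^ 2) = exp (Real.pi * z * t) := by
    simp [Finset.sum_range_succ, Nat.factorial]
    field_simp
    ring
  rw [e, e, e2]
  unfold dilogIntegrand principalPart
  have e3 : (Real.pi * t * z : ℂ) = Real.pi * z * t := by ring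
  rw [e3]
  rw [← hc₁] at hX ⊢
  rw [← hc₂] at hY ⊢
  generalize exp (c₁ * t) = X at *
  generalize exp (c₂ * t) = Y at *
  generalize exp (Real.pi * z * t) = E at *
  generalize ((z - bigQ b / 2) ^ 2 / 2 - ((b : ℂ) ^ 2 + ((b : ℂ)⁻¹) ^ 2) / 24) = C at *
  generalize ((z - bigQ b / 2) / Real.pi : ℂ) = B at *
  generalize (1 / (Real.pi : ℂ) ^ 2) = A at *
  field_simp

/-- The substitution t ↦ -t takes the integrand for Q - z on Im t = b to minus the integrand for z
on Im t = -b. The sum is thus a difference of two parallel contour integrals, and only the residue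
at t = 0 survives. -/
theorem dilogExponent_add_reflect {b : ℝ} (hb0 : 0 < b) (hb1 : b < 1) {z : ℂ}
    (h1 : 0 < z.re) (h2 : z.re < bigQ b) :
    dilogExponent b z + dilogExponent b (bigQ b - z) = -(2 * Real.pi * I *
      ((z - bigQ b / 2) ^ 2 / 2 - ((b : ℂ) ^ 2 + ((b : ℂ)⁻¹) ^ 2) / 24)) := by
  obtain ⟨C, hC, h⟩ := exists_norm_integrand_le hb0 hb1
  set ε := min z.re (bigQ b - z.re)
  have hε : 0 < ε := lt_min h1 (by linarith)
  have hgt : Tendsto (fun u => C * Real.exp (Real.pi * b * |z.im|) * Real.exp (-(Real.pi * ε) * u))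
      atTop (𝓝 0) := by
    simpa using (tendsto_exp_neg_mul_atTop (c := Real.pi * ε) (by positivity)).const_mul
      (C * Real.exp (Real.pi * b * |z.im|))
  have key := integral_sub_horizontal_eq_residue hb0 (f := dilogIntegrand b z) (by
      intro t ht
      obtain ⟨h3, h4, h5⟩ := denominators_ne_zero hb0 hb1 ht
      refine DifferentiableAt.differentiableWithinAt ?_
      unfold dilogIntegrand
      exact DifferentiableAt.div (by fun_prop) (by fun_prop)
        (mul_ne_zero (mul_ne_zero h3 h4) h5)) (tendsto_dilogIntegrand_residue hb0 z)
    hgt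
    (by
      intro u hu t ht
      refine ((h ε z u t (Or.inl hu) (min_le_left _ _)).1 ?_).trans ?_
      · linarith [min_le_right z.re (bigQ b - z.re)]
      · gcongr
        have : |t * z.im| ≤ b * |z.im| := by
          rw [abs_mul]; gcongr; exact abs_le.2 ht
        nlinarith [neg_abs_le (t * z.im), Real.pi_pos])
    (integrable_dilogIntegrand hb0 hb1 (by rw [abs_neg, abs_of_pos hb0]) h1 h2)
    (integrable_dilogIntegrand hb0 hb1 (abs_of_pos hb0) h1 h2)
  have e : ∀ u : ℝ, dilogIntegrand b (bigQ b - z) (u + b * I) =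
      -dilogIntegrand b z ((-u : ℝ) + (-b : ℝ) * I) := by
    intro u
    obtain ⟨h3, h4, h5⟩ := exp_sub_one_ne_zero_of_controlled hb0 hb1 (u := u) (τ := b)
      (Or.inr (abs_of_pos hb0))
    unfold dilogIntegrand
    set t : ℂ := u + b * I with ht
    have e1 : ((-u : ℝ) : ℂ) + (-b : ℝ) * I = -t := by rw [ht]; push_cast; ring
    have e2 : exp (Real.pi * t * (bigQ b - z)) =
        exp (Real.pi * b * t) * exp (Real.pi * (b : ℂ)⁻¹ * t) * exp (Real.pi * -t * z) := by
      rw [← Complex.exp_add, ← Complex.exp_add]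
      congr 1
      simp [bigQ]
      ring
    have e3 : exp (Real.pi * b * -t) = (exp (Real.pi * b * t))⁻¹ := by
      rw [← Complex.exp_neg]; ring_nf
    have e4 : exp (Real.pi * (b : ℂ)⁻¹ * -t) = (exp (Real.pi * (b : ℂ)⁻¹ * t))⁻¹ := by
      rw [← Complex.exp_neg]; ring_nf
    rw [e1, e2, e3, e4]
    have hX := Complex.exp_ne_zero (Real.pi * b * t)
    have hY := Complex.exp_ne_zero (Real.pi * (b : ℂ)⁻¹ * t)
    generalize exp (Real.pi * b * t) = X at *
    generalize exp (Real.pi * (b : ℂ)⁻¹ * t) = Y at *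
    have h6 : X⁻¹ - 1 = -(X - 1) / X := by field_simp; ring
    have h7 : Y⁻¹ - 1 = -(Y - 1) / Y := by field_simp; ring
    rw [h6, h7]
    field_simp
  have e' : dilogExponent b (bigQ b - z) = -∫ u : ℝ, dilogIntegrand b z (u + (-b : ℝ) * I) := by
    unfold dilogExponent
    simp_rw [e]
    rw [integral_neg, integral_neg_eq_self (fun u : ℝ => dilogIntegrand b z (u + (-b : ℝ) * I))]
  rw [e', ← key]
  unfold dilogExponent
  ring

theorem dilogS_of_strip (b : ℝ) {z : ℂ} (h1 : 0 < z.re) (h2 : z.re < bigQ b) :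
    dilogS b z = exp (Real.pi * I * z * (bigQ b - z) / 2) *
      ((starRingEnd ℂ) (zetaB b) * exp (-dilogExponent b z)) := by
  unfold dilogS dilogG
  rw [if_neg (not_le.2 h1), if_pos h2]
  rfl

theorem conj_zetaB (b : ℝ) : (starRingEnd ℂ) (zetaB b) =
    exp (-(Real.pi * I / 2 * (((b : ℂ) ^ 2 + ((b : ℂ)⁻¹) ^ 2) / 6 + 1 / 2))) := by
  have : (Real.pi * I / 2 * (((b : ℂ) ^ 2 + ((b : ℂ)⁻¹) ^ 2) / 6 + 1 / 2)) =
    ((Real.pi / 2 * ((b ^ 2 + b⁻¹ ^ 2) / 6 + 1 / 2) : ℝ) : ℂ) * I := by push_cast; ring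
  rw [zetaB, ← Complex.exp_conj, this, map_mul, conj_I, conj_ofReal, mul_neg]

theorem norm_conj_zetaB (b : ℝ) : ‖(starRingEnd ℂ) (zetaB b)‖ = 1 := by
  have : (Real.pi * I / 2 * (((b : ℂ) ^ 2 + ((b : ℂ)⁻¹) ^ 2) / 6 + 1 / 2)) =
    ((Real.pi / 2 * ((b ^ 2 + b⁻¹ ^ 2) / 6 + 1 / 2) : ℝ) : ℂ) * I := by push_cast; ring
  rw [RCLike.norm_conj, zetaB, this, Complex.norm_exp_ofReal_mul_I]

theorem dilogS_ne_zero (b : ℝ) {z : ℂ} (h1 : 0 < z.re) (h2 : z.re < bigQ b) :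
    dilogS b z ≠ 0 := by
  rw [dilogS_of_strip b h1 h2, conj_zetaB]
  exact mul_ne_zero (Complex.exp_ne_zero _)
    (mul_ne_zero (Complex.exp_ne_zero _) (Complex.exp_ne_zero _))

theorem differentiableAt_dilogS {b : ℝ} (hb0 : 0 < b) (hb1 : b < 1) {z : ℂ}
    (h1 : 0 < z.re) (h2 : z.re < bigQ b) : DifferentiableAt ℂ (dilogS b) z := by
  have hd := differentiableAt_dilogExponent hb0 hb1 h1 h2
  have hd2 : DifferentiableAt ℂ (fun z => exp (Real.pi * I * z * (bigQ b - z) / 2) *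
      ((starRingEnd ℂ) (zetaB b) * exp (-dilogExponent b z))) z := by
    fun_prop
  refine hd2.congr_of_eventuallyEq ?_
  have ho : IsOpen (re ⁻¹' Set.Ioo 0 (bigQ b)) := isOpen_Ioo.preimage continuous_re
  filter_upwards [ho.mem_nhds ⟨h1, h2⟩] with w hw using dilogS_of_strip b hw.1 hw.2

/-- The quadratic exponentials contribute πiz(Q-z), which removes the z-dependence of the residue.
The square of the conjugate of ζ_b removes the remaining constant. -/
theorem dilogS_mul_reflect {b : ℝ} (hb0 : 0 < b) (hb1 : b < 1) {z : ℂ}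
    (h1 : 0 < z.re) (h2 : z.re < bigQ b) : dilogS b z * dilogS b (bigQ b - z) = 1 := by
  rw [dilogS_of_strip b h1 h2, dilogS_of_strip b (z := bigQ b - z) (by simp; linarith)
    (by simp; linarith), conj_zetaB]
  simp only [← Complex.exp_add]
  have h := dilogExponent_add_reflect hb0 hb1 h1 h2
  have hb : (b : ℂ) ≠ 0 := by exact_mod_cast hb0.ne'
  have hQ : (bigQ b : ℂ) = b + (b : ℂ)⁻¹ := by simp [bigQ]
  have hbb : (b : ℂ) * (b : ℂ)⁻¹ = 1 := mul_inv_cancel₀ hb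
  refine Eq.trans (congrArg exp ?_) Complex.exp_zero
  rw [hQ] at h ⊢
  linear_combination -h + Real.pi * I / 2 * hbb

theorem dilogS_reflect {b : ℝ} (hb0 : 0 < b) (hb1 : b < 1) {z : ℂ}
    (h1 : 0 < z.re) (h2 : z.re < bigQ b) : dilogS b (bigQ b - z) = (dilogS b z)⁻¹ :=
  eq_inv_of_mul_eq_one_right (dilogS_mul_reflect hb0 hb1 h1 h2)

/-- `2 sin(πbz)`, the multiplier in the functional equation of `S_b`. -/
noncomputable def twoSin (b : ℝ) (z : ℂ) : ℂ := 2 * sin (Real.pi * b * z)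

/-- The quadratic exponential contributes i e^{-πibz}, which symmetrizes 1 - e^{2πibz} to 2
sin(πbz). -/
theorem dilogS_add {b : ℝ} (hb0 : 0 < b) (hb1 : b < 1) {z : ℂ}
    (h1 : 0 < z.re) (h2 : z.re < b⁻¹) : dilogS b (z + b) = twoSin b z * dilogS b z := by
  rw [dilogS_of_strip b (z := z + b) (by simp; linarith) (by simp [bigQ]; linarith),
    dilogS_of_strip b h1 (by unfold bigQ; linarith), exp_dilogExponent_add hb0 hb1 h1 h2]
  have hb : (b : ℂ) ≠ 0 := by exact_mod_cast hb0.ne'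
  have hbb : (b : ℂ) * (b : ℂ)⁻¹ = 1 := mul_inv_cancel₀ hb
  have hQ : (bigQ b : ℂ) = b + (b : ℂ)⁻¹ := by simp [bigQ]
  have e : exp (Real.pi * I * (z + b) * (bigQ b - (z + b)) / 2) =
      exp (Real.pi * I * z * (bigQ b - z) / 2) * (I * exp (-(Real.pi * b * z * I))) := by
    nth_rewrite 3 [← Complex.exp_pi_div_two_mul_I]
    rw [← Complex.exp_add, ← Complex.exp_add, hQ]
    congr 1
    linear_combination (Real.pi * I / 2) * hbb
  have e2 : exp (2 * Real.pi * I * b * z) =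
      exp (Real.pi * b * z * I) * exp (Real.pi * b * z * I) := by
    rw [← Complex.exp_add]; ring_nf
  have e3 : exp (-(Real.pi * b * z * I)) * exp (Real.pi * b * z * I) = 1 := by
    rw [← Complex.exp_add]; simp
  rw [e, e2, twoSin, Complex.sin, neg_mul]
  linear_combination -(exp (Real.pi * I * z * (bigQ b - z) / 2) * I * exp (Real.pi * b * z * I) *
    (starRingEnd ℂ) (zetaB b) * exp (-dilogExponent b z)) * e3

theorem norm_exp_quadratic (b : ℝ) (z : ℂ) :
    ‖exp (Real.pi * I * z * (bigQ b - z) / 2)‖ = Real.exp (Real.pi * z.im * (z.re - bigQ b / 2)) := by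
  rw [Complex.norm_exp]
  congr 1
  have : (Real.pi * I * z * (bigQ b - z) / 2 : ℂ) = ((Real.pi / 2 : ℝ) : ℂ) * (I * (z * (bigQ b - z))) := by
    push_cast; ring
  rw [this, Complex.re_ofReal_mul]
  simp
  ring

/-- For Im z ≥ 0 the exponent integral is bounded, so the size is that of the quadratic exponential.
Reflection z ↦ Q - z carries the lower half plane to the upper one and exchanges the two bounds. -/
theorem exists_norm_dilogS_bounds {b : ℝ} (hb0 : 0 < b) (hb1 : b < 1) {ε : ℝ} (hε : 0 < ε) :
    ∃ C > 0, ∀ z : ℂ, ε ≤ z.re → z.re ≤ bigQ b - ε →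
      ‖dilogS b z‖ ≤ C * Real.exp (Real.pi * |z.im| * (z.re - bigQ b / 2)) ∧
      ‖(dilogS b z)⁻¹‖ ≤ C * Real.exp (-(Real.pi * |z.im| * (z.re - bigQ b / 2))) := by
  obtain ⟨C, hC, h⟩ := exists_norm_dilogExponent_le hb0 hb1 hε
  have upper : ∀ z : ℂ, ε ≤ z.re → z.re ≤ bigQ b - ε → 0 ≤ z.im →
      ‖dilogS b z‖ ≤ Real.exp C * Real.exp (Real.pi * z.im * (z.re - bigQ b / 2)) ∧
      ‖(dilogS b z)⁻¹‖ ≤ Real.exp C * Real.exp (-(Real.pi * z.im * (z.re - bigQ b / 2))) := by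
    intro z h1 h2 h3
    have hn : ‖dilogExponent b z‖ ≤ C := by
      refine (h z h1 h2).trans (mul_le_of_le_one_right hC.le (Real.exp_le_one_iff.2 ?_))
      have := Real.pi_pos
      have : 0 ≤ Real.pi * b * z.im := by positivity
      linarith
    have hre := (abs_le.1 ((abs_re_le_norm _).trans hn))
    rw [dilogS_of_strip b (by linarith) (by linarith), norm_inv, norm_mul, norm_mul,
      norm_conj_zetaB, one_mul, norm_exp_quadratic, Complex.norm_exp, neg_re]
    constructor
    · rw [mul_comm]
      gcongr
      linarith
    · rw [mul_inv, mul_comm, ← Real.exp_neg, ← Real.exp_neg]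
      gcongr
      linarith
  refine ⟨Real.exp C, Real.exp_pos _, fun z h1 h2 => ?_⟩
  rcases le_total 0 z.im with h3 | h3
  · rw [abs_of_nonneg h3]
    exact upper z h1 h2 h3
  · have hr : dilogS b z = (dilogS b (bigQ b - z))⁻¹ := by
      rw [dilogS_reflect hb0 hb1 (by linarith) (by linarith), inv_inv]
    have hu := upper (bigQ b - z) (by simp; linarith) (by simp; linarith) (by simpa using h3)
    have e : Real.pi * (bigQ b - z : ℂ).im * ((bigQ b - z : ℂ).re - bigQ b / 2) =
        -(Real.pi * |z.im| * (z.re - bigQ b / 2)) := by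
      rw [abs_of_nonpos h3]; simp; ring
    rw [e, neg_neg] at hu
    rw [hr, inv_inv]
    exact ⟨hu.2, hu.1⟩

end QuantumDilogarithm

/-! ### The replacement rule and bounds for the kernel at complex arguments. -/

section KernelEstimates

/-- The point 2iα lies on the boundary of the strip, so the functional equation is read off from the
definition of `dilogG`. At α = 0 both sides vanish, the left one because the value at a pole is set
to 0. -/
theorem inv_dilogS_two_mul_I {b : ℝ} (hb0 : 0 < b) (hb1 : b < 1) (α : ℝ) :
    (dilogS b (2 * I * α))⁻¹ = twoSin b (2 * I * α) * (dilogS b (2 * I * α + b))⁻¹ := by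
  set z : ℂ := 2 * I * α with hz
  have hz0 : z.re = 0 := by simp [hz]
  have hb : (b : ℂ) ≠ 0 := by exact_mod_cast hb0.ne'
  have hbb : (b : ℂ) * (b : ℂ)⁻¹ = 1 := mul_inv_cancel₀ hb
  have hQ : (bigQ b : ℂ) = b + (b : ℂ)⁻¹ := by simp [bigQ]
  have h2 : b < bigQ b := by have := b_lt_half_bigQ hb0 hb1; linarith
  -- At Re z = 0 exactly one shift is made, since the floor is 0.
  have hG : dilogG b z = dilogStrip b (z + b) / (1 - exp (2 * Real.pi * I * b * z)) := by
    unfold dilogG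
    rw [if_pos hz0.le, hz0]
    simp
  have hG2 : dilogG b (z + b) = dilogStrip b (z + b) := by
    unfold dilogG
    rw [if_neg (by simp [hz0, hb0]), if_pos (by simp [hz0, h2])]
  unfold dilogS
  rw [hG, hG2]
  have e : exp (Real.pi * I * (z + b) * (bigQ b - (z + b)) / 2) =
      exp (Real.pi * I * z * (bigQ b - z) / 2) * (I * exp (-(Real.pi * b * z * I))) := by
    nth_rewrite 3 [← Complex.exp_pi_div_two_mul_I]
    rw [← Complex.exp_add, ← Complex.exp_add, hQ]
    congr 1
    linear_combination (Real.pi * I / 2) * hbb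
  have e2 : exp (2 * Real.pi * I * b * z) =
      exp (Real.pi * b * z * I) * exp (Real.pi * b * z * I) := by
    rw [← Complex.exp_add]; ring_nf
  have e3 : exp (-(Real.pi * b * z * I)) * exp (Real.pi * b * z * I) = 1 := by
    rw [← Complex.exp_add]; simp
  have hsin : twoSin b z * (I * exp (-(Real.pi * b * z * I)))⁻¹ =
      1 - exp (2 * Real.pi * I * b * z) := by
    rw [mul_inv_eq_iff_eq_mul₀ (mul_ne_zero I_ne_zero (Complex.exp_ne_zero _)), e2, twoSin,
      Complex.sin, neg_mul]
    linear_combination (I * exp (Real.pi * b * z * I)) * e3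
  rw [e, ← hsin]
  generalize twoSin b z = T
  generalize exp (Real.pi * I * z * (bigQ b - z) / 2) = E
  generalize I * exp (-(Real.pi * b * z * I)) = J
  simp only [div_eq_mul_inv, mul_inv, inv_inv]
  ring

/-- Here s₁ stands for S_b(ir). Its inverse S_b(Q - ir), the image of [ρ]!, enters three binomials,
and after cancellation one factor s₁ is left in the numerator. -/
theorem replacement_algebra {e s₁ s₂ s₃ s₄ s₅ s₆ s₇ s₈ s₉ s₁₀ : ℂ} (h : s₁ ≠ 0) :
    e * (s₂ / (s₁⁻¹ * s₃)) * (s₄⁻¹ / (s₅ * s₆⁻¹)) * (s₇ / (s₁⁻¹ * s₈)) * (s₉ / (s₁⁻¹ * s₁₀))⁻¹ =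
      s₂ * s₇ / (s₅ * s₉) * (e * s₆ * s₁ * s₁₀ / (s₃ * s₄ * s₈)) := by
  simp only [div_eq_mul_inv, mul_inv, inv_inv]
  field_simp

/-- The replacement rule. -/
theorem cgReplaced_eq {b : ℝ} (hb0 : 0 < b) (hb1 : b < 1) (l₁ l₂ x y α : ℝ) {r : ℂ}
    (hr₁ : -(bigQ b / 2) < r.im) (hr₂ : r.im < 0) :
    cgReplaced b l₁ l₂ x α (x + y) r =
      cgPrefactor b l₁ l₂ y α (x + y) * cgIntegrand b l₁ l₂ x y α (x + y) r := by
  have hb : (b : ℂ) ≠ 0 := by exact_mod_cast hb0.ne'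
  have hQ0 := bigQ_pos hb0
  have hρ : (b : ℂ) * (r / (I * b)) = -(I * r) := by
    field_simp; linear_combination r * I_sq
  have hW : ∀ l : ℝ, (b : ℂ) * virtualWeight b l = -bigQ b + 2 * I * l := by
    intro l; unfold virtualWeight; field_simp
  have hIx : ∀ l x : ℝ, (b : ℂ) * virtualIndex b l x = -bigQ b / 2 + I * l - I * x := by
    intro l x; unfold virtualIndex virtualWeight; field_simp
  unfold cgReplaced cgSummand binomS qPow
  set ρ := r / (I * b)
  set M := virtualWeight b l₁ with hM
  set N := virtualWeight b l₂ with hN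
  set S := virtualWeight b α with hS
  set m := virtualIndex b l₁ x with hm
  set k := virtualIndex b α (x + y) with hk
  have a1 : (bigQ b : ℂ) + b * k = bigQ b / 2 + I * α - I * (x + y : ℝ) := by
    rw [hk, hIx]; ring
  have a2 : (bigQ b : ℂ) + b * ρ = bigQ b - I * r := by rw [hρ]; ring
  have a3 : (bigQ b : ℂ) + b * (k - ρ) = bigQ b / 2 + I * α - I * (x + y : ℝ) + I * r := by
    rw [mul_sub, hk, hIx, hρ]; ring
  have a4 : (bigQ b : ℂ) + b * (ρ + (M + N - S) / 2) =
      bigQ b - (bigQ b / 2 + I * α - I * l₁ - I * l₂ + I * r) := by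
    linear_combination hρ + (hW l₁ + hW l₂ - hW α) / 2
  have a5 : (bigQ b : ℂ) + b * (k - m + (M + N - S) / 2) = bigQ b / 2 - I * y + I * l₂ := by
    have h1 := hIx α (x + y)
    push_cast at h1
    linear_combination h1 - hIx l₁ x + (hW l₁ + hW l₂ - hW α) / 2
  have a6 : (bigQ b : ℂ) + b * (ρ + (M + N - S) / 2 - (k - m + (M + N - S) / 2)) =
      bigQ b - (I * α - I * y - I * l₁ + I * r) := by
    have h1 := hIx α (x + y)
    push_cast at h1
    linear_combination hρ - h1 + hIx l₁ x
  have a7 : (bigQ b : ℂ) + b * (N - (M + N - S) / 2) = bigQ b / 2 + I * α - I * l₁ + I * l₂ := by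
    linear_combination hW l₂ - (hW l₁ + hW l₂ - hW α) / 2
  have a8 : (bigQ b : ℂ) + b * (N - (M + N - S) / 2 - ρ) =
      bigQ b / 2 + I * α - I * l₁ + I * l₂ + I * r := by
    linear_combination hW l₂ - (hW l₁ + hW l₂ - hW α) / 2 - hρ
  have a9 : (bigQ b : ℂ) + b * S = 2 * I * α := by
    linear_combination hW α
  have a10 : (bigQ b : ℂ) + b * (S - ρ) = 2 * I * α + I * r := by
    linear_combination hW α - hρ
  -- The exponents combine to πi · b(ρ+m-k) · (Q + b(M-m)), and the last two factors become
  -- -i(r+α-λ₁-y) and Q/2 + ix + iλ₁.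
  have hexp : exp (Real.pi * I * b * bigQ b * (ρ + m - k)) *
      exp (Real.pi * I * (b : ℂ) ^ 2 * ((ρ + m - k) * (M - m))) =
      exp (Real.pi * (bigQ b / 2 + I * x + I * l₁) * (r + α - l₁ - y)) := by
    have h1 : (b : ℂ) * (ρ + m - k) = -I * (r + α - l₁ - y) := by
      have h1 := hIx α (x + y)
      push_cast at h1
      linear_combination hρ - h1 + hIx l₁ x
    have h2 : (b : ℂ) * (M - m) = -bigQ b / 2 + I * l₁ + I * x := by
      linear_combination hW l₁ - hIx l₁ x
    rw [← Complex.exp_add]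
    congr 1
    have : (Real.pi * I * b * bigQ b * (ρ + m - k) + Real.pi * I * (b : ℂ) ^ 2 *
        ((ρ + m - k) * (M - m)) : ℂ) = Real.pi * I * (b * (ρ + m - k)) * (bigQ b + b * (M - m)) := by
      ring
    rw [this, h1, h2]
    linear_combination (-Real.pi * (r + α - l₁ - y) * (bigQ b / 2 + I * x + I * l₁)) * I_sq
  rw [a1, a2, a3, a4, a5, a6, a7, a8, a9, a10, hexp]
  have hir : (I * r).re = -r.im := by simp
  -- Reflection is applied to the images of [ρ]!, [ρ+d]! and [ρ+m-k]!. The condition -Q/2 < Im r < 0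
  -- places the three reflected arguments in the strip.
  rw [dilogS_reflect hb0 hb1 (z := I * r) (by rw [hir]; linarith) (by rw [hir]; linarith),
    dilogS_reflect hb0 hb1 (z := bigQ b / 2 + I * α - I * l₁ - I * l₂ + I * r) (by simp; linarith)
      (by simp; linarith),
    dilogS_reflect hb0 hb1 (z := I * α - I * y - I * l₁ + I * r) (by simp; linarith)
      (by simp; linarith)]
  have hne := dilogS_ne_zero b (z := I * r) (by rw [hir]; linarith) (by rw [hir]; linarith)
  unfold cgPrefactor cgIntegrand
  exact replacement_algebra hne

/-- The contour integrand, for complex values of `x`, `y`, `z`. -/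
noncomputable def contourIntegrand (b l₁ l₂ : ℝ) (x y z : ℂ) (α : ℝ) (r : ℂ) : ℂ :=
  exp (Real.pi * (bigQ b / 2 + I * x + I * l₁) * (r + α - l₁ - y)) *
      dilogS b (I * α - I * y - I * l₁ + I * r) *
      dilogS b (I * r) * dilogS b (2 * I * α + I * r) /
    (dilogS b (bigQ b / 2 + I * α - I * z + I * r) *
      dilogS b (bigQ b / 2 + I * α - I * l₁ - I * l₂ + I * r) *
      dilogS b (bigQ b / 2 + I * α - I * l₁ + I * l₂ + I * r))

/-- The factor in front of the contour integral, for complex values of `y`, `z`. -/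
noncomputable def contourPrefactor (b l₁ l₂ : ℝ) (y z : ℂ) (α : ℝ) : ℂ :=
  dilogS b (bigQ b / 2 + I * α - I * z) * dilogS b (bigQ b / 2 + I * α - I * l₁ + I * l₂) /
    (dilogS b (bigQ b / 2 - I * y + I * l₂) * dilogS b (2 * I * α))

/-- Imaginary parts `a`, `c`, `e` of `x`, `y`, `z` and `-s` of `r` for which all arguments of `S_b`
in the kernel stay in the strip, and the contour integrand decays, with margin `ε`. -/
structure Admissible (b ε a c e s : ℝ) : Prop where
  ε_pos : 0 < ε
  s_lower : ε ≤ s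
  s_upper : s ≤ bigQ b / 2 - ε
  sc_lower : ε ≤ s + c
  sc_upper : s + c ≤ bigQ b - ε
  e_lower : ε ≤ bigQ b / 2 + e
  es_upper : bigQ b / 2 + e + s ≤ bigQ b - ε
  c_lower : ε ≤ bigQ b / 2 + c
  c_upper : bigQ b / 2 + c ≤ bigQ b - ε
  a_bound : |a| ≤ bigQ b - ε
  decay : c - e - 3 * bigQ b / 2 + |bigQ b / 2 - a| ≤ -ε

/-- Each argument in the contour integrand has imaginary part u up to bounded parameters. This
replaces |Im w| by |u| in the growth bound, at the price of a factor exponential in the size V of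
the parameters. -/
theorem norm_dilogS_le_of_im_near {b C : ℝ} (hb0 : 0 < b) {w : ℂ} (h1 : 0 < w.re)
    (h2 : w.re < bigQ b) (hC : 0 < C)
    (h : ‖dilogS b w‖ ≤ C * Real.exp (Real.pi * |w.im| * (w.re - bigQ b / 2)) ∧
      ‖(dilogS b w)⁻¹‖ ≤ C * Real.exp (-(Real.pi * |w.im| * (w.re - bigQ b / 2))))
    {u V κ : ℝ} (hV : |w.im - u| ≤ V) (hκ : w.re - bigQ b / 2 = κ) :
    ‖dilogS b w‖ ≤ C * Real.exp (Real.pi * bigQ b * V) * Real.exp (Real.pi * |u| * κ) ∧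
      ‖(dilogS b w)⁻¹‖ ≤ C * Real.exp (Real.pi * bigQ b * V) * Real.exp (Real.pi * |u| * -κ) := by
  have hQ := bigQ_pos hb0
  rw [hκ] at h
  have h3 : |(|w.im| - |u|) * κ| ≤ V * bigQ b := by
    rw [abs_mul]
    have h4 : |(|w.im| - |u|)| ≤ V := (abs_abs_sub_abs_le_abs_sub _ _).trans hV
    have h5 : |κ| ≤ bigQ b := abs_le.2 ⟨by linarith, by linarith⟩
    exact mul_le_mul h4 h5 (abs_nonneg _) ((abs_nonneg _).trans h4)
  have h6 := abs_le.1 h3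
  have hπ := Real.pi_pos
  constructor
  · refine h.1.trans ?_
    rw [mul_assoc C, ← Real.exp_add]
    gcongr
    nlinarith
  · refine h.2.trans ?_
    rw [mul_assoc C, ← Real.exp_add]
    gcongr
    nlinarith

/-- The three numerators and three denominators contribute rates in which s cancels; their sum is Im
y - Im z - 3Q/2, and the exponential adds at most |Q/2 - Im x|. The rate δ is kept apart from the
margin ε because the argument for F needs the full rate Q, whereas ε must be small. -/
theorem exists_norm_contourIntegrand_le {b : ℝ} (hb0 : 0 < b) (hb1 : b < 1) {ε : ℝ} (hε : 0 < ε) :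
    ∃ C > 0, ∀ (l₁ l₂ : ℝ) (x y z : ℂ) (α u s V δ : ℝ), Admissible b ε x.im y.im z.im s →
      y.im - z.im - 3 * bigQ b / 2 + |bigQ b / 2 - x.im| ≤ -δ → |α| ≤ V → |x.re| ≤ V → |y.re| ≤ V → |z.re| ≤ V → |l₁| ≤ V → |l₂| ≤ V →
      ‖contourIntegrand b l₁ l₂ x y z α (u - s * I)‖ ≤
        C * Real.exp (40 * Real.pi * bigQ b * V) * Real.exp (-(Real.pi * δ) * |u|) := by
  obtain ⟨C, hC, hS⟩ := exists_norm_dilogS_bounds hb0 hb1 hε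
  have hQ := bigQ_pos hb0
  have hπ := Real.pi_pos
  refine ⟨C ^ 6, by positivity, fun l₁ l₂ x y z α u s V δ adm q10 hα hx hy hz hl₁ hl₂ => ?_⟩
  obtain ⟨-, q1, q2, q3, q4, q5, q6, q7, q8, q9, -⟩ := adm
  have hV : 0 ≤ V := (abs_nonneg _).trans hα
  rw [abs_le] at hα hx hy hz hl₁ hl₂
  have key : ∀ (w : ℂ) (κ : ℝ), ε ≤ w.re → w.re ≤ bigQ b - ε → |w.im - u| ≤ 3 * V →
      w.re - bigQ b / 2 = κ →
      ‖dilogS b w‖ ≤ C * Real.exp (Real.pi * bigQ b * (3 * V)) * Real.exp (Real.pi * |u| * κ) ∧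
      ‖(dilogS b w)⁻¹‖ ≤
        C * Real.exp (Real.pi * bigQ b * (3 * V)) * Real.exp (Real.pi * |u| * -κ) :=
    fun w κ h1 h2 h3 h4 => norm_dilogS_le_of_im_near hb0 (by linarith) (by linarith) hC (hS w h1 h2)
      h3 h4
  unfold contourIntegrand
  set r : ℂ := u - s * I with hr
  have n1 := (key (I * α - I * y - I * l₁ + I * r) (s + y.im - bigQ b / 2)
    (by simp [hr]; linarith) (by simp [hr]; linarith)
    (by rw [abs_le]; constructor <;> simp [hr] <;> linarith) (by simp [hr]; ring)).1
  have n2 := (key (I * r) (s - bigQ b / 2)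
    (by simp [hr]; linarith) (by simp [hr]; linarith)
    (by rw [abs_le]; constructor <;> simp [hr] <;> linarith) (by simp [hr])).1
  have n3 := (key (2 * I * α + I * r) (s - bigQ b / 2)
    (by simp [hr]; linarith) (by simp [hr]; linarith)
    (by rw [abs_le]; constructor <;> simp [hr] <;> linarith) (by simp [hr])).1
  have n4 := (key (bigQ b / 2 + I * α - I * z + I * r) (z.im + s)
    (by simp [hr]; linarith) (by simp [hr]; linarith)
    (by rw [abs_le]; constructor <;> simp [hr] <;> linarith) (by simp [hr]; ring)).2
  have n5 := (key (bigQ b / 2 + I * α - I * l₁ - I * l₂ + I * r) s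
    (by simp [hr]; linarith) (by simp [hr]; linarith)
    (by rw [abs_le]; constructor <;> simp [hr] <;> linarith) (by simp [hr])).2
  have n6 := (key (bigQ b / 2 + I * α - I * l₁ + I * l₂ + I * r) s
    (by simp [hr]; linarith) (by simp [hr]; linarith)
    (by rw [abs_le]; constructor <;> simp [hr] <;> linarith) (by simp [hr])).2
  have n0 : ‖exp (Real.pi * (bigQ b / 2 + I * x + I * l₁) * (r + α - l₁ - y))‖ ≤
      Real.exp (10 * Real.pi * bigQ b * V) * Real.exp (Real.pi * ((bigQ b / 2 - x.im) * u)) := by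
    rw [Complex.norm_exp, ← Real.exp_add]
    apply Real.exp_le_exp.2
    have e : (Real.pi * (bigQ b / 2 + I * x + I * l₁) * (r + α - l₁ - y) : ℂ).re =
        Real.pi * ((bigQ b / 2 - x.im) * u + ((bigQ b / 2 - x.im) * (α - l₁ - y.re) +
          (x.re + l₁) * (s + y.im))) := by
      rw [mul_assoc, Complex.re_ofReal_mul]
      simp [hr]
      ring
    rw [e]
    have e1 : (bigQ b / 2 - x.im) * (α - l₁ - y.re) ≤ (2 * bigQ b) * (3 * V) := by
      refine (le_abs_self _).trans ?_
      rw [abs_mul]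
      rw [abs_le] at q9
      refine mul_le_mul (abs_le.2 ⟨by linarith, by linarith⟩) (abs_le.2 ⟨by linarith, by linarith⟩)
        (abs_nonneg _) (by positivity)
    have e2 : (x.re + l₁) * (s + y.im) ≤ (2 * V) * bigQ b := by
      refine (le_abs_self _).trans ?_
      rw [abs_mul]
      refine mul_le_mul (abs_le.2 ⟨by linarith, by linarith⟩) (abs_le.2 ⟨by linarith, by linarith⟩)
        (abs_nonneg _) (by positivity)
    have e3 : 0 ≤ bigQ b * V := by positivity
    nlinarith
  have hdecay : Real.exp (Real.pi * ((bigQ b / 2 - x.im) * u)) *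
      Real.exp (Real.pi * |u| * (s + y.im - bigQ b / 2)) *
      Real.exp (Real.pi * |u| * (s - bigQ b / 2)) * Real.exp (Real.pi * |u| * (s - bigQ b / 2)) *
      (Real.exp (Real.pi * |u| * -(z.im + s)) * Real.exp (Real.pi * |u| * -s) *
        Real.exp (Real.pi * |u| * -s)) ≤ Real.exp (-(Real.pi * δ) * |u|) := by
    simp only [← Real.exp_add]
    apply Real.exp_le_exp.2
    have h1 : (bigQ b / 2 - x.im) * u ≤ |bigQ b / 2 - x.im| * |u| := by
      rw [← abs_mul]; exact le_abs_self _
    have h2 : |bigQ b / 2 - x.im| * |u| ≤ (-δ - (y.im - z.im - 3 * bigQ b / 2)) * |u| := by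
      gcongr; linarith
    have h3 := mul_le_mul_of_nonneg_left (h1.trans h2) hπ.le
    linarith
  rw [div_eq_mul_inv, mul_inv, mul_inv]
  simp only [norm_mul]
  calc _ ≤ (Real.exp (10 * Real.pi * bigQ b * V) * Real.exp (Real.pi * ((bigQ b / 2 - x.im) * u))) *
        (C * Real.exp (Real.pi * bigQ b * (3 * V)) *
          Real.exp (Real.pi * |u| * (s + y.im - bigQ b / 2))) *
        (C * Real.exp (Real.pi * bigQ b * (3 * V)) * Real.exp (Real.pi * |u| * (s - bigQ b / 2))) *
        (C * Real.exp (Real.pi * bigQ b * (3 * V)) * Real.exp (Real.pi * |u| * (s - bigQ b / 2))) *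
        ((C * Real.exp (Real.pi * bigQ b * (3 * V)) * Real.exp (Real.pi * |u| * -(z.im + s))) *
        (C * Real.exp (Real.pi * bigQ b * (3 * V)) * Real.exp (Real.pi * |u| * -s)) *
        (C * Real.exp (Real.pi * bigQ b * (3 * V)) * Real.exp (Real.pi * |u| * -s))) := by
        gcongr
    _ = C ^ 6 * (Real.exp (10 * Real.pi * bigQ b * V) *
          Real.exp (Real.pi * bigQ b * (3 * V)) ^ 6) *
        (Real.exp (Real.pi * ((bigQ b / 2 - x.im) * u)) *
      Real.exp (Real.pi * |u| * (s + y.im - bigQ b / 2)) *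
      Real.exp (Real.pi * |u| * (s - bigQ b / 2)) * Real.exp (Real.pi * |u| * (s - bigQ b / 2)) *
      (Real.exp (Real.pi * |u| * -(z.im + s)) * Real.exp (Real.pi * |u| * -s) *
        Real.exp (Real.pi * |u| * -s))) := by ring
    _ ≤ _ := by
      gcongr
      -- Six dilogarithms at 3πQV each and 10πQV from the exponential: 28 ≤ 40.
      rw [← Real.exp_nat_mul, ← Real.exp_add]
      apply Real.exp_le_exp.2
      have e3 : 0 ≤ Real.pi * bigQ b * V := by positivity
      push_cast
      linarith

theorem norm_twoSin_le (b : ℝ) (z : ℂ) : ‖twoSin b z‖ ≤ 2 * Real.exp (|Real.pi * b * z.im|) := by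
  have e : twoSin b z = (exp (-(Real.pi * b * z) * I) - exp (Real.pi * b * z * I)) * I := by
    rw [twoSin, Complex.sin]; ring
  have e1 : (-(Real.pi * b * z) * I : ℂ).re = Real.pi * b * z.im := by
    rw [← ofReal_mul]; simp
  have e2 : (Real.pi * b * z * I : ℂ).re = -(Real.pi * b * z.im) := by
    rw [← ofReal_mul]; simp
  rw [e, norm_mul, norm_I, mul_one]
  refine (norm_sub_le _ _).trans ?_
  rw [Complex.norm_exp, Complex.norm_exp, e1, e2, two_mul]
  gcongr
  · exact le_abs_self _
  · exact neg_le_abs _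

/-- The factor 1/S_b(2iα) is replaced by a sine over S_b(2iα + b), whose argument is inside the
strip. The bound thereby stays uniform as α → 0. -/
theorem exists_norm_contourPrefactor_le {b : ℝ} (hb0 : 0 < b) (hb1 : b < 1) {ε : ℝ} (hε : 0 < ε) :
    ∃ C > 0, ∀ (l₁ l₂ : ℝ) (y z : ℂ) (α V : ℝ), ε ≤ bigQ b / 2 + y.im →
      bigQ b / 2 + y.im ≤ bigQ b - ε → ε ≤ bigQ b / 2 + z.im → bigQ b / 2 + z.im ≤ bigQ b - ε →
      |α| ≤ V → |y.re| ≤ V → |z.re| ≤ V → |l₁| ≤ V → |l₂| ≤ V →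
      ‖contourPrefactor b l₁ l₂ y z α‖ ≤ C * Real.exp (40 * Real.pi * bigQ b * V) := by
  have hb2 := b_lt_half_bigQ hb0 hb1
  -- The argument 2iα + b has real part b, so the margin must not exceed b.
  obtain ⟨μ, hμ, hm, hm'⟩ : ∃ μ, 0 < μ ∧ μ ≤ ε ∧ μ ≤ b :=
    ⟨min ε b, lt_min hε hb0, min_le_left _ _, min_le_right _ _⟩
  obtain ⟨C, hC, hS⟩ := exists_norm_dilogS_bounds hb0 hb1 hμ
  have hQ := bigQ_pos hb0
  have hπ := Real.pi_pos
  refine ⟨2 * C ^ 4, by positivity, fun l₁ l₂ y z α V q1 q2 q3 q4 hα hy hz hl₁ hl₂ => ?_⟩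
  have hV : 0 ≤ V := (abs_nonneg _).trans hα
  have hα' := hα
  rw [abs_le] at hα hy hz hl₁ hl₂
  have key : ∀ (w : ℂ), μ ≤ w.re → w.re ≤ bigQ b - μ → |w.im - 0| ≤ 3 * V →
      ‖dilogS b w‖ ≤ C * Real.exp (Real.pi * bigQ b * (3 * V)) ∧
      ‖(dilogS b w)⁻¹‖ ≤ C * Real.exp (Real.pi * bigQ b * (3 * V)) := by
    intro w h1 h2 h3
    have := norm_dilogS_le_of_im_near hb0 (by linarith) (by linarith) hC (hS w h1 h2)
      h3 rfl
    simpa using this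
  have n1 := (key (bigQ b / 2 + I * α - I * z)
    (by simp; linarith) (by simp; linarith)
    (by rw [abs_le]; constructor <;> simp <;> linarith)).1
  have n2 := (key (bigQ b / 2 + I * α - I * l₁ + I * l₂)
    (by simp; linarith) (by simp; linarith)
    (by rw [abs_le]; constructor <;> simp <;> linarith)).1
  have n3 := (key (bigQ b / 2 - I * y + I * l₂)
    (by simp; linarith) (by simp; linarith)
    (by rw [abs_le]; constructor <;> simp <;> linarith)).2
  have n4 := (key (2 * I * α + b)
    (by simp; linarith) (by simp; linarith)
    (by rw [abs_le]; constructor <;> simp <;> linarith)).2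
  have n5 : ‖twoSin b (2 * I * α)‖ ≤ 2 * Real.exp (2 * Real.pi * bigQ b * V) := by
    refine (norm_twoSin_le _ _).trans ?_
    gcongr
    have : (2 * I * α : ℂ).im = 2 * α := by simp
    rw [this, abs_mul, abs_mul, abs_mul, abs_of_pos hπ, abs_of_pos hb0, abs_two]
    have : b * |α| ≤ bigQ b * V := by
      refine mul_le_mul (by linarith) hα' (abs_nonneg _) hQ.le
    nlinarith
  unfold contourPrefactor
  rw [div_eq_mul_inv, mul_inv, inv_dilogS_two_mul_I hb0 hb1]
  simp only [norm_mul]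
  calc _ ≤ (C * Real.exp (Real.pi * bigQ b * (3 * V))) * (C * Real.exp (Real.pi * bigQ b * (3 * V)))
        * ((C * Real.exp (Real.pi * bigQ b * (3 * V))) * ((2 * Real.exp (2 * Real.pi * bigQ b * V)) *
          (C * Real.exp (Real.pi * bigQ b * (3 * V))))) := by gcongr
    _ = 2 * C ^ 4 * (Real.exp (Real.pi * bigQ b * (3 * V)) ^ 4 *
          Real.exp (2 * Real.pi * bigQ b * V)) := by ring
    _ ≤ _ := by
      gcongr
      rw [← Real.exp_nat_mul, ← Real.exp_add]
      apply Real.exp_le_exp.2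
      have e3 : 0 ≤ Real.pi * bigQ b * V := by positivity
      push_cast
      linarith

end KernelEstimates

/-! ### Regularity of the kernel; convergence and independence of the contour. -/

section ContourIntegral

/-- Small changes of the imaginary parts cost half the margin. This supplies the neighbourhoods on
which integrals are dominated. -/
theorem Admissible.of_near {b ε a c e s a' c' e' : ℝ} (h : Admissible b ε a c e s)
    (ha : |a' - a| ≤ ε / 8) (hc : |c' - c| ≤ ε / 8) (he : |e' - e| ≤ ε / 8) :
    Admissible b (ε / 2) a' c' e' s := by
  obtain ⟨q0, q1, q2, q3, q4, q5, q6, q7, q8, q9, q10⟩ := h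
  have h1 : |a'| ≤ |a| + |a' - a| := by
    calc |a'| = |a + (a' - a)| := by ring_nf
      _ ≤ _ := abs_add_le _ _
  have h2 : |bigQ b / 2 - a'| ≤ |bigQ b / 2 - a| + |a' - a| := by
    calc |bigQ b / 2 - a'| = |(bigQ b / 2 - a) - (a' - a)| := by ring_nf
      _ ≤ _ := abs_sub _ _
  have hc' := abs_le.1 hc
  have he' := abs_le.1 he
  constructor <;> linarith

section regularity

variable {X : Type*} [TopologicalSpace X]

theorem continuousAt_dilogS_comp {b : ℝ} (hb0 : 0 < b) (hb1 : b < 1) {w : X → ℂ} {p : X}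
    (hw : ContinuousAt w p) (h1 : 0 < (w p).re) (h2 : (w p).re < bigQ b) :
    ContinuousAt (fun p => dilogS b (w p)) p :=
  ContinuousAt.comp (f := w) (g := dilogS b) (differentiableAt_dilogS hb0 hb1 h1 h2).continuousAt hw

theorem differentiableAt_dilogS_comp {b : ℝ} (hb0 : 0 < b) (hb1 : b < 1) {w : ℂ → ℂ} {p : ℂ}
    (hw : DifferentiableAt ℂ w p) (h1 : 0 < (w p).re) (h2 : (w p).re < bigQ b) :
    DifferentiableAt ℂ (fun p => dilogS b (w p)) p :=
  DifferentiableAt.comp (f := w) (g := dilogS b) p (differentiableAt_dilogS hb0 hb1 h1 h2) hw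

theorem continuousAt_contourIntegrand {b ε : ℝ} (hb0 : 0 < b) (hb1 : b < 1) (l₁ l₂ : ℝ)
    {x y z r : X → ℂ} {α : X → ℝ} {p : X} (hx : ContinuousAt x p) (hy : ContinuousAt y p)
    (hz : ContinuousAt z p) (hr : ContinuousAt r p) (hα : ContinuousAt α p)
    (h : Admissible b ε (x p).im (y p).im (z p).im (-(r p).im)) :
    ContinuousAt (fun p => contourIntegrand b l₁ l₂ (x p) (y p) (z p) (α p) (r p)) p := by
  obtain ⟨q0, q1, q2, q3, q4, q5, q6, q7, q8, q9, q10⟩ := h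
  have hα' : ContinuousAt (fun p => (α p : ℂ)) p := continuous_ofReal.continuousAt.comp hα
  unfold contourIntegrand
  have hQ := bigQ_pos hb0
  refine ContinuousAt.div (((ContinuousAt.mul (by fun_prop)
    (continuousAt_dilogS_comp hb0 hb1 (by fun_prop) ?_ ?_)).mul
    (continuousAt_dilogS_comp hb0 hb1 (by fun_prop) ?_ ?_)).mul
    (continuousAt_dilogS_comp hb0 hb1 (by fun_prop) ?_ ?_))
    (((continuousAt_dilogS_comp hb0 hb1 (by fun_prop) ?_ ?_).mul
    (continuousAt_dilogS_comp hb0 hb1 (by fun_prop) ?_ ?_)).mul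
    (continuousAt_dilogS_comp hb0 hb1 (by fun_prop) ?_ ?_))
    (mul_ne_zero (mul_ne_zero (dilogS_ne_zero b ?_ ?_) (dilogS_ne_zero b ?_ ?_))
      (dilogS_ne_zero b ?_ ?_))
  all_goals (simp; linarith)

theorem differentiableAt_contourIntegrand {b ε : ℝ} (hb0 : 0 < b) (hb1 : b < 1) (l₁ l₂ α : ℝ)
    {x y z r : ℂ → ℂ} {p : ℂ} (hx : DifferentiableAt ℂ x p) (hy : DifferentiableAt ℂ y p)
    (hz : DifferentiableAt ℂ z p) (hr : DifferentiableAt ℂ r p)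
    (h : Admissible b ε (x p).im (y p).im (z p).im (-(r p).im)) :
    DifferentiableAt ℂ (fun p => contourIntegrand b l₁ l₂ (x p) (y p) (z p) α (r p)) p := by
  obtain ⟨q0, q1, q2, q3, q4, q5, q6, q7, q8, q9, q10⟩ := h
  unfold contourIntegrand
  have hQ := bigQ_pos hb0
  refine DifferentiableAt.div (((DifferentiableAt.mul (by fun_prop)
    (differentiableAt_dilogS_comp hb0 hb1 (by fun_prop) ?_ ?_)).mul
    (differentiableAt_dilogS_comp hb0 hb1 (by fun_prop) ?_ ?_)).mul
    (differentiableAt_dilogS_comp hb0 hb1 (by fun_prop) ?_ ?_))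
    (((differentiableAt_dilogS_comp hb0 hb1 (by fun_prop) ?_ ?_).mul
    (differentiableAt_dilogS_comp hb0 hb1 (by fun_prop) ?_ ?_)).mul
    (differentiableAt_dilogS_comp hb0 hb1 (by fun_prop) ?_ ?_))
    (mul_ne_zero (mul_ne_zero (dilogS_ne_zero b ?_ ?_) (dilogS_ne_zero b ?_ ?_))
      (dilogS_ne_zero b ?_ ?_))
  all_goals (simp; linarith)

/-- In this form no dilogarithm is evaluated on the boundary of the strip, so continuity in α holds
across α = 0. -/
theorem contourPrefactor_eq {b : ℝ} (hb0 : 0 < b) (hb1 : b < 1) (l₁ l₂ : ℝ) (y z : ℂ) (α : ℝ) :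
    contourPrefactor b l₁ l₂ y z α =
      dilogS b (bigQ b / 2 + I * α - I * z) * dilogS b (bigQ b / 2 + I * α - I * l₁ + I * l₂) *
        (twoSin b (2 * I * α) / (dilogS b (bigQ b / 2 - I * y + I * l₂) *
          dilogS b (2 * I * α + b))) := by
  unfold contourPrefactor
  rw [div_eq_mul_inv, mul_inv, inv_dilogS_two_mul_I hb0 hb1]
  simp only [div_eq_mul_inv, mul_inv]
  ring

theorem continuousAt_contourPrefactor {b ε : ℝ} (hb0 : 0 < b) (hb1 : b < 1) (l₁ l₂ : ℝ)
    {y z : X → ℂ} {α : X → ℝ} {p : X} (hy : ContinuousAt y p)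
    (hz : ContinuousAt z p) (hα : ContinuousAt α p) {a s : ℝ}
    (h : Admissible b ε a (y p).im (z p).im s) :
    ContinuousAt (fun p => contourPrefactor b l₁ l₂ (y p) (z p) (α p)) p := by
  obtain ⟨q0, q1, q2, q3, q4, q5, q6, q7, q8, q9, q10⟩ := h
  have hα' : ContinuousAt (fun p => (α p : ℂ)) p := continuous_ofReal.continuousAt.comp hα
  simp_rw [contourPrefactor_eq hb0 hb1]
  unfold twoSin
  have hb2 := b_lt_half_bigQ hb0 hb1
  refine ((continuousAt_dilogS_comp hb0 hb1 (by fun_prop) ?_ ?_).mul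
    (continuousAt_dilogS_comp hb0 hb1 (by fun_prop) ?_ ?_)).mul
    (ContinuousAt.div (by fun_prop) ((continuousAt_dilogS_comp hb0 hb1 (by fun_prop) ?_ ?_).mul
      (continuousAt_dilogS_comp hb0 hb1 (by fun_prop) ?_ ?_))
      (mul_ne_zero (dilogS_ne_zero b ?_ ?_) (dilogS_ne_zero b ?_ ?_)))
  all_goals (simp; linarith)

theorem differentiableAt_contourPrefactor {b ε : ℝ} (hb0 : 0 < b) (hb1 : b < 1) (l₁ l₂ α : ℝ)
    {y z : ℂ → ℂ} {p : ℂ} (hy : DifferentiableAt ℂ y p)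
    (hz : DifferentiableAt ℂ z p) {a s : ℝ} (h : Admissible b ε a (y p).im (z p).im s) :
    DifferentiableAt ℂ (fun p => contourPrefactor b l₁ l₂ (y p) (z p) α) p := by
  obtain ⟨q0, q1, q2, q3, q4, q5, q6, q7, q8, q9, q10⟩ := h
  simp_rw [contourPrefactor_eq hb0 hb1]
  have hb2 := b_lt_half_bigQ hb0 hb1
  refine ((differentiableAt_dilogS_comp hb0 hb1 (by fun_prop) ?_ ?_).mul
    (differentiableAt_dilogS_comp hb0 hb1 (by fun_prop) ?_ ?_)).mul
    (DifferentiableAt.div (by fun_prop)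
      ((differentiableAt_dilogS_comp hb0 hb1 (by fun_prop) ?_ ?_).mul
      (differentiableAt_dilogS_comp hb0 hb1 (by fun_prop) ?_ ?_))
      (mul_ne_zero (dilogS_ne_zero b ?_ ?_) (dilogS_ne_zero b ?_ ?_)))
  all_goals (simp; linarith)

end regularity

theorem admissible_real {b s ε : ℝ} (hε : 0 < ε) (h1 : ε ≤ s) (h2 : s ≤ bigQ b / 2 - ε) :
    Admissible b ε 0 0 0 s := by
  have h3 : |bigQ b / 2 - 0| = bigQ b / 2 := by
    rw [sub_zero, abs_of_pos (by linarith)]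
  constructor <;> (try rw [h3]) <;> (try rw [abs_zero]) <;> linarith

theorem integrable_contourIntegrand {b ε : ℝ} (hb0 : 0 < b) (hb1 : b < 1) (l₁ l₂ : ℝ)
    {x y z : ℂ} (α : ℝ) {s : ℝ} (h : Admissible b ε x.im y.im z.im s) :
    Integrable fun u : ℝ => contourIntegrand b l₁ l₂ x y z α (u - s * I) := by
  have hε := h.ε_pos
  obtain ⟨C, hC, hbd⟩ := exists_norm_contourIntegrand_le hb0 hb1 hε
  set V := |α| + |x.re| + |y.re| + |z.re| + |l₁| + |l₂| with hV
  have p1 := abs_nonneg α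
  have p2 := abs_nonneg x.re
  have p3 := abs_nonneg y.re
  have p4 := abs_nonneg z.re
  have p5 := abs_nonneg l₁
  have p6 := abs_nonneg l₂
  have hcont : Continuous fun u : ℝ => contourIntegrand b l₁ l₂ x y z α (u - s * I) := by
    rw [continuous_iff_continuousAt]
    intro u
    refine continuousAt_contourIntegrand (ε := ε) hb0 hb1 l₁ l₂ (by fun_prop) (by fun_prop)
      (by fun_prop) (by fun_prop) (by fun_prop) ?_
    simpa using h
  refine ((integrable_exp_neg_mul_abs (c := Real.pi * ε) (by positivity)).const_mul
    (C * Real.exp (40 * Real.pi * bigQ b * V))).mono' hcont.aestronglyMeasurable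
    (Eventually.of_forall fun u => hbd l₁ l₂ x y z α u s V ε h h.decay ?_ ?_ ?_ ?_ ?_ ?_) <;> linarith

theorem tendsto_const_mul_exp_neg (K : ℝ) {c : ℝ} (hc : 0 < c) :
    Tendsto (fun u => K * Real.exp (-c * u)) atTop (𝓝 0) := by
  simpa using (tendsto_exp_neg_mul_atTop hc).const_mul K

/-- All arguments of S_b stay in the open strip between the two lines, so there are no poles there,
and the decay is uniform. -/
theorem integral_contourIntegrand_eq_of_le {b : ℝ} (hb0 : 0 < b) (hb1 : b < 1) (l₁ l₂ x y z α : ℝ)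
    {s s' : ℝ} (hs : 0 < s) (hss : s ≤ s') (hs' : s' < bigQ b / 2) :
    ∫ u : ℝ, contourIntegrand b l₁ l₂ x y z α (u - s * I) =
      ∫ u : ℝ, contourIntegrand b l₁ l₂ x y z α (u - s' * I) := by
  obtain ⟨ε, hε, hε1, hε2⟩ : ∃ ε, 0 < ε ∧ ε ≤ s ∧ ε ≤ bigQ b / 2 - s' :=
    ⟨min s (bigQ b / 2 - s'), lt_min hs (by linarith), min_le_left _ _, min_le_right _ _⟩
  have hadm : ∀ t, s ≤ t → t ≤ s' → Admissible b ε 0 0 0 t := fun t h1 h2 =>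
    admissible_real hε (by linarith) (by linarith)
  obtain ⟨C, hC, hbd⟩ := exists_norm_contourIntegrand_le hb0 hb1 hε
  set V := |α| + |x| + |y| + |z| + |l₁| + |l₂| with hV
  have p1 := abs_nonneg α
  have p2 := abs_nonneg x
  have p3 := abs_nonneg y
  have p4 := abs_nonneg z
  have p5 := abs_nonneg l₁
  have p6 := abs_nonneg l₂
  have e : ∀ t u : ℝ, (u : ℂ) + ((-t : ℝ) : ℂ) * I = u - t * I := by intro t u; push_cast; ring
  have key := integral_horizontal_eq (a := -s') (b := -s) (by linarith)
    (f := contourIntegrand b l₁ l₂ x y z α) (by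
      intro r hr
      refine (differentiableAt_contourIntegrand (ε := ε) hb0 hb1 l₁ l₂ α (by fun_prop) (by fun_prop)
        (by fun_prop) (by fun_prop) ?_).differentiableWithinAt
      simpa using hadm (-r.im) (by linarith [hr.2]) (by linarith [hr.1]))
    (tendsto_const_mul_exp_neg (C * Real.exp (40 * Real.pi * bigQ b * V))
      (c := Real.pi * ε) (by positivity)) (by
      intro u _ t ht
      have h0 := hadm (-t) (by linarith [ht.2]) (by linarith [ht.1])
      have h1 := hbd l₁ l₂ x y z α u (-t) V ε (by simpa using h0) (by simpa using h0.decay)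
      have h2 : (u : ℂ) - ((-t : ℝ) : ℂ) * I = u + t * I := by push_cast; ring
      rw [h2] at h1
      refine h1 ?_ ?_ ?_ ?_ ?_ ?_ <;> (try simp only [ofReal_re]) <;> linarith) (by
      simp_rw [e]
      exact integrable_contourIntegrand hb0 hb1 l₁ l₂ α (by simpa using hadm s' hss le_rfl)) (by
      simp_rw [e]
      exact integrable_contourIntegrand hb0 hb1 l₁ l₂ α (by simpa using hadm s le_rfl hss))
  simp_rw [e] at key
  exact key.symm

theorem cgIntegrand_eq (b l₁ l₂ x y α z : ℝ) (r : ℂ) :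
    cgIntegrand b l₁ l₂ x y α z r = contourIntegrand b l₁ l₂ x y z α r := rfl

theorem cgPrefactor_eq (b l₁ l₂ y α z : ℝ) :
    cgPrefactor b l₁ l₂ y α z = contourPrefactor b l₁ l₂ y z α := rfl

theorem cgDensity_eq {b : ℝ} (hb0 : 0 < b) (hb1 : b < 1) (l₁ l₂ x y z α : ℝ)
    {s : ℝ} (hs : 0 < s) (hs' : s < bigQ b / 2) :
    cgDensity b l₁ l₂ x y α z = contourPrefactor b l₁ l₂ y z α *
      ∫ u : ℝ, contourIntegrand b l₁ l₂ x y z α (u - s * I) := by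
  have hQ := bigQ_pos hb0
  unfold cgDensity
  rw [cgPrefactor_eq]
  simp_rw [cgIntegrand_eq]
  congr 1
  rcases le_total s (bigQ b / 4) with h | h
  · exact (integral_contourIntegrand_eq_of_le hb0 hb1 l₁ l₂ x y z α hs h (by linarith)).symm
  · exact integral_contourIntegrand_eq_of_le hb0 hb1 l₁ l₂ x y z α (by linarith) h hs'

/-- Absolute convergence and independence of the contour. -/
theorem contour_convergence {b : ℝ} (hb0 : 0 < b) (hb1 : b < 1) (l₁ l₂ x y z α : ℝ)
    {s : ℝ} (hs : 0 < s) (hs' : s < bigQ b / 2) :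
    Integrable (fun u : ℝ => cgIntegrand b l₁ l₂ x y α z ((u : ℂ) - s * I)) ∧
      cgDensity b l₁ l₂ x y α z = cgPrefactor b l₁ l₂ y α z *
        ∫ u : ℝ, cgIntegrand b l₁ l₂ x y α z ((u : ℂ) - s * I) := by
  refine ⟨?_, cgDensity_eq hb0 hb1 l₁ l₂ x y z α hs hs'⟩
  simp_rw [cgIntegrand_eq]
  refine integrable_contourIntegrand (ε := min s (bigQ b / 2 - s)) hb0 hb1 l₁ l₂ α ?_
  simpa using admissible_real (lt_min hs (by linarith)) (min_le_left _ _)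
    (by linarith [min_le_right s (bigQ b / 2 - s)])

end ContourIntegral

/-! ### Gaussian bounds, shift operators, q-numbers and the test space. -/

section TestFunctions

/-! ### Gaussian bounds -/

/-- Completing the square: half of the Gaussian absorbs the linear exponent. -/
theorem mul_abs_le_of_gaussian {c : ℝ} (hc : 0 < c) (κ v : ℝ) :
    κ * |v| - c * v ^ 2 ≤ κ ^ 2 / (2 * c) - c / 2 * v ^ 2 := by
  have h : 0 ≤ (c * |v| - κ) ^ 2 / (2 * c) := by positivity
  have e : (c * |v| - κ) ^ 2 / (2 * c) = c / 2 * |v| ^ 2 - κ * |v| + κ ^ 2 / (2 * c) := by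
    field_simp; ring
  rw [e, sq_abs] at h
  linarith

theorem integrable_exp_abs_sub_sq (κ y : ℝ) {c : ℝ} (hc : 0 < c) :
    Integrable fun x : ℝ => Real.exp (κ * |x| - c * (x + y) ^ 2) := by
  have hg : Integrable fun x : ℝ => Real.exp (-(c / 2) * (x + y) ^ 2) :=
    (integrable_exp_neg_mul_sq (b := c / 2) (by positivity)).comp_add_right y
  refine (hg.const_mul (Real.exp (|κ| * |y| + |κ| ^ 2 / (2 * c)))).mono' (by fun_prop)
    (Eventually.of_forall fun x => ?_)
  rw [Real.norm_of_nonneg (Real.exp_pos _).le, ← Real.exp_add]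
  apply Real.exp_le_exp.2
  have h1 := mul_abs_le_of_gaussian hc |κ| (x + y)
  have h2 : κ * |x| ≤ |κ| * (|x + y| + |y|) := by
    refine mul_le_mul (le_abs_self _) ?_ (abs_nonneg _) (abs_nonneg _)
    calc |x| = |(x + y) - y| := by ring_nf
      _ ≤ _ := abs_sub _ _
  linarith

theorem memLp_exp_abs_sub_sq (M κ y : ℝ) {c : ℝ} (hc : 0 < c) :
    MemLp (fun x : ℝ => M * Real.exp (κ * |x| - c * (x + y) ^ 2)) 2 volume := by
  rw [memLp_two_iff_integrable_sq (by fun_prop)]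
  refine ((integrable_exp_abs_sub_sq (2 * κ) y (c := 2 * c) (by positivity)).const_mul
    (M ^ 2)).congr (Eventually.of_forall fun x => ?_)
  simp only
  rw [mul_pow, ← Real.exp_nat_mul]
  congr 2
  push_cast
  ring

theorem memLp_of_gaussian_bound {g : ℝ → ℂ} (hg : Continuous g) {M κ c y : ℝ} (hc : 0 < c)
    (h : ∀ x, ‖g x‖ ≤ M * Real.exp (κ * |x| - c * (x + y) ^ 2)) : MemLp g 2 volume :=
  (memLp_exp_abs_sub_sq M κ y hc).mono' hg.aestronglyMeasurable (Eventually.of_forall h)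

theorem shiftGraph_of_gaussian_bound {a : ℝ} {Φ : ℂ → ℂ}
    (hΦ : AnalyticOnNhd ℂ Φ {w : ℂ | w.im ∈ Set.uIcc 0 a}) {M κ c y : ℝ} (hc : 0 < c)
    (h : ∀ t ∈ Set.uIcc 0 a, ∀ x : ℝ, ‖Φ (x + t * I)‖ ≤ M * Real.exp (κ * |x| - c * (x + y) ^ 2)) :
    ShiftGraph a (fun x => Φ x) (fun x => Φ (x + a * I)) := by
  refine ⟨Φ, hΦ, fun _ => rfl, fun _ => rfl, ?_⟩
  have hB := memLp_exp_abs_sub_sq M κ y hc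
  refine ⟨(eLpNorm (fun x : ℝ => M * Real.exp (κ * |x| - c * (x + y) ^ 2)) 2 volume).toNNReal,
    fun t ht => ?_⟩
  rw [ENNReal.coe_toNNReal hB.eLpNorm_ne_top]
  exact eLpNorm_mono_real (h t ht)

/-- The `q`-number with the argument scaled by `b⁻¹`. -/
theorem qNum_div {b : ℝ} (hb0 : 0 < b) (v : ℂ) :
    qNum b (v / b) = I / (qPow b 1 - qPow b (-1)) * twoSin b v := by
  have hb : (b : ℂ) ≠ 0 := by exact_mod_cast hb0.ne'
  unfold qNum
  have e : qPow b (v / b) - qPow b (-(v / b)) = I * twoSin b v := by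
    unfold qPow twoSin
    rw [Complex.sin]
    have e1 : (Real.pi * I * (b : ℂ) ^ 2 * (v / b) : ℂ) = Real.pi * b * v * I := by
      field_simp
    have e2 : (Real.pi * I * (b : ℂ) ^ 2 * (-(v / b)) : ℂ) = -(Real.pi * b * v) * I := by
      field_simp
    rw [e1, e2]
    linear_combination (exp (Real.pi * b * v * I) - exp (-(Real.pi * b * v) * I)) * I_sq
  rw [e]
  ring

/-- The constant `i/(q - q⁻¹)`. -/
noncomputable def qConst (b : ℝ) : ℂ := I / (qPow b 1 - qPow b (-1))

/-- The coefficients of E and F become sines with one common constant, which factors out of the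
intertwining relations. -/
theorem qNum_E {b : ℝ} (hb0 : 0 < b) (v : ℂ) :
    qNum b (bigQ b / (2 * b) + I / b * v) = qConst b * twoSin b (bigQ b / 2 + I * v) := by
  have hb : (b : ℂ) ≠ 0 := by exact_mod_cast hb0.ne'
  rw [qConst, ← qNum_div hb0]
  congr 1
  field_simp

theorem norm_qNum_le {b : ℝ} (hb0 : 0 < b) (v : ℝ) :
    ‖qNum b (bigQ b / (2 * b) + I / b * v)‖ ≤
      ‖qConst b‖ * 2 * Real.exp (Real.pi * b * |v|) := by
  rw [qNum_E hb0, norm_mul, mul_assoc]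
  gcongr
  refine (norm_twoSin_le _ _).trans (le_of_eq ?_)
  have : (bigQ b / 2 + I * v : ℂ).im = v := by simp
  rw [this, abs_mul, abs_of_pos (by have := Real.pi_pos; positivity)]

theorem continuous_qNum (b : ℝ) {X : Type*} [TopologicalSpace X] {v : X → ℂ} (hv : Continuous v) :
    Continuous fun x => qNum b (v x) := by
  unfold qNum qPow
  fun_prop

/-! ### The test space -/

theorem exists_norm_eval_le (P : Polynomial ℂ) :
    ∃ C > 0, ∀ w : ℂ, ‖P.eval w‖ ≤ C * Real.exp ‖w‖ := by
  induction P using Polynomial.induction_on' with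
  | add p q hp hq =>
    obtain ⟨C, hC, h⟩ := hp
    obtain ⟨D, hD, h'⟩ := hq
    refine ⟨C + D, by positivity, fun w => ?_⟩
    rw [Polynomial.eval_add, add_mul]
    exact (norm_add_le _ _).trans (add_le_add (h w) (h' w))
  | monomial n a =>
    refine ⟨‖a‖ * n.factorial + 1, by positivity, fun w => ?_⟩
    rw [Polynomial.eval_monomial, norm_mul, norm_pow]
    have h := Real.pow_div_factorial_le_exp ‖w‖ (norm_nonneg w) n
    rw [div_le_iff₀ (by positivity)] at h
    calc ‖a‖ * ‖w‖ ^ n ≤ ‖a‖ * (Real.exp ‖w‖ * n.factorial) := by gcongr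
      _ ≤ _ := by nlinarith [Real.exp_pos ‖w‖]

/-- The strip of half-width 2 leaves room around the shifts by ±ib, since b < 1. Half of the
Gaussian absorbs the linear exponent and the polynomial; the constants use (Im w)² ≤ 4 and |w| ≤ |Re
w| + 2. -/
theorem exists_norm_gaussian_le {r : ℝ} (hr : 0 < r) (s : ℂ) (P : Polynomial ℂ) :
    ∃ C > 0, ∀ w : ℂ, |w.im| ≤ 2 → ‖exp (-(r : ℂ) * w ^ 2 + s * w) * P.eval w‖ ≤
      C * Real.exp (-(r / 2) * w.re ^ 2) := by
  obtain ⟨C, hC, h⟩ := exists_norm_eval_le P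
  set k := ‖s‖ + 1 with hk
  refine ⟨C * Real.exp (4 * r + 2 * k + k ^ 2 / (2 * r)), by positivity, fun w hw => ?_⟩
  have hwn : ‖w‖ ≤ |w.re| + 2 := (norm_le_abs_re_add_abs_im w).trans (by linarith)
  have him : w.im ^ 2 ≤ 4 := by
    have := sq_le_sq' (by linarith [neg_abs_le w.im]) ((le_abs_self w.im).trans hw)
    linarith
  rw [norm_mul, Complex.norm_exp]
  have e1 : (-(r : ℂ) * w ^ 2 + s * w).re ≤ -r * w.re ^ 2 + r * 4 + ‖s‖ * ‖w‖ := by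
    rw [add_re, ← norm_mul]
    refine add_le_add ?_ (re_le_norm _)
    have : (-(r : ℂ) * w ^ 2).re = -r * w.re ^ 2 + r * w.im ^ 2 := by
      rw [← ofReal_neg, re_ofReal_mul, sq, mul_re]; ring
    rw [this]
    gcongr
  calc _ ≤ Real.exp (-r * w.re ^ 2 + r * 4 + ‖s‖ * ‖w‖) * (C * Real.exp ‖w‖) := by
        gcongr
        exact h w
    _ = C * Real.exp (-r * w.re ^ 2 + r * 4 + k * ‖w‖) := by
        rw [mul_left_comm, ← Real.exp_add, hk]; ring_nf
    _ ≤ C * Real.exp (4 * r + 2 * k + k ^ 2 / (2 * r) + -(r / 2) * w.re ^ 2) := by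
        refine mul_le_mul_of_nonneg_left (Real.exp_le_exp.2 ?_) hC.le
        have h1 := mul_abs_le_of_gaussian hr k w.re
        have h2 : k * ‖w‖ ≤ k * (|w.re| + 2) := by gcongr
        linarith
    _ = _ := by rw [Real.exp_add]; ring

/-- `Ψ` extends the function `f(α, z)` to complex `z`, holomorphically and with Gaussian decay, and
the space of test functions contains all functions derived from it by complex shifts in `z` and
multiplication by exponentials. -/
structure EntireExtension (f : ℝ → ℝ → ℂ) (Ψ : ℝ → ℂ → ℂ) : Prop where
  coe : ∀ α z : ℝ, Ψ α z = f α z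
  cont : Continuous fun p : ℝ × ℂ => Ψ p.1 p.2
  diff : ∀ α, Differentiable ℂ (Ψ α)
  bound : ∃ C > 0, ∃ c > 0, ∀ (α : ℝ) (w : ℂ), |w.im| ≤ 2 →
    ‖Ψ α w‖ ≤ C * Real.exp (-c * (α ^ 2 + w.re ^ 2))
  mem : ∀ A B t : ℂ, (fun α z : ℝ => exp (A * α + B * z) * Ψ α (z + t)) ∈ testSpace

theorem coreW_exp_shift {r : ℝ} (hr : 0 < r) (s : ℂ) (P : Polynomial ℂ) (B t : ℂ) :
    (fun z : ℝ => exp (B * z) * (exp (-(r : ℂ) * (z + t) ^ 2 + s * (z + t)) * P.eval (z + t))) ∈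
      coreW := by
  refine ⟨r, s + B - 2 * r * t,
    Polynomial.C (exp (-(r : ℂ) * t ^ 2 + s * t)) * P.comp (Polynomial.X + Polynomial.C t), hr,
    fun z => ?_⟩
  simp only [Polynomial.eval_mul, Polynomial.eval_C, Polynomial.eval_comp, Polynomial.eval_add,
    Polynomial.eval_X]
  rw [← mul_assoc, ← mul_assoc, ← Complex.exp_add, ← Complex.exp_add]
  congr 2
  ring

theorem exists_entireExtension {f : ℝ → ℝ → ℂ} (hf : f ∈ testSpace) :
    ∃ Ψ, EntireExtension f Ψ := by
  induction hf using Submodule.span_induction with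
  | mem f hf =>
    obtain ⟨φ, ⟨r, s, P, hr, hφ⟩, ψ, ⟨r', s', P', hr', hψ⟩, rfl⟩ := hf
    refine ⟨fun α w => (exp (-(r : ℂ) * (α : ℂ) ^ 2 + s * α) * P.eval (α : ℂ)) *
      (exp (-(r' : ℂ) * w ^ 2 + s' * w) * P'.eval w), ?_, ?_, ?_, ?_, ?_⟩
    · intro α z
      rw [hφ, hψ]
    · have h1 : Continuous fun p : ℝ × ℂ => P.eval (p.1 : ℂ) := P.continuous.comp (by fun_prop)
      have h2 : Continuous fun p : ℝ × ℂ => P'.eval p.2 := P'.continuous.comp (by fun_prop)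
      fun_prop
    · intro α
      have h2 := P'.differentiable
      fun_prop
    · obtain ⟨C, hC, h⟩ := exists_norm_gaussian_le hr s P
      obtain ⟨C', hC', h'⟩ := exists_norm_gaussian_le hr' s' P'
      refine ⟨C * C', by positivity, min (r / 2) (r' / 2), by positivity, fun α w hw => ?_⟩
      rw [norm_mul]
      have h1 := h α (by simp)
      have h2 := h' w hw
      rw [ofReal_re] at h1
      calc _ ≤ (C * Real.exp (-(r / 2) * α ^ 2)) * (C' * Real.exp (-(r' / 2) * w.re ^ 2)) := by
            gcongr
        _ = C * C' * Real.exp (-(r / 2) * α ^ 2 + -(r' / 2) * w.re ^ 2) := by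
            rw [Real.exp_add]; ring
        _ ≤ _ := by
            gcongr
            have e1 := mul_le_mul_of_nonneg_right (min_le_left (r / 2) (r' / 2)) (sq_nonneg α)
            have e2 := mul_le_mul_of_nonneg_right (min_le_right (r / 2) (r' / 2)) (sq_nonneg w.re)
            linarith
    · intro A B t
      refine Submodule.subset_span ⟨_, coreW_exp_shift hr s P A 0, _,
        coreW_exp_shift hr' s' P' B t, ?_⟩
      funext α z
      rw [Complex.exp_add, add_zero]
      ring
  | zero =>
    refine ⟨fun _ _ => 0, ?_, ?_, ?_, ?_, ?_⟩
    · intro α z; rfl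
    · fun_prop
    · intro α; fun_prop
    · exact ⟨1, one_pos, 1, one_pos, fun α w _ => by simpa using (Real.exp_pos _).le⟩
    · intro A B t
      simp only [mul_zero]
      exact testSpace.zero_mem
  | add f g _ _ hf hg =>
    obtain ⟨Ψ, h⟩ := hf
    obtain ⟨Ψ', h'⟩ := hg
    refine ⟨fun α w => Ψ α w + Ψ' α w, ?_, ?_, ?_, ?_, ?_⟩
    · intro α z; simp only [h.coe, h'.coe]; rfl
    · exact h.cont.add h'.cont
    · exact fun α => (h.diff α).add (h'.diff α)
    · obtain ⟨C, hC, c, hc, hb⟩ := h.bound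
      obtain ⟨C', hC', c', hc', hb'⟩ := h'.bound
      refine ⟨C + C', by positivity, min c c', by positivity, fun α w hw => ?_⟩
      refine (norm_add_le _ _).trans ?_
      rw [add_mul]
      refine add_le_add ((hb α w hw).trans ?_) ((hb' α w hw).trans ?_)
      · gcongr
        exact min_le_left _ _
      · gcongr
        exact min_le_right _ _
    · intro A B t
      have := testSpace.add_mem (h.mem A B t) (h'.mem A B t)
      convert this using 1
      funext α z
      simp only [Pi.add_apply]
      ring
  | smul k f _ hf =>
    obtain ⟨Ψ, h⟩ := hf
    refine ⟨fun α w => k * Ψ α w, ?_, ?_, ?_, ?_, ?_⟩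
    · intro α z; simp only [h.coe]; rfl
    · exact continuous_const.mul h.cont
    · exact fun α => (h.diff α).const_mul k
    · obtain ⟨C, hC, c, hc, hb⟩ := h.bound
      refine ⟨(‖k‖ + 1) * C, by positivity, c, hc, fun α w hw => ?_⟩
      rw [norm_mul, mul_assoc]
      have := hb α w hw
      gcongr
      linarith
    · intro A B t
      have := testSpace.smul_mem k (h.mem A B t)
      convert this using 1
      funext α z
      simp only [Pi.smul_apply, smul_eq_mul]
      ring

end TestFunctions

/-! ### The transform as an absolutely convergent double integral, continued in x and y. -/

section Transformation

/-- The integrand of the transformation over `(α, u)`, `r = u - is`, for complex `x` and `y`. -/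
noncomputable def transformIntegrand (b l₁ l₂ s : ℝ) (Ψ : ℝ → ℂ → ℂ) (x y : ℂ) (p : ℝ × ℝ) : ℂ :=
  contourPrefactor b l₁ l₂ y (x + y) p.1 * contourIntegrand b l₁ l₂ x y (x + y) p.1 (p.2 - s * I) *
    Ψ p.1 (x + y)

/-- The product measure on `(α, u)`, `α > 0`. -/
noncomputable def transformMeasure : Measure (ℝ × ℝ) :=
  (volume.restrict (Set.Ioi (0 : ℝ))).prod volume

/-- The transformation, continued to complex `x` and `y`. -/
noncomputable def transform (b l₁ l₂ s : ℝ) (Ψ : ℝ → ℂ → ℂ) (x y : ℂ) : ℂ :=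
  ∫ p, transformIntegrand b l₁ l₂ s Ψ x y p ∂transformMeasure

/-- Admissibility of a pair `(x, y)`. -/
def AdmissiblePair (b ε s : ℝ) (x y : ℂ) : Prop :=
  Admissible b ε x.im y.im (x + y).im s ∧ |(x + y).im| ≤ 2 - ε

variable {b l₁ l₂ s ε : ℝ} {f : ℝ → ℝ → ℂ} {Ψ : ℝ → ℂ → ℂ}

theorem AdmissiblePair.of_near {x y x' y' : ℂ} (h : AdmissiblePair b ε s x y)
    (hx : |x'.im - x.im| ≤ ε / 16) (hy : |y'.im - y.im| ≤ ε / 16) :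
    AdmissiblePair b (ε / 2) s x' y' := by
  have hε := h.1.ε_pos
  have hz : |(x' + y').im - (x + y).im| ≤ ε / 8 := by
    have : (x' + y').im - (x + y).im = (x'.im - x.im) + (y'.im - y.im) := by simp; ring
    rw [this]
    exact (abs_add_le _ _).trans (by linarith)
  refine ⟨h.1.of_near (by linarith) (by linarith) hz, ?_⟩
  calc |(x' + y').im| = |(x + y).im + ((x' + y').im - (x + y).im)| := by ring_nf
    _ ≤ _ := abs_add_le _ _
    _ ≤ _ := by linarith [h.2]

/-- The dominating function in `(α, u)`. -/
noncomputable def dominant (κ c ε : ℝ) (p : ℝ × ℝ) : ℝ :=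
  Real.exp (κ * |p.1| - c * p.1 ^ 2) * Real.exp (-(Real.pi * ε) * |p.2|)

theorem integrable_dominant (κ : ℝ) {c ε : ℝ} (hc : 0 < c) (hε : 0 < ε) :
    Integrable (dominant κ c ε) transformMeasure := by
  have h1 := integrable_exp_abs_sub_sq κ 0 hc
  simp only [add_zero] at h1
  exact (h1.restrict (s := Set.Ioi 0)).mul_prod
    (integrable_exp_neg_mul_abs (c := Real.pi * ε) (by positivity))

/-- Prefactor and contour integrand each grow at most like e^{40πQV}, with V a sum of absolute
values, so the product splits into separate exponentials. The decay of Ψ supplies Gaussians in α and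
in Re x + Re y; the first makes the integral over α converge, the second makes slices in x or y
square integrable. -/
theorem exists_norm_transformIntegrand_le (hb0 : 0 < b) (hb1 : b < 1) (l₁ l₂ : ℝ) (hε : 0 < ε)
    (hΨ : EntireExtension f Ψ) :
    ∃ M > 0, ∃ κ > 0, ∃ c > 0, ∀ (s : ℝ) (x y : ℂ), AdmissiblePair b ε s x y → ∀ p : ℝ × ℝ,
      ‖transformIntegrand b l₁ l₂ s Ψ x y p‖ ≤
        M * Real.exp (κ * (|x.re| + |y.re|) - c * (x.re + y.re) ^ 2) * dominant κ c ε p := by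
  obtain ⟨C₁, hC₁, h₁⟩ := exists_norm_contourPrefactor_le hb0 hb1 hε
  obtain ⟨C₂, hC₂, h₂⟩ := exists_norm_contourIntegrand_le hb0 hb1 hε
  obtain ⟨C₃, hC₃, c, hc, h₃⟩ := hΨ.bound
  have hQ := bigQ_pos hb0
  have hπ := Real.pi_pos
  refine ⟨C₁ * C₂ * C₃ * Real.exp (80 * Real.pi * bigQ b * (|l₁| + |l₂|)), by positivity,
    80 * Real.pi * bigQ b, by positivity, c, hc, ?_⟩
  rintro s x y ⟨adm, hz⟩ ⟨α, u⟩
  set V := |α| + |x.re| + |y.re| + |l₁| + |l₂| with hV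
  have p1 := abs_nonneg α
  have p2 := abs_nonneg x.re
  have p3 := abs_nonneg y.re
  have p5 := abs_nonneg l₁
  have p6 := abs_nonneg l₂
  have hzre : |(x + y).re| ≤ V := by
    rw [add_re]
    exact (abs_add_le _ _).trans (by linarith)
  have n1 := h₁ l₁ l₂ y (x + y) α V adm.c_lower adm.c_upper adm.e_lower
    (by linarith [adm.es_upper, adm.s_lower]) (by linarith) (by linarith) hzre (by linarith)
    (by linarith)
  have n2 := h₂ l₁ l₂ x y (x + y) α u s V ε adm adm.decay (by linarith) (by linarith) (by linarith) hzre
    (by linarith) (by linarith)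
  have n3 := h₃ α (x + y) (by linarith)
  unfold transformIntegrand dominant
  simp only [norm_mul]
  calc _ ≤ (C₁ * Real.exp (40 * Real.pi * bigQ b * V)) *
        (C₂ * Real.exp (40 * Real.pi * bigQ b * V) * Real.exp (-(Real.pi * ε) * |u|)) *
        (C₃ * Real.exp (-c * (α ^ 2 + (x + y).re ^ 2))) := by gcongr
    _ = C₁ * C₂ * C₃ * (Real.exp (40 * Real.pi * bigQ b * V) * Real.exp (40 * Real.pi * bigQ b * V)
        * Real.exp (-c * (α ^ 2 + (x + y).re ^ 2))) * Real.exp (-(Real.pi * ε) * |u|) := by ring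
    _ = C₁ * C₂ * C₃ * (Real.exp (80 * Real.pi * bigQ b * (|l₁| + |l₂|)) *
        Real.exp (80 * Real.pi * bigQ b * (|x.re| + |y.re|) - c * (x.re + y.re) ^ 2) *
        Real.exp (80 * Real.pi * bigQ b * |α| - c * α ^ 2)) * Real.exp (-(Real.pi * ε) * |u|) := by
      congr 2
      simp only [← Real.exp_add]
      congr 1
      rw [hV, add_re]
      ring
    _ = _ := by ring

theorem aestronglyMeasurable_transformIntegrand (hb0 : 0 < b) (hb1 : b < 1)
    (hΨ : EntireExtension f Ψ) {x y : ℂ} (h : AdmissiblePair b ε s x y) :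
    AEStronglyMeasurable (transformIntegrand b l₁ l₂ s Ψ x y) transformMeasure := by
  refine Continuous.aestronglyMeasurable ?_
  rw [continuous_iff_continuousAt]
  intro p
  unfold transformIntegrand
  refine ContinuousAt.mul (ContinuousAt.mul ?_ ?_) ?_
  · exact continuousAt_contourPrefactor (ε := ε) hb0 hb1 l₁ l₂ (by fun_prop) (by fun_prop)
      (by fun_prop) h.1
  · refine continuousAt_contourIntegrand (ε := ε) hb0 hb1 l₁ l₂ (by fun_prop) (by fun_prop)
      (by fun_prop) (by fun_prop) (by fun_prop) ?_
    simpa using h.1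
  · exact (hΨ.cont.comp (by fun_prop : Continuous fun p : ℝ × ℝ => (p.1, x + y))).continuousAt

theorem integrable_transformIntegrand (hb0 : 0 < b) (hb1 : b < 1)
    (hΨ : EntireExtension f Ψ) {x y : ℂ} (h : AdmissiblePair b ε s x y) :
    Integrable (transformIntegrand b l₁ l₂ s Ψ x y) transformMeasure := by
  have hε := h.1.ε_pos
  obtain ⟨M, hM, κ, hκ, c, hc, hbd⟩ := exists_norm_transformIntegrand_le hb0 hb1 l₁ l₂ hε hΨ
  exact ((integrable_dominant κ hc hε).const_mul _).mono'
    (aestronglyMeasurable_transformIntegrand hb0 hb1 hΨ h) (Eventually.of_forall (hbd s x y h))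

theorem exists_norm_transform_le (hb0 : 0 < b) (hb1 : b < 1) (l₁ l₂ : ℝ) (hε : 0 < ε)
    (hΨ : EntireExtension f Ψ) :
    ∃ M > 0, ∃ κ > 0, ∃ c > 0, ∀ (s : ℝ) (x y : ℂ), AdmissiblePair b ε s x y →
      ‖transform b l₁ l₂ s Ψ x y‖ ≤
        M * Real.exp (κ * (|x.re| + |y.re|) - c * (x.re + y.re) ^ 2) := by
  obtain ⟨M, hM, κ, hκ, c, hc, hbd⟩ := exists_norm_transformIntegrand_le hb0 hb1 l₁ l₂ hε hΨ
  have hnn : 0 ≤ ∫ p, dominant κ c ε p ∂transformMeasure :=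
    integral_nonneg fun p => by unfold dominant; positivity
  refine ⟨M * (∫ p, dominant κ c ε p ∂transformMeasure) + 1, by positivity, κ, hκ, c, hc,
    fun s x y h => ?_⟩
  have := norm_integral_le_of_norm_le ((integrable_dominant κ hc hε).const_mul _)
    (Eventually.of_forall (hbd s x y h))
  rw [integral_const_mul] at this
  refine this.trans ?_
  nlinarith [Real.exp_pos (κ * (|x.re| + |y.re|) - c * (x.re + y.re) ^ 2)]

/-- Taking x and y as functions of one complex variable covers holomorphy in either argument with
the other one fixed. -/
theorem analyticAt_transform (hb0 : 0 < b) (hb1 : b < 1) (l₁ l₂ : ℝ)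
    (hΨ : EntireExtension f Ψ) {x y : ℂ → ℂ} (hx : Differentiable ℂ x) (hy : Differentiable ℂ y)
    {w : ℂ} (h : AdmissiblePair b ε s (x w) (y w)) :
    AnalyticAt ℂ (fun w => transform b l₁ l₂ s Ψ (x w) (y w)) w := by
  have hε := h.1.ε_pos
  have hε2 : 0 < ε / 2 := half_pos hε
  obtain ⟨M, hM, κ, hκ, c, hc, hbd⟩ := exists_norm_transformIntegrand_le hb0 hb1 l₁ l₂ hε2 hΨ
  -- The two balls keep the pair admissible with margin ε/2; the last condition bounds the
  -- exponential growth, so that one function dominates on all of `U`.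
  set U : Set ℂ := (fun w' => x w' - x w) ⁻¹' Metric.ball 0 (ε / 16) ∩
    (fun w' => y w' - y w) ⁻¹' Metric.ball 0 (ε / 16) ∩
    {w' | κ * (|(x w').re| + |(y w').re|) < κ * (|(x w).re| + |(y w).re|) + 1} with hU
  have hxc := hx.continuous
  have hyc := hy.continuous
  have hUo : IsOpen U := by
    refine ((Metric.isOpen_ball.preimage (by fun_prop)).inter
      (Metric.isOpen_ball.preimage (by fun_prop))).inter (isOpen_lt (by fun_prop) (by fun_prop))
  have hwU : w ∈ U := by
    refine ⟨⟨?_, ?_⟩, ?_⟩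
    · simp [hε]
    · simp [hε]
    · simp
  have hadm : ∀ w' ∈ U, AdmissiblePair b (ε / 2) s (x w') (y w') := by
    intro w' hw'
    have h1 : ‖x w' - x w‖ < ε / 16 := by simpa using hw'.1.1
    have h2 : ‖y w' - y w‖ < ε / 16 := by simpa using hw'.1.2
    refine h.of_near ?_ ?_
    · rw [← sub_im]; exact (abs_im_le_norm _).trans h1.le
    · rw [← sub_im]; exact (abs_im_le_norm _).trans h2.le
  refine DifferentiableOn.analyticAt (s := U) ?_ (hUo.mem_nhds hwU)
  refine differentiableOn_integral_of_dominated_holomorphic hUo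
    (B := fun p => M * Real.exp (κ * (|(x w).re| + |(y w).re|) + 1) * dominant κ c (ε / 2) p)
    (fun w' hw' => aestronglyMeasurable_transformIntegrand hb0 hb1 hΨ (hadm w' hw')) ?_
    ((integrable_dominant κ hc hε2).const_mul _) ?_
  · refine Eventually.of_forall fun p w' hw' => DifferentiableAt.differentiableWithinAt ?_
    have ha := hadm w' hw'
    have hxd := hx w'
    have hyd := hy w'
    have hzd := hxd.add hyd
    unfold transformIntegrand
    refine DifferentiableAt.mul (DifferentiableAt.mul ?_ ?_) ?_
    · exact differentiableAt_contourPrefactor (ε := ε / 2) hb0 hb1 l₁ l₂ p.1 hyd hzd ha.1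
    · refine differentiableAt_contourIntegrand (ε := ε / 2) hb0 hb1 l₁ l₂ p.1 hxd hyd hzd
        (by fun_prop) ?_
      simpa using ha.1
    · exact DifferentiableAt.comp w' (hΨ.diff p.1 _) hzd
  · refine Eventually.of_forall fun p w' hw' => (hbd s _ _ (hadm w' hw') p).trans ?_
    have h0 : 0 ≤ dominant κ c (ε / 2) p := by unfold dominant; positivity
    gcongr
    have h3 : κ * (|(x w').re| + |(y w').re|) < κ * (|(x w).re| + |(y w).re|) + 1 := hw'.2
    have h4 : 0 ≤ c * ((x w').re + (y w').re) ^ 2 := by positivity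
    linarith

theorem admissiblePair_real {ε : ℝ} (hε : 0 < ε) (hε1 : ε ≤ 1) (h1 : ε ≤ s)
    (h2 : s ≤ bigQ b / 2 - ε) (x y : ℝ) : AdmissiblePair b ε s x y := by
  refine ⟨by simpa using admissible_real hε h1 h2, ?_⟩
  simp
  linarith

theorem exists_admissible_margin (hs : 0 < s) (hs' : s < bigQ b / 2) :
    ∃ ε, 0 < ε ∧ ε ≤ 1 ∧ ε ≤ s ∧ s ≤ bigQ b / 2 - ε := by
  refine ⟨min 1 (min s (bigQ b / 2 - s)), lt_min one_pos (lt_min hs (by linarith)),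
    min_le_left _ _, (min_le_right _ _).trans (min_le_left _ _), ?_⟩
  have : min 1 (min s (bigQ b / 2 - s)) ≤ bigQ b / 2 - s :=
    (min_le_right _ _).trans (min_le_right _ _)
  linarith

theorem integral_dirac_density (hb0 : 0 < b) (hb1 : b < 1) (l₁ l₂ : ℝ) (hs : 0 < s)
    (hs' : s < bigQ b / 2) (hΨ : EntireExtension f Ψ) (x y α : ℝ) :
    ∫ z : ℝ, cgDensity b l₁ l₂ x y α z * f α z ∂(Measure.dirac (x + y)) =
      ∫ u : ℝ, transformIntegrand b l₁ l₂ s Ψ x y (α, u) := by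
  rw [integral_dirac, cgDensity_eq hb0 hb1 l₁ l₂ x y (x + y) α hs hs', ← hΨ.coe]
  unfold transformIntegrand
  simp only [ofReal_add]
  rw [integral_mul_const, integral_const_mul]

theorem integrableOn_density (hb0 : 0 < b) (hb1 : b < 1) (l₁ l₂ : ℝ) (hf : f ∈ testSpace)
    (x y : ℝ) :
    IntegrableOn (fun α : ℝ => ∫ z : ℝ, cgDensity b l₁ l₂ x y α z * f α z
      ∂(Measure.dirac (x + y))) (Set.Ioi 0) := by
  obtain ⟨Ψ, hΨ⟩ := exists_entireExtension hf
  have hQ := bigQ_pos hb0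
  obtain ⟨ε, hε, h1, h2, h3⟩ := exists_admissible_margin (b := b) (s := bigQ b / 4)
    (by linarith) (by linarith)
  simp_rw [integral_dirac_density hb0 hb1 l₁ l₂ (s := bigQ b / 4) (by linarith) (by linarith) hΨ]
  exact (integrable_transformIntegrand hb0 hb1 hΨ
    (admissiblePair_real hε h1 h2 h3 x y)).integral_prod_left

/-- The height s is free here. The relations for E and F need different heights, and this identifies
the transforms obtained from them. -/
theorem cgTransform_eq (hb0 : 0 < b) (hb1 : b < 1) (l₁ l₂ : ℝ) (hs : 0 < s)
    (hs' : s < bigQ b / 2) (hΨ : EntireExtension f Ψ) (x y : ℝ) :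
    cgTransform b l₁ l₂ f x y = transform b l₁ l₂ s Ψ x y := by
  obtain ⟨ε, hε, h1, h2, h3⟩ := exists_admissible_margin hs hs'
  unfold cgTransform transform
  simp_rw [integral_dirac_density hb0 hb1 l₁ l₂ hs hs' hΨ]
  exact (integral_prod _ (integrable_transformIntegrand hb0 hb1 hΨ
    (admissiblePair_real hε h1 h2 h3 x y))).symm

end Transformation

/-! ### Effect of shifts on the kernel, the pointwise relation for E, and trigonometric identities.
-/

section RaisingIdentity

variable {b l₁ l₂ s ε : ℝ}

/-- By the functional equation a zero of the sine would be a zero of S_b(z + b), and S_b has none in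
the strip. -/
theorem twoSin_ne_zero (hb0 : 0 < b) (hb1 : b < 1) {z : ℂ} (h1 : 0 < z.re) (h2 : z.re < b⁻¹) :
    twoSin b z ≠ 0 := by
  have h := dilogS_ne_zero b (z := z + b) (by simp; linarith) (by simp [bigQ]; linarith)
  rw [dilogS_add hb0 hb1 h1 h2] at h
  exact left_ne_zero_of_mul h

theorem dilogS_sub (hb0 : 0 < b) (hb1 : b < 1) {z : ℂ} (h1 : b < z.re) (h2 : z.re < bigQ b) :
    dilogS b (z - b) = dilogS b z / twoSin b (z - b) := by
  have h3 : 0 < (z - b : ℂ).re := by simpa using h1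
  have h4 : (z - b : ℂ).re < b⁻¹ := by simp [bigQ] at h2 ⊢; linarith
  have h := dilogS_add hb0 hb1 h3 h4
  rw [sub_add_cancel] at h
  rw [h, mul_div_cancel_left₀ _ (twoSin_ne_zero hb0 hb1 h3 h4)]

/-- `e^{πbw}`. -/
noncomputable def expB (b : ℝ) (w : ℂ) : ℂ := exp (Real.pi * b * w)

theorem expB_ne_zero (b : ℝ) (w : ℂ) : expB b w ≠ 0 := Complex.exp_ne_zero _

theorem expB_add (b : ℝ) (v w : ℂ) : expB b (v + w) = expB b v * expB b w := by
  unfold expB; rw [← Complex.exp_add]; ring_nf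

theorem expB_sub (b : ℝ) (v w : ℂ) : expB b (v - w) = expB b v / expB b w := by
  unfold expB; rw [← Complex.exp_sub]; ring_nf

theorem expB_neg (b : ℝ) (w : ℂ) : expB b (-w) = (expB b w)⁻¹ := by
  unfold expB; rw [← Complex.exp_neg]; ring_nf

theorem twoSin_I_mul (b : ℝ) (w : ℂ) : twoSin b (I * w) = I * (expB b w - (expB b w)⁻¹) := by
  rw [← expB_neg, twoSin, Complex.sin]
  unfold expB
  have e1 : (-(Real.pi * b * (I * w)) * I : ℂ) = Real.pi * b * w := by
    linear_combination -(Real.pi * b * w) * I_sq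
  have e2 : (Real.pi * b * (I * w) * I : ℂ) = Real.pi * b * -w := by
    linear_combination (Real.pi * b * w) * I_sq
  rw [e1, e2]
  ring

/-- Since bQ = b² + 1, shifts by b and by Q/2 are expressed through the single quantity e^{-πibQ/2}.
-/
theorem expB_b (hb0 : 0 < b) : expB b (-(I * b)) = -(expB b (-(I * (bigQ b / 2)))) ^ 2 := by
  have h := b_mul_bigQ hb0
  have h' : (b : ℂ) * bigQ b = b ^ 2 + 1 := by exact_mod_cast h
  have e : (Real.pi * b * -(I * b) : ℂ) =
      Real.pi * b * -(I * (bigQ b / 2)) + Real.pi * b * -(I * (bigQ b / 2)) + Real.pi * I := by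
    linear_combination (Real.pi * I) * h'
  unfold expB
  rw [e, Complex.exp_add, Complex.exp_add, Complex.exp_pi_mul_I]
  ring

/-- From bQ - b² = 1 and sin(π - v) = sin v. -/
theorem twoSin_half_sub (hb0 : 0 < b) (v : ℂ) :
    twoSin b (bigQ b / 2 + v - b) = twoSin b (bigQ b / 2 - v) := by
  have h := b_mul_bigQ hb0
  have h' : (b : ℂ) * bigQ b = b ^ 2 + 1 := by exact_mod_cast h
  unfold twoSin
  have e : (Real.pi * b * (bigQ b / 2 + v - b) : ℂ) = Real.pi - Real.pi * b * (bigQ b / 2 - v) := by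
    linear_combination (Real.pi : ℂ) * h'
  rw [e, Complex.sin_pi_sub]

/-! ### Shifts by `ib` -/

theorem contourPrefactor_shift_second (hb0 : 0 < b) (hb1 : b < 1) (l₁ l₂ α z : ℝ) (y : ℂ) :
    contourPrefactor b l₁ l₂ y (z + b * I) α =
      twoSin b (bigQ b / 2 + I * α - I * z) * contourPrefactor b l₁ l₂ y z α := by
  have hb2 := b_lt_half_bigQ hb0 hb1
  have hQ : bigQ b = b + b⁻¹ := rfl
  unfold contourPrefactor
  have e : (bigQ b / 2 + I * α - I * (z + b * I) : ℂ) = bigQ b / 2 + I * α - I * z + b := by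
    linear_combination -(b : ℂ) * I_sq
  rw [e, dilogS_add hb0 hb1 (by simp; linarith) (by simp; linarith)]
  ring

/-- The sine on the left, produced by S_b(Q/2 - iy + iλ₂) in the denominator, is the one in the
coefficient of E on the second tensor factor, so the two cancel. -/
theorem contourPrefactor_shift_both (hb0 : 0 < b) (hb1 : b < 1) (l₁ l₂ α y z : ℝ) :
    twoSin b (bigQ b / 2 - I * y + I * l₂) * contourPrefactor b l₁ l₂ (y + b * I) (z + b * I) α =
      twoSin b (bigQ b / 2 + I * α - I * z) * contourPrefactor b l₁ l₂ y z α := by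
  have hb2 := b_lt_half_bigQ hb0 hb1
  have hQ : bigQ b = b + b⁻¹ := rfl
  rw [contourPrefactor_shift_second hb0 hb1]
  have hne := twoSin_ne_zero hb0 hb1 (z := bigQ b / 2 - I * y + I * l₂) (by simp; linarith)
    (by simp; linarith)
  unfold contourPrefactor
  have e : (bigQ b / 2 - I * (y + b * I) + I * l₂ : ℂ) = bigQ b / 2 - I * y + I * l₂ + b := by
    linear_combination -(b : ℂ) * I_sq
  rw [e, dilogS_add hb0 hb1 (z := bigQ b / 2 - I * y + I * l₂) (by simp; linarith)
    (by simp; linarith)]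
  generalize twoSin b (bigQ b / 2 - I * y + I * l₂) = t at *
  simp only [div_eq_mul_inv, mul_inv]
  field_simp

/-- The lower bound on Im r keeps Q/2 + iα - iz + ir in the strip after the shift by b. -/
theorem contourIntegrand_shift_first (hb0 : 0 < b) (hb1 : b < 1) (l₁ l₂ α x y z : ℝ) {r : ℂ}
    (hr : r.im < 0) (hr' : b - bigQ b / 2 < r.im) :
    contourIntegrand b l₁ l₂ (x + b * I) y (z + b * I) α r =
      expB b (-(r + α - l₁ - y)) / twoSin b (bigQ b / 2 + I * α - I * z + I * r) *
        contourIntegrand b l₁ l₂ x y z α r := by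
  have hQ : bigQ b = b + b⁻¹ := rfl
  unfold contourIntegrand
  have e : (bigQ b / 2 + I * α - I * (z + b * I) + I * r : ℂ) =
      bigQ b / 2 + I * α - I * z + I * r + b := by
    linear_combination -(b : ℂ) * I_sq
  have e2 : exp (Real.pi * (bigQ b / 2 + I * (x + b * I) + I * l₁) * (r + α - l₁ - y)) =
      expB b (-(r + α - l₁ - y)) *
        exp (Real.pi * (bigQ b / 2 + I * x + I * l₁) * (r + α - l₁ - y)) := by
    unfold expB
    rw [← Complex.exp_add]
    congr 1
    linear_combination (Real.pi * b * (r + α - l₁ - y)) * I_sq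
  rw [e, e2, dilogS_add hb0 hb1 (z := bigQ b / 2 + I * α - I * z + I * r) (by simp; linarith)
    (by simp; linarith)]
  simp only [div_eq_mul_inv, mul_inv]
  ring

theorem contourIntegrand_shift_second (hb0 : 0 < b) (hb1 : b < 1) (l₁ l₂ α x y z : ℝ) {r : ℂ}
    (hr : r.im < 0) (hr' : b - bigQ b / 2 < r.im) :
    contourIntegrand b l₁ l₂ x (y + b * I) (z + b * I) α r =
      expB b (-(I * (bigQ b / 2 + I * x + I * l₁))) * twoSin b (I * (r + α - l₁ - y)) /
        twoSin b (bigQ b / 2 + I * α - I * z + I * r) * contourIntegrand b l₁ l₂ x y z α r := by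
  have hQ : bigQ b = b + b⁻¹ := rfl
  unfold contourIntegrand
  have e : (bigQ b / 2 + I * α - I * (z + b * I) + I * r : ℂ) =
      bigQ b / 2 + I * α - I * z + I * r + b := by
    linear_combination -(b : ℂ) * I_sq
  have e1 : (I * α - I * (y + b * I) - I * l₁ + I * r : ℂ) = I * (r + α - l₁ - y) + b := by
    linear_combination -(b : ℂ) * I_sq
  have e3 : (I * α - I * y - I * l₁ + I * r : ℂ) = I * (r + α - l₁ - y) := by ring
  have e2 : exp (Real.pi * (bigQ b / 2 + I * x + I * l₁) * (r + α - l₁ - (y + b * I))) =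
      expB b (-(I * (bigQ b / 2 + I * x + I * l₁))) *
        exp (Real.pi * (bigQ b / 2 + I * x + I * l₁) * (r + α - l₁ - y)) := by
    unfold expB
    rw [← Complex.exp_add]
    congr 1
    ring
  rw [e, e1, e2, e3,
    dilogS_add hb0 hb1 (z := bigQ b / 2 + I * α - I * z + I * r) (by simp; linarith)
    (by simp; linarith), dilogS_add hb0 hb1 (z := I * (r + α - l₁ - y)) (by simp; linarith)
    (by simp; linarith)]
  simp only [div_eq_mul_inv, mul_inv]
  ring

/-- The trigonometric identity behind the intertwining property for `E`. -/
theorem twoSin_identity_raising (b : ℝ) (A ρ : ℂ) :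
    twoSin b A * expB b (-ρ) + expB b (-(I * A)) * twoSin b (I * ρ) = twoSin b (A + I * ρ) := by
  have e1 : A = I * -(I * A) := by linear_combination A * I_sq
  have e2 : A + I * ρ = I * (ρ + -(I * A)) := by linear_combination A * I_sq
  have h1 : twoSin b A = I * (expB b (-(I * A)) - (expB b (-(I * A)))⁻¹) := by
    conv_lhs => rw [e1]
    exact twoSin_I_mul _ _
  rw [h1, e2, twoSin_I_mul, twoSin_I_mul, expB_add, expB_neg b ρ]
  have := expB_ne_zero b ρ
  have := expB_ne_zero b (-(I * A))
  field_simp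
  ring

/-- Every shifted kernel is a multiple of the unshifted one with the common denominator 2 sin πb(Q/2
+ iα - iz + ir). What remains is `twoSin_identity_raising` with A = Q/2 + i(λ₁ - x) and ρ = r + α -
λ₁ - y, for which A + iρ is exactly that argument. -/
theorem kernel_identity_raising (hb0 : 0 < b) (hb1 : b < 1) (l₁ l₂ α x y : ℝ) {r : ℂ}
    (hr : r.im < 0) (hr' : b - bigQ b / 2 < r.im) :
    twoSin b (bigQ b / 2 + I * (l₁ - x)) * (contourPrefactor b l₁ l₂ y (x + y + b * I) α *
        contourIntegrand b l₁ l₂ (x + b * I) y (x + y + b * I) α r) +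
      exp (-2 * Real.pi * b * x) * (twoSin b (bigQ b / 2 + I * (l₂ - y)) *
        (contourPrefactor b l₁ l₂ (y + b * I) (x + y + b * I) α *
        contourIntegrand b l₁ l₂ x (y + b * I) (x + y + b * I) α r)) =
      twoSin b (bigQ b / 2 + I * (α - (x + y))) * (contourPrefactor b l₁ l₂ y (x + y) α *
        contourIntegrand b l₁ l₂ x y (x + y) α r) := by
  have hQ : bigQ b = b + b⁻¹ := rfl
  have hb2 := b_lt_half_bigQ hb0 hb1
  have hz : (x + y : ℂ) = ((x + y : ℝ) : ℂ) := by push_cast; ring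
  have a1 : (bigQ b / 2 + I * (l₂ - y) : ℂ) = bigQ b / 2 - I * y + I * l₂ := by ring
  have a2 : (bigQ b / 2 + I * (α - ((x + y : ℝ) : ℂ)) : ℂ) =
      bigQ b / 2 + I * α - I * (x + y : ℝ) := by ring
  have p1 := contourPrefactor_shift_second hb0 hb1 l₁ l₂ α (x + y) y
  have p2 := contourPrefactor_shift_both hb0 hb1 l₁ l₂ α y (x + y)
  have p3 := contourIntegrand_shift_first hb0 hb1 l₁ l₂ α x y (x + y) hr hr'
  have p4 := contourIntegrand_shift_second hb0 hb1 l₁ l₂ α x y (x + y) hr hr'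
  have hne := twoSin_ne_zero hb0 hb1 (z := bigQ b / 2 + I * α - I * (x + y : ℝ) + I * r)
    (by simp; linarith) (by simp; linarith)
  have key := twoSin_identity_raising b (bigQ b / 2 + I * (l₁ - x)) (r + α - l₁ - y)
  have k1 : (bigQ b / 2 + I * (l₁ - x) + I * (r + α - l₁ - y) : ℂ) =
      bigQ b / 2 + I * α - I * (x + y : ℝ) + I * r := by push_cast; ring
  have k2 : exp (-2 * Real.pi * b * x) * expB b (-(I * (bigQ b / 2 + I * x + I * l₁))) =
      expB b (-(I * (bigQ b / 2 + I * (l₁ - x)))) := by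
    unfold expB
    rw [← Complex.exp_add]
    congr 1
    linear_combination (-2 * Real.pi * b * x) * I_sq
  rw [k1] at key
  rw [hz, p1, p3, p4, a1, a2]
  generalize twoSin b (bigQ b / 2 + I * α - I * (x + y : ℝ) + I * r) = D at *
  generalize twoSin b (bigQ b / 2 + I * α - I * (x + y : ℝ)) = t at *
  generalize contourIntegrand b l₁ l₂ x y (x + y : ℝ) α r = J at *
  calc _ = J / D * (twoSin b (bigQ b / 2 + I * (l₁ - x)) * expB b (-(r + α - l₁ - y)) *
        (t * contourPrefactor b l₁ l₂ y (x + y : ℝ) α) +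
        exp (-2 * Real.pi * b * x) * expB b (-(I * (bigQ b / 2 + I * x + I * l₁))) *
        twoSin b (I * (r + α - l₁ - y)) * (twoSin b (bigQ b / 2 - I * y + I * l₂) *
          contourPrefactor b l₁ l₂ (y + b * I) ((x + y : ℝ) + b * I) α)) := by
        field_simp
    _ = J / D * (t * contourPrefactor b l₁ l₂ y (x + y : ℝ) α) * D := by
        rw [p2, k2, ← key]
        ring
    _ = _ := by field_simp

theorem contourPrefactor_unshift_second (hb0 : 0 < b) (hb1 : b < 1) (l₁ l₂ α z : ℝ) (y : ℂ) :
    contourPrefactor b l₁ l₂ y (z - b * I) α =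
      contourPrefactor b l₁ l₂ y z α / twoSin b (bigQ b / 2 - (I * α - I * z)) := by
  have hb2 := b_lt_half_bigQ hb0 hb1
  have hQ : bigQ b = b + b⁻¹ := rfl
  unfold contourPrefactor
  have e : (bigQ b / 2 + I * α - I * (z - b * I) : ℂ) = bigQ b / 2 + I * α - I * z - b := by
    linear_combination (b : ℂ) * I_sq
  rw [e, dilogS_sub hb0 hb1 (by simp; linarith) (by simp; linarith), ← twoSin_half_sub hb0]
  have e1 : (bigQ b / 2 + I * α - I * z - b : ℂ) = bigQ b / 2 + (I * α - I * z) - b := by ring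
  rw [e1]
  simp only [div_eq_mul_inv, mul_inv]
  ring

theorem contourPrefactor_unshift_both (hb0 : 0 < b) (hb1 : b < 1) (l₁ l₂ α y z : ℝ) :
    contourPrefactor b l₁ l₂ (y - b * I) (z - b * I) α =
      twoSin b (bigQ b / 2 - (I * l₂ - I * y)) * contourPrefactor b l₁ l₂ y z α /
        twoSin b (bigQ b / 2 - (I * α - I * z)) := by
  have hb2 := b_lt_half_bigQ hb0 hb1
  have hQ : bigQ b = b + b⁻¹ := rfl
  rw [contourPrefactor_unshift_second hb0 hb1]
  unfold contourPrefactor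
  have e : (bigQ b / 2 - I * (y - b * I) + I * l₂ : ℂ) = bigQ b / 2 - I * y + I * l₂ - b := by
    linear_combination (b : ℂ) * I_sq
  rw [e, dilogS_sub hb0 hb1 (z := bigQ b / 2 - I * y + I * l₂) (by simp; linarith)
    (by simp; linarith), ← twoSin_half_sub hb0 (I * l₂ - I * y)]
  have e1 : (bigQ b / 2 - I * y + I * l₂ - b : ℂ) = bigQ b / 2 + (I * l₂ - I * y) - b := by ring
  rw [e1]
  simp only [div_eq_mul_inv, mul_inv, inv_inv]
  ring

theorem contourIntegrand_unshift_first (hb0 : 0 < b) (hb1 : b < 1) (l₁ l₂ α x y z : ℝ) {r : ℂ}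
    (hr : r.im < 0) (hr' : -(bigQ b / 2) < r.im) :
    contourIntegrand b l₁ l₂ (x - b * I) y (z - b * I) α r =
      expB b (r + α - l₁ - y) * twoSin b (bigQ b / 2 - (I * α - I * z + I * r)) *
        contourIntegrand b l₁ l₂ x y z α r := by
  have hb2 := b_lt_half_bigQ hb0 hb1
  unfold contourIntegrand
  have e : (bigQ b / 2 + I * α - I * (z - b * I) + I * r : ℂ) =
      bigQ b / 2 + I * α - I * z + I * r - b := by
    linear_combination (b : ℂ) * I_sq
  have e2 : exp (Real.pi * (bigQ b / 2 + I * (x - b * I) + I * l₁) * (r + α - l₁ - y)) =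
      expB b (r + α - l₁ - y) *
        exp (Real.pi * (bigQ b / 2 + I * x + I * l₁) * (r + α - l₁ - y)) := by
    unfold expB
    rw [← Complex.exp_add]
    congr 1
    linear_combination -(Real.pi * b * (r + α - l₁ - y)) * I_sq
  rw [e, e2, dilogS_sub hb0 hb1 (z := bigQ b / 2 + I * α - I * z + I * r) (by simp; linarith)
    (by simp; linarith), ← twoSin_half_sub hb0]
  have e1 : (bigQ b / 2 + I * α - I * z + I * r - b : ℂ) =
    bigQ b / 2 + (I * α - I * z + I * r) - b := by ring
  rw [e1]
  simp only [div_eq_mul_inv, mul_inv, inv_inv]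
  ring

/-- The shift lowers the real part of iα - iy - iλ₁ + ir by b. Hence the line must lie below Im r =
-b. -/
theorem contourIntegrand_unshift_second (hb0 : 0 < b) (hb1 : b < 1) (l₁ l₂ α x y z : ℝ) {r : ℂ}
    (hr : r.im < -b) (hr' : -(bigQ b / 2) < r.im) :
    contourIntegrand b l₁ l₂ x (y - b * I) (z - b * I) α r =
      expB b (I * (bigQ b / 2 + I * x + I * l₁)) *
        twoSin b (bigQ b / 2 - (I * α - I * z + I * r)) / twoSin b (I * (r + α - l₁ - y) - b) *
        contourIntegrand b l₁ l₂ x y z α r := by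
  have hb2 := b_lt_half_bigQ hb0 hb1
  unfold contourIntegrand
  have e : (bigQ b / 2 + I * α - I * (z - b * I) + I * r : ℂ) =
      bigQ b / 2 + I * α - I * z + I * r - b := by
    linear_combination (b : ℂ) * I_sq
  have e2 : exp (Real.pi * (bigQ b / 2 + I * x + I * l₁) * (r + α - l₁ - (y - b * I))) =
      expB b (I * (bigQ b / 2 + I * x + I * l₁)) *
        exp (Real.pi * (bigQ b / 2 + I * x + I * l₁) * (r + α - l₁ - y)) := by
    unfold expB
    rw [← Complex.exp_add]
    congr 1
    ring
  have e4 : (I * α - I * (y - b * I) - I * l₁ + I * r : ℂ) = I * (r + α - l₁ - y) - b := by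
    linear_combination (b : ℂ) * I_sq
  have e3 : (I * α - I * y - I * l₁ + I * r : ℂ) = I * (r + α - l₁ - y) := by ring
  rw [e, e2, e3, e4, dilogS_sub hb0 hb1 (z := bigQ b / 2 + I * α - I * z + I * r)
    (by simp; linarith) (by simp; linarith), ← twoSin_half_sub hb0,
    dilogS_sub hb0 hb1 (z := I * (r + α - l₁ - y)) (by simp; linarith) (by simp; linarith)]
  have e1 : (bigQ b / 2 + I * α - I * z + I * r - b : ℂ) =
    bigQ b / 2 + (I * α - I * z + I * r) - b := by ring
  rw [e1]
  simp only [div_eq_mul_inv, mul_inv, inv_inv]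
  ring

/-- All dilogarithm arguments containing r drop by b; this gives three sines above and three below.
-/
theorem contourIntegrand_shift_contour (hb0 : 0 < b) (hb1 : b < 1) (l₁ l₂ α x y z : ℝ) {r : ℂ}
    (hr : r.im < -b) (hr' : -(bigQ b / 2) < r.im) :
    contourIntegrand b l₁ l₂ x y z α (r + b * I) =
      expB b (I * (bigQ b / 2 + I * x + I * l₁)) *
        (twoSin b (bigQ b / 2 - (I * α - I * z + I * r)) *
          twoSin b (bigQ b / 2 - (I * α - I * l₁ - I * l₂ + I * r)) *
          twoSin b (bigQ b / 2 - (I * α - I * l₁ + I * l₂ + I * r))) /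
        (twoSin b (I * (r + α - l₁ - y) - b) * twoSin b (I * r - b) *
          twoSin b (2 * I * α + I * r - b)) *
        contourIntegrand b l₁ l₂ x y z α r := by
  have hb2 := b_lt_half_bigQ hb0 hb1
  unfold contourIntegrand
  have e2 : exp (Real.pi * (bigQ b / 2 + I * x + I * l₁) * (r + b * I + α - l₁ - y)) =
      expB b (I * (bigQ b / 2 + I * x + I * l₁)) *
        exp (Real.pi * (bigQ b / 2 + I * x + I * l₁) * (r + α - l₁ - y)) := by
    unfold expB
    rw [← Complex.exp_add]
    congr 1
    ring
  have eI : I * (r + b * I) = I * r - b := by linear_combination (b : ℂ) * I_sq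
  have e3 : (I * α - I * y - I * l₁ + I * r : ℂ) = I * (r + α - l₁ - y) := by ring
  have f1 : (I * α - I * y - I * l₁ + (I * r - b) : ℂ) = I * (r + α - l₁ - y) - b := by ring
  have f2 : (2 * I * α + (I * r - b) : ℂ) = 2 * I * α + I * r - b := by ring
  have f3 : (bigQ b / 2 + I * α - I * z + (I * r - b) : ℂ) =
    bigQ b / 2 + I * α - I * z + I * r - b := by ring
  have f4 : (bigQ b / 2 + I * α - I * l₁ - I * l₂ + (I * r - b) : ℂ) =
    bigQ b / 2 + I * α - I * l₁ - I * l₂ + I * r - b := by ring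
  have f5 : (bigQ b / 2 + I * α - I * l₁ + I * l₂ + (I * r - b) : ℂ) =
    bigQ b / 2 + I * α - I * l₁ + I * l₂ + I * r - b := by ring
  rw [e2, eI, f1, f2, f3, f4, f5, e3,
    dilogS_sub hb0 hb1 (z := I * (r + α - l₁ - y)) (by simp; linarith) (by simp; linarith),
    dilogS_sub hb0 hb1 (z := I * r) (by simp; linarith) (by simp; linarith),
    dilogS_sub hb0 hb1 (z := 2 * I * α + I * r) (by simp; linarith) (by simp; linarith),
    dilogS_sub hb0 hb1 (z := bigQ b / 2 + I * α - I * z + I * r) (by simp; linarith)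
      (by simp; linarith),
    dilogS_sub hb0 hb1 (z := bigQ b / 2 + I * α - I * l₁ - I * l₂ + I * r) (by simp; linarith)
      (by simp; linarith),
    dilogS_sub hb0 hb1 (z := bigQ b / 2 + I * α - I * l₁ + I * l₂ + I * r) (by simp; linarith)
      (by simp; linarith),
    ← twoSin_half_sub hb0, ← twoSin_half_sub hb0, ← twoSin_half_sub hb0]
  have g3 : (bigQ b / 2 + I * α - I * z + I * r - b : ℂ) =
    bigQ b / 2 + (I * α - I * z + I * r) - b := by ring
  have g4 : (bigQ b / 2 + I * α - I * l₁ - I * l₂ + I * r - b : ℂ) =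
    bigQ b / 2 + (I * α - I * l₁ - I * l₂ + I * r) - b := by ring
  have g5 : (bigQ b / 2 + I * α - I * l₁ + I * l₂ + I * r - b : ℂ) =
    bigQ b / 2 + (I * α - I * l₁ + I * l₂ + I * r) - b := by ring
  rw [g3, g4, g5]
  simp only [div_eq_mul_inv, mul_inv, inv_inv]
  ring

theorem twoSin_half_add (b : ℝ) (v : ℂ) : twoSin b (bigQ b / 2 + I * v) =
    I * (expB b (-(I * (bigQ b / 2))) * expB b v - (expB b (-(I * (bigQ b / 2))) * expB b v)⁻¹) := by
  rw [← expB_add, ← twoSin_I_mul]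
  congr 1
  linear_combination (bigQ b / 2 : ℂ) * I_sq

theorem twoSin_sub_b (hb0 : 0 < b) (v : ℂ) : twoSin b (I * v - b) =
    I * (-((expB b (-(I * (bigQ b / 2)))) ^ 2)⁻¹ * expB b v -
      (-((expB b (-(I * (bigQ b / 2)))) ^ 2)⁻¹ * expB b v)⁻¹) := by
  have h : -((expB b (-(I * (bigQ b / 2)))) ^ 2)⁻¹ = expB b (I * b) := by
    have h1 := expB_b hb0
    rw [expB_neg] at h1
    rw [← inv_neg, ← h1, inv_inv]
  rw [h, ← expB_add, ← twoSin_I_mul]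
  congr 1
  linear_combination -(b : ℂ) * I_sq

/-- The trigonometric identity behind the intertwining property for `F`. -/
theorem twoSin_identity_lowering (hb0 : 0 < b) (l₁ l₂ α x y r : ℂ)
    (hne : twoSin b (I * (r + α - l₁ - y) - b) ≠ 0) :
    twoSin b (bigQ b / 2 + I * (-α + (x + y) - r)) *
      (twoSin b (bigQ b / 2 + I * (l₂ + y)) * twoSin b (bigQ b / 2 + I * (-l₂ + y)) *
        expB b (I * (bigQ b / 2 + I * x + I * l₁)) / twoSin b (I * (r + α - l₁ - y) - b) +
      expB b (2 * y) * twoSin b (bigQ b / 2 + I * (l₁ + x)) * expB b (r + α - l₁ - y)) -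
      twoSin b (bigQ b / 2 + I * (α + (x + y))) * twoSin b (bigQ b / 2 + I * (-α + (x + y))) =
    expB b (I * (bigQ b / 2 + I * x + I * l₁)) *
      (twoSin b (bigQ b / 2 + I * (-α + (x + y) - r)) *
        twoSin b (bigQ b / 2 + I * (-α + l₁ + l₂ - r)) *
        twoSin b (bigQ b / 2 + I * (-α + l₁ - l₂ - r))) / twoSin b (I * (r + α - l₁ - y) - b) -
      twoSin b (I * r) * twoSin b (I * (2 * α + r)) := by
  have hX : expB b (I * (bigQ b / 2 + I * x + I * l₁)) =
      (expB b (-(I * (bigQ b / 2))))⁻¹ / (expB b x * expB b l₁) := by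
    rw [← expB_neg, ← expB_add, ← expB_sub]
    congr 1
    linear_combination (x + l₁) * I_sq
  have h2y : expB b (2 * y) = expB b y * expB b y := by rw [← expB_add]; ring_nf
  have h2α : expB b (2 * α) = expB b α * expB b α := by rw [← expB_add]; ring_nf
  refine mul_right_cancel₀ hne ?_
  rw [sub_mul, sub_mul, mul_assoc (twoSin b (bigQ b / 2 + I * (-α + (x + y) - r))), add_mul,
    div_mul_cancel₀ _ hne, div_mul_cancel₀ _ hne, twoSin_sub_b hb0, hX, h2y]
  simp only [twoSin_half_add, twoSin_I_mul]
  have n7 := expB_ne_zero b (-(I * (bigQ b / 2)))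
  -- From here on the seven exponentials are independent nonzero unknowns, and the claim is an
  -- identity of rational functions.
  generalize expB b (-(I * (bigQ b / 2))) = k at *
  simp only [expB_add, expB_sub, expB_neg, h2α]
  have n1 := expB_ne_zero b x
  have n2 := expB_ne_zero b y
  have n3 := expB_ne_zero b α
  have n4 := expB_ne_zero b l₁
  have n5 := expB_ne_zero b l₂
  have n6 := expB_ne_zero b r
  generalize expB b x = x at *
  generalize expB b y = y at *
  generalize expB b α = α at *
  generalize expB b l₁ = l₁ at *
  generalize expB b l₂ = l₂ at *
  generalize expB b r = r at *
  field_simp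
  ring

end RaisingIdentity

/-! ### The telescoping relation for F, slices of test functions and transforms, and the relation
for K. -/

section LoweringIdentity

variable {b l₁ l₂ s ε : ℝ} {f : ℝ → ℝ → ℂ} {Ψ : ℝ → ℂ → ℂ}

/-- The integrand of the kernel for `F` is, up to a factor, the difference of the values of this
function at `r + ib` and `r`. -/
noncomputable def loweringPrimitive (b l₁ l₂ x y α : ℝ) (r : ℂ) : ℂ :=
  twoSin b (I * r) * twoSin b (I * (2 * α + r)) * contourIntegrand b l₁ l₂ x y (x + y) α r

/-- In the variable ρ = r/(ib) the shift r ↦ r + ib is ρ ↦ ρ + 1, so the defect has the form of a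
telescoping summand. The two sines in `loweringPrimitive`, taken at r + ib, cancel those that the
shift of S_b(ir) and S_b(2iα + ir) leaves in the denominator. -/
theorem kernel_identity_lowering (hb0 : 0 < b) (hb1 : b < 1) (l₁ l₂ α x y : ℝ) {r : ℂ}
    (hr : r.im < -b) (hr' : -(bigQ b / 2) < r.im) :
    twoSin b (bigQ b / 2 + I * (l₂ + y)) * (contourPrefactor b l₁ l₂ (y - b * I) (x + y - b * I) α *
        contourIntegrand b l₁ l₂ x (y - b * I) (x + y - b * I) α r) +
      expB b (2 * y) * (twoSin b (bigQ b / 2 + I * (l₁ + x)) *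
        (contourPrefactor b l₁ l₂ y (x + y - b * I) α *
        contourIntegrand b l₁ l₂ (x - b * I) y (x + y - b * I) α r)) -
      twoSin b (bigQ b / 2 + I * (α + (x + y))) * (contourPrefactor b l₁ l₂ y (x + y) α *
        contourIntegrand b l₁ l₂ x y (x + y) α r) =
    contourPrefactor b l₁ l₂ y (x + y) α / twoSin b (bigQ b / 2 + I * (-α + (x + y))) *
      (loweringPrimitive b l₁ l₂ x y α (r + b * I) - loweringPrimitive b l₁ l₂ x y α r) := by
  have hQ : bigQ b = b + b⁻¹ := rfl
  have hb2 := b_lt_half_bigQ hb0 hb1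
  have hz : ((x + y : ℝ) : ℂ) = (x + y : ℂ) := by push_cast; ring
  have p1 := contourPrefactor_unshift_second hb0 hb1 l₁ l₂ α (x + y) y
  have p2 := contourPrefactor_unshift_both hb0 hb1 l₁ l₂ α y (x + y)
  have p3 := contourIntegrand_unshift_first hb0 hb1 l₁ l₂ α x y (x + y) (by linarith) hr'
  have p4 := contourIntegrand_unshift_second hb0 hb1 l₁ l₂ α x y (x + y) hr hr'
  have p5 := contourIntegrand_shift_contour hb0 hb1 l₁ l₂ α x y (x + y) hr hr'
  rw [hz] at p1 p2 p3 p4 p5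
  have n1 := twoSin_ne_zero hb0 hb1 (z := I * (r + α - l₁ - y) - b) (by simp; linarith)
    (by simp; linarith)
  have n2 := twoSin_ne_zero hb0 hb1 (z := I * r - b) (by simp; linarith) (by simp; linarith)
  have n3 := twoSin_ne_zero hb0 hb1 (z := 2 * I * α + I * r - b) (by simp; linarith)
    (by simp; linarith)
  have n4 := twoSin_ne_zero hb0 hb1 (z := bigQ b / 2 + I * (-α + (x + y))) (by simp; linarith)
    (by simp; linarith)
  have key := twoSin_identity_lowering hb0 l₁ l₂ α x y r n1
  have a1 : (bigQ b / 2 - (I * α - I * (x + y)) : ℂ) = bigQ b / 2 + I * (-α + (x + y)) := by ring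
  have a2 : (bigQ b / 2 - (I * l₂ - I * y) : ℂ) = bigQ b / 2 + I * (-l₂ + y) := by ring
  have a3 : (bigQ b / 2 - (I * α - I * (x + y) + I * r) : ℂ) =
    bigQ b / 2 + I * (-α + (x + y) - r) := by ring
  have a4 : (bigQ b / 2 - (I * α - I * l₁ - I * l₂ + I * r) : ℂ) =
    bigQ b / 2 + I * (-α + l₁ + l₂ - r) := by ring
  have a5 : (bigQ b / 2 - (I * α - I * l₁ + I * l₂ + I * r) : ℂ) =
    bigQ b / 2 + I * (-α + l₁ - l₂ - r) := by ring
  have a6 : I * (r + b * I) = I * r - b := by linear_combination (b : ℂ) * I_sq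
  have a7 : I * (2 * α + (r + b * I)) = 2 * I * α + I * r - b := by
    linear_combination (b : ℂ) * I_sq
  unfold loweringPrimitive
  rw [p1, p2, p3, p4, p5, a1, a2, a3, a4, a5, a6, a7]
  generalize twoSin b (I * r - b) = t₁ at *
  generalize twoSin b (2 * I * α + I * r - b) = t₂ at *
  generalize twoSin b (I * (r + α - l₁ - y) - b) = t₃ at *
  generalize twoSin b (bigQ b / 2 + I * (-α + (x + y))) = t₄ at *
  generalize contourPrefactor b l₁ l₂ y (x + y) α = P at *
  generalize contourIntegrand b l₁ l₂ x y (x + y) α r = J at *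
  calc _ = P * J / t₄ * (twoSin b (bigQ b / 2 + I * (-α + (x + y) - r)) *
      (twoSin b (bigQ b / 2 + I * (l₂ + y)) * twoSin b (bigQ b / 2 + I * (-l₂ + y)) *
        expB b (I * (bigQ b / 2 + I * x + I * l₁)) / t₃ +
      expB b (2 * y) * twoSin b (bigQ b / 2 + I * (l₁ + x)) * expB b (r + α - l₁ - y)) -
      twoSin b (bigQ b / 2 + I * (α + (x + y))) * t₄) := by
        field_simp
    _ = _ := by
        rw [key]
        field_simp

/-- For real x and y the contour integrand decays at rate πQ, while the two sines grow at rate πb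
each. Since b < Q/2, decay remains. -/
theorem exists_norm_loweringPrimitive_le (hb0 : 0 < b) (hb1 : b < 1) (l₁ l₂ x y α : ℝ)
    (hs : b < s) (hs' : s < bigQ b / 2) :
    ∃ K, ∀ u t : ℝ, t ∈ Set.Icc (-s) (-s + b) →
      ‖loweringPrimitive b l₁ l₂ x y α (u + t * I)‖ ≤
        K * Real.exp (-(Real.pi * (bigQ b - 2 * b)) * |u|) := by
  obtain ⟨ε, hε, hε1, hε2⟩ : ∃ ε, 0 < ε ∧ ε ≤ s - b ∧ ε ≤ bigQ b / 2 - s :=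
    ⟨min (s - b) (bigQ b / 2 - s), lt_min (by linarith) (by linarith), min_le_left _ _,
      min_le_right _ _⟩
  have hπ := Real.pi_pos
  obtain ⟨C, hC, hbd⟩ := exists_norm_contourIntegrand_le hb0 hb1 hε
  set V := |α| + |x| + |y| + |l₁| + |l₂| with hV
  have p1 := abs_nonneg α
  have p2 := abs_nonneg x
  have p3 := abs_nonneg y
  have p5 := abs_nonneg l₁
  have p6 := abs_nonneg l₂
  refine ⟨4 * Real.exp (Real.pi * b * (2 * |α|)) * (C * Real.exp (40 * Real.pi * bigQ b * V)),
    fun u t ht => ?_⟩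
  have hadm : Admissible b ε (x : ℂ).im (y : ℂ).im (x + y : ℂ).im (-t) := by
    simpa using admissible_real hε (s := -t) (by linarith [ht.2]) (by linarith [ht.1])
  -- The full rate δ = Q is needed here; the margin ε would not outweigh the sines.
  have n0 := hbd l₁ l₂ x y (x + y) α u (-t) V (bigQ b) hadm (by
    have : |bigQ b / 2| = bigQ b / 2 := abs_of_pos (by linarith)
    simp [this]; linarith) (by linarith) (by simp; linarith) (by simp; linarith)
    (by
      rw [← ofReal_add, ofReal_re]
      exact (abs_add_le _ _).trans (by linarith)) (by linarith) (by linarith)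
  have h2 : (u : ℂ) - ((-t : ℝ) : ℂ) * I = u + t * I := by push_cast; ring
  rw [h2] at n0
  have n1 : ‖twoSin b (I * (u + t * I))‖ ≤ 2 * Real.exp (Real.pi * b * |u|) := by
    refine (norm_twoSin_le _ _).trans (le_of_eq ?_)
    have : (I * (u + t * I) : ℂ).im = u := by simp
    rw [this, abs_mul, abs_of_pos (by positivity)]
  have n2 : ‖twoSin b (I * (2 * α + (u + t * I)))‖ ≤
      2 * Real.exp (Real.pi * b * (2 * |α| + |u|)) := by
    refine (norm_twoSin_le _ _).trans ?_
    have : (I * (2 * α + (u + t * I)) : ℂ).im = 2 * α + u := by simp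
    rw [this, abs_mul, abs_of_pos (by positivity : 0 < Real.pi * b)]
    gcongr
    exact (abs_add_le _ _).trans (by rw [abs_mul, abs_two])
  unfold loweringPrimitive
  rw [norm_mul, norm_mul]
  calc _ ≤ 2 * Real.exp (Real.pi * b * |u|) * (2 * Real.exp (Real.pi * b * (2 * |α| + |u|))) *
        (C * Real.exp (40 * Real.pi * bigQ b * V) * Real.exp (-(Real.pi * bigQ b) * |u|)) := by
        gcongr
    _ = 4 * (C * Real.exp (40 * Real.pi * bigQ b * V)) * (Real.exp (Real.pi * b * |u|) *
        Real.exp (Real.pi * b * (2 * |α| + |u|)) * Real.exp (-(Real.pi * bigQ b) * |u|)) := by ring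
    _ = 4 * (C * Real.exp (40 * Real.pi * bigQ b * V)) * (Real.exp (Real.pi * b * (2 * |α|)) *
        Real.exp (-(Real.pi * (bigQ b - 2 * b)) * |u|)) := by
        simp only [← Real.exp_add]
        ring_nf
    _ = _ := by ring

theorem differentiableAt_loweringPrimitive (hb0 : 0 < b) (hb1 : b < 1) (l₁ l₂ x y α : ℝ) {r : ℂ}
    (hr : r.im < 0) (hr' : -(bigQ b / 2) < r.im) :
    DifferentiableAt ℂ (loweringPrimitive b l₁ l₂ x y α) r := by
  obtain ⟨ε, hε, -, h1, h2⟩ := exists_admissible_margin (b := b) (s := -r.im) (by linarith)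
    (by linarith)
  have hd : DifferentiableAt ℂ (fun r => contourIntegrand b l₁ l₂ x y (x + y) α r) r :=
    differentiableAt_contourIntegrand (ε := ε) hb0 hb1 l₁ l₂ α (by fun_prop) (by fun_prop)
      (by fun_prop) (by fun_prop) (by simpa using admissible_real hε h1 h2)
  unfold loweringPrimitive twoSin
  fun_prop

/-- The points r and r + ib run over Im = -s and Im = -s + b. Both lines lie in -Q/2 < Im r < 0,
where the function is holomorphic, so the integrals agree. -/
theorem integral_loweringPrimitive_sub (hb0 : 0 < b) (hb1 : b < 1) (l₁ l₂ x y α : ℝ)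
    (hs : b < s) (hs' : s < bigQ b / 2) :
    ∫ u : ℝ, (loweringPrimitive b l₁ l₂ x y α (u - s * I + b * I) -
      loweringPrimitive b l₁ l₂ x y α (u - s * I)) = 0 := by
  obtain ⟨K, hK⟩ := exists_norm_loweringPrimitive_le hb0 hb1 l₁ l₂ x y α hs hs'
  have hb2 := b_lt_half_bigQ hb0 hb1
  have hpos : 0 < Real.pi * (bigQ b - 2 * b) := mul_pos Real.pi_pos (by linarith)
  have hd : ∀ r : ℂ, r.im ∈ Set.Icc (-s) (-s + b) →
      DifferentiableAt ℂ (loweringPrimitive b l₁ l₂ x y α) r := fun r hr =>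
    differentiableAt_loweringPrimitive hb0 hb1 l₁ l₂ x y α (by linarith [hr.2])
      (by linarith [hr.1])
  have hint : ∀ t ∈ Set.Icc (-s) (-s + b),
      Integrable fun u : ℝ => loweringPrimitive b l₁ l₂ x y α (u + t * I) := by
    intro t ht
    have hc : Continuous fun u : ℝ => loweringPrimitive b l₁ l₂ x y α (u + t * I) := by
      rw [continuous_iff_continuousAt]
      intro u
      exact ContinuousAt.comp (f := fun u : ℝ => (u + t * I : ℂ))
        (hd _ (by simpa using ht)).continuousAt (by fun_prop)
    exact ((integrable_exp_neg_mul_abs hpos).const_mul K).mono' hc.aestronglyMeasurable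
      (Eventually.of_forall fun u => hK u t ht)
  have key := integral_sub_horizontal_eq_zero (a := -s) (b := -s + b) (by linarith)
    (f := loweringPrimitive b l₁ l₂ x y α)
    (fun r hr => (hd r hr).differentiableWithinAt) (tendsto_const_mul_exp_neg K hpos)
    (fun u _ t ht => hK u t ht)
    ((hint _ ⟨le_rfl, by linarith⟩).sub (hint _ ⟨by linarith, le_rfl⟩))
  have e : ∀ u : ℝ, loweringPrimitive b l₁ l₂ x y α (u - s * I + b * I) -
      loweringPrimitive b l₁ l₂ x y α (u - s * I) =
      -(loweringPrimitive b l₁ l₂ x y α (u + (-s : ℝ) * I) -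
        loweringPrimitive b l₁ l₂ x y α (u + (-s + b : ℝ) * I)) := by
    intro u
    rw [neg_sub]
    congr 2 <;> (push_cast; ring)
  simp_rw [e]
  rw [integral_neg, key, neg_zero]

/-! ### Slices of test functions -/

theorem memLp_slice (hf : f ∈ testSpace) (α : ℝ) : MemLp (f α) 2 volume := by
  obtain ⟨Ψ, hΨ⟩ := exists_entireExtension hf
  obtain ⟨C, hC, c, hc, h⟩ := hΨ.bound
  have e : f α = fun z : ℝ => Ψ α z := by funext z; rw [hΨ.coe]
  rw [e]
  have hcont := (hΨ.diff α).continuous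
  refine memLp_of_gaussian_bound (M := C) (κ := 0) (c := c) (y := 0) (by fun_prop) hc fun z => ?_
  refine (h α z (by simp)).trans ?_
  gcongr
  simp only [ofReal_re]
  nlinarith [mul_nonneg hc.le (sq_nonneg α)]

theorem shiftGraph_slice (hΨ : EntireExtension f Ψ) (α : ℝ) {a : ℝ} (ha : |a| ≤ 2) :
    ShiftGraph a (f α) (fun z => Ψ α (z + a * I)) := by
  obtain ⟨C, hC, c, hc, h⟩ := hΨ.bound
  have e : f α = fun z : ℝ => Ψ α z := by funext z; rw [hΨ.coe]
  rw [e]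
  refine shiftGraph_of_gaussian_bound (M := C) (κ := 0) (c := c) (y := 0)
    (fun w _ => (hΨ.diff α).analyticAt w) hc fun t ht z => ?_
  have ht2 : |t| ≤ 2 := by
    have := Set.abs_sub_left_of_mem_uIcc ht
    simp only [sub_zero] at this
    linarith
  refine (h α _ (by simpa using ht2)).trans ?_
  gcongr
  simp
  nlinarith [mul_nonneg hc.le (sq_nonneg α)]

/-- The q-number is a combination of the exponentials e^{±πb(α+σz)}, under which the test space is
stable. The sign σ = -1 serves E and σ = 1 serves F. -/
theorem qNum_mul_mem_testSpace (hb0 : 0 < b) (hΨ : EntireExtension f Ψ) (σ t : ℂ) :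
    (fun α z : ℝ => qNum b (bigQ b / (2 * b) + I / b * (α + σ * z)) * Ψ α (z + t)) ∈ testSpace := by
  set k := expB b (-(I * (bigQ b / 2)))
  have h1 := testSpace.smul_mem (qConst b * I * k) (hΨ.mem (Real.pi * b) (Real.pi * b * σ) t)
  have h2 := testSpace.smul_mem (qConst b * I * k⁻¹) (hΨ.mem (-(Real.pi * b)) (-(Real.pi * b * σ)) t)
  convert testSpace.sub_mem h1 h2 using 1
  funext α z
  rw [qNum_E hb0, twoSin_half_add, mul_inv, ← expB_neg b (α + σ * z)]
  have e1 : expB b (α + σ * z) = exp (Real.pi * b * α + Real.pi * b * σ * z) := by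
    unfold expB; ring_nf
  have e2 : expB b (-(α + σ * z)) = exp (-(Real.pi * b) * α + -(Real.pi * b * σ) * z) := by
    unfold expB; ring_nf
  rw [e1, e2]
  simp only [Pi.sub_apply, Pi.smul_apply, smul_eq_mul]
  ring

/-! ### Slices of the transformation -/

/-- For fixed y the transform has a Gaussian bound in x, which absorbs any weight of exponential
growth such as a q-number or e^{-2πbx}. -/
theorem memLp_transform_first (hb0 : 0 < b) (hb1 : b < 1) (hε : 0 < ε) (hΨ : EntireExtension f Ψ)
    {y : ℂ} {τ : ℝ} (h : ∀ x : ℝ, AdmissiblePair b ε s (x + τ * I) y) {e : ℝ → ℂ}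
    (he : Continuous e) {K κ' : ℝ} (hK : ∀ x, ‖e x‖ ≤ K * Real.exp (κ' * |x|)) :
    MemLp (fun x : ℝ => e x * transform b l₁ l₂ s Ψ (x + τ * I) y) 2 volume := by
  obtain ⟨M, hM, κ, hκ, c, hc, hbd⟩ := exists_norm_transform_le hb0 hb1 l₁ l₂ hε hΨ
  have hcont : Continuous fun x : ℝ => transform b l₁ l₂ s Ψ (x + τ * I) y := by
    rw [continuous_iff_continuousAt]
    intro x
    exact ContinuousAt.comp (f := fun x : ℝ => (x + τ * I : ℂ))
      (analyticAt_transform hb0 hb1 l₁ l₂ hΨ differentiable_id (differentiable_const y)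
        (w := x + τ * I) (h x)).continuousAt (by fun_prop)
  refine memLp_of_gaussian_bound (M := K * M * Real.exp (κ * |y.re|)) (κ := κ' + κ) (c := c)
    (y := y.re) (he.mul hcont) hc fun x => ?_
  rw [norm_mul]
  have h1 := hbd s _ y (h x)
  have h2 : (x + τ * I : ℂ).re = x := by simp
  rw [h2] at h1
  calc _ ≤ (K * Real.exp (κ' * |x|)) *
        (M * Real.exp (κ * (|x| + |y.re|) - c * (x + y.re) ^ 2)) := by
        gcongr
        · exact (norm_nonneg _).trans (hK x)
        · exact hK x
    _ = K * M * (Real.exp (κ' * |x|) * Real.exp (κ * (|x| + |y.re|) - c * (x + y.re) ^ 2)) := by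
        ring
    _ = K * M * (Real.exp (κ * |y.re|) * Real.exp ((κ' + κ) * |x| - c * (x + y.re) ^ 2)) := by
        simp only [← Real.exp_add]; ring_nf
    _ = _ := by ring

theorem memLp_transform_second (hb0 : 0 < b) (hb1 : b < 1) (hε : 0 < ε)
    (hΨ : EntireExtension f Ψ) {x : ℂ} {τ : ℝ}
    (h : ∀ y : ℝ, AdmissiblePair b ε s x (y + τ * I)) {e : ℝ → ℂ}
    (he : Continuous e) {K κ' : ℝ} (hK : ∀ y, ‖e y‖ ≤ K * Real.exp (κ' * |y|)) :
    MemLp (fun y : ℝ => e y * transform b l₁ l₂ s Ψ x (y + τ * I)) 2 volume := by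
  obtain ⟨M, hM, κ, hκ, c, hc, hbd⟩ := exists_norm_transform_le hb0 hb1 l₁ l₂ hε hΨ
  have hcont : Continuous fun y : ℝ => transform b l₁ l₂ s Ψ x (y + τ * I) := by
    rw [continuous_iff_continuousAt]
    intro y
    exact ContinuousAt.comp (f := fun y : ℝ => (y + τ * I : ℂ))
      (analyticAt_transform hb0 hb1 l₁ l₂ hΨ (differentiable_const x) differentiable_id
        (w := y + τ * I) (h y)).continuousAt (by fun_prop)
  refine memLp_of_gaussian_bound (M := K * M * Real.exp (κ * |x.re|)) (κ := κ' + κ) (c := c)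
    (y := x.re) (he.mul hcont) hc fun y => ?_
  rw [norm_mul]
  have h1 := hbd s x _ (h y)
  have h2 : (y + τ * I : ℂ).re = y := by simp
  rw [h2] at h1
  calc _ ≤ (K * Real.exp (κ' * |y|)) *
        (M * Real.exp (κ * (|x.re| + |y|) - c * (x.re + y) ^ 2)) := by
        gcongr
        · exact (norm_nonneg _).trans (hK y)
        · exact hK y
    _ = K * M * (Real.exp (κ' * |y|) * Real.exp (κ * (|x.re| + |y|) - c * (x.re + y) ^ 2)) := by
        ring
    _ = K * M * (Real.exp (κ * |x.re|) * Real.exp ((κ' + κ) * |y| - c * (y + x.re) ^ 2)) := by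
        simp only [← Real.exp_add]; ring_nf
    _ = _ := by ring

theorem shiftGraph_transform_first (hb0 : 0 < b) (hb1 : b < 1) (hε : 0 < ε)
    (hΨ : EntireExtension f Ψ) {y a : ℝ}
    (h : ∀ x : ℂ, x.im ∈ Set.uIcc 0 a → AdmissiblePair b ε s x y) :
    ShiftGraph a (fun x => transform b l₁ l₂ s Ψ x y)
      (fun x => transform b l₁ l₂ s Ψ (x + a * I) y) := by
  obtain ⟨M, hM, κ, hκ, c, hc, hbd⟩ := exists_norm_transform_le hb0 hb1 l₁ l₂ hε hΨ
  refine shiftGraph_of_gaussian_bound (Φ := fun x => transform b l₁ l₂ s Ψ x y)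
    (M := M * Real.exp (κ * |y|)) (κ := κ) (c := c) (y := y)
    (fun w hw => analyticAt_transform hb0 hb1 l₁ l₂ hΨ differentiable_id
      (differentiable_const (y : ℂ)) (h w hw)) hc fun t ht x => ?_
  have h1 := hbd s (x + t * I) y (h _ (by simpa using ht))
  have h2 : (x + t * I : ℂ).re = x := by simp
  rw [h2, ofReal_re] at h1
  refine h1.trans (le_of_eq ?_)
  rw [mul_assoc, ← Real.exp_add]
  ring_nf

theorem shiftGraph_transform_second (hb0 : 0 < b) (hb1 : b < 1) (hε : 0 < ε)
    (hΨ : EntireExtension f Ψ) {x a : ℝ}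
    (h : ∀ y : ℂ, y.im ∈ Set.uIcc 0 a → AdmissiblePair b ε s x y) :
    ShiftGraph a (fun y => transform b l₁ l₂ s Ψ x y)
      (fun y => transform b l₁ l₂ s Ψ x (y + a * I)) := by
  obtain ⟨M, hM, κ, hκ, c, hc, hbd⟩ := exists_norm_transform_le hb0 hb1 l₁ l₂ hε hΨ
  refine shiftGraph_of_gaussian_bound (Φ := fun y => transform b l₁ l₂ s Ψ x y)
    (M := M * Real.exp (κ * |x|)) (κ := κ) (c := c) (y := x)
    (fun w hw => analyticAt_transform hb0 hb1 l₁ l₂ hΨ (differentiable_const (x : ℂ))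
      differentiable_id (h w hw)) hc fun t ht y => ?_
  have h1 := hbd s x (y + t * I) (h _ (by simpa using ht))
  have h2 : (y + t * I : ℂ).re = y := by simp
  rw [h2, ofReal_re] at h1
  refine h1.trans (le_of_eq ?_)
  rw [mul_assoc, ← Real.exp_add]
  ring_nf

theorem norm_qNum_le_exp_abs (hb0 : 0 < b) (l σ x : ℝ) (hσ : |σ| = 1) :
    ‖qNum b (bigQ b / (2 * b) + I / b * (l + σ * x))‖ ≤
      ‖qConst b‖ * 2 * Real.exp (Real.pi * b * |l|) * Real.exp (Real.pi * b * |x|) := by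
  have h := norm_qNum_le hb0 (l + σ * x)
  push_cast at h
  refine h.trans ?_
  rw [mul_assoc (‖qConst b‖ * 2), ← Real.exp_add, ← mul_add]
  have hπ := Real.pi_pos
  have : |l + σ * x| ≤ |l| + |x| := (abs_add_le _ _).trans (by rw [abs_mul, hσ, one_mul])
  gcongr

theorem norm_exp_real_le (k x : ℝ) : ‖exp (k * x)‖ ≤ 1 * Real.exp (|k| * |x|) := by
  rw [← ofReal_mul, Complex.norm_exp, ofReal_re, one_mul, ← abs_mul]
  exact Real.exp_le_exp.2 (le_abs_self _)

/-! ### The intertwining property -/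

/-- On the support z = x + y of the kernel the multiplier factors as e^{-2πbx} e^{-2πby}. -/
theorem intertwines_K (hb0 : 0 < b) (hb1 : b < 1) (l₁ l₂ : ℝ) :
    Intertwines b l₁ l₂ (fun _ => GraphK b) (CoprodK b) := by
  intro f hf
  obtain ⟨Ψ, hΨ⟩ := exists_entireExtension hf
  have hg : (fun α z : ℝ => exp (-2 * Real.pi * b * z) * f α z) ∈ testSpace := by
    have := hΨ.mem 0 (-2 * Real.pi * b) 0
    convert this using 1
    funext α z
    rw [add_zero, hΨ.coe, zero_mul, zero_add]
  have hQ := bigQ_pos hb0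
  have hs : 0 < bigQ b / 4 := by linarith
  have hs' : bigQ b / 4 < bigQ b / 2 := by linarith
  obtain ⟨ε, hε, h1, h2, h3⟩ := exists_admissible_margin hs hs'
  have hadm := admissiblePair_real (s := bigQ b / 4) hε h1 h2 h3
  refine ⟨_, hg, fun α _ => ⟨memLp_slice hf α, memLp_slice hg α, fun _ => rfl⟩, ?_⟩
  have hF : cgTransform b l₁ l₂ f = fun x y : ℝ => transform b l₁ l₂ (bigQ b / 4) Ψ x y := by
    funext x y
    exact cgTransform_eq hb0 hb1 l₁ l₂ hs hs' hΨ x y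
  have hG : cgTransform b l₁ l₂ (fun α z : ℝ => exp (-2 * Real.pi * b * z) * f α z) =
      fun x y : ℝ => exp (-2 * Real.pi * b * x) * (exp (-2 * Real.pi * b * y) *
        transform b l₁ l₂ (bigQ b / 4) Ψ x y) := by
    funext x y
    rw [← cgTransform_eq hb0 hb1 l₁ l₂ hs hs' hΨ x y, ← mul_assoc, ← Complex.exp_add]
    unfold cgTransform
    simp_rw [integral_dirac]
    rw [← integral_const_mul]
    congr 1
    funext α
    have e : (-2 * Real.pi * b * (x + y : ℝ) : ℂ) =
      -2 * Real.pi * b * x + -2 * Real.pi * b * y := by push_cast; ring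
    rw [e]
    ring
  rw [hF, hG]
  have hk : ∀ x : ℝ, ‖exp (-2 * Real.pi * b * x)‖ ≤ 1 * Real.exp (|-2 * Real.pi * b| * |x|) := by
    intro x
    have := norm_exp_real_le (-2 * Real.pi * b) x
    push_cast at this
    exact this
  have hadm' : ∀ x y : ℝ, AdmissiblePair b ε (bigQ b / 4) (x + (0 : ℝ) * I) y := by
    intro x y; simpa using hadm x y
  have hadm'' : ∀ x y : ℝ, AdmissiblePair b ε (bigQ b / 4) x (y + (0 : ℝ) * I) := by
    intro x y; simpa using hadm x y
  refine ⟨fun x y => exp (-2 * Real.pi * b * y) * transform b l₁ l₂ (bigQ b / 4) Ψ x y,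
    fun x => ⟨?_, ?_, fun y => rfl⟩, fun y => ⟨?_, ?_, fun x => rfl⟩⟩
  · simpa using memLp_transform_second (l₁ := l₁) (l₂ := l₂) hb0 hb1 hε hΨ (hadm'' x)
      (e := fun _ => 1) continuous_const (K := 1) (κ' := 0) (by simp)
  · simpa using memLp_transform_second (l₁ := l₁) (l₂ := l₂) hb0 hb1 hε hΨ (hadm'' x)
      (e := fun y => exp (-2 * Real.pi * b * y)) (by fun_prop) hk
  · simpa using memLp_transform_first (l₁ := l₁) (l₂ := l₂) hb0 hb1 hε hΨ (fun x => hadm' x y)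
      (e := fun _ => exp (-2 * Real.pi * b * y)) continuous_const
      (K := ‖exp (-2 * Real.pi * b * y)‖) (κ' := 0) (by simp)
  · have := memLp_transform_first (l₁ := l₁) (l₂ := l₂) hb0 hb1 hε hΨ (fun x => hadm' x y)
      (e := fun x => exp (-2 * Real.pi * b * y) * exp (-2 * Real.pi * b * x)) (by fun_prop)
      (K := ‖exp (-2 * Real.pi * b * y)‖) (κ' := |-2 * Real.pi * b|) (fun x => by
        rw [norm_mul]
        gcongr
        simpa using hk x)
    have e : (fun x : ℝ => exp (-2 * Real.pi * b * x) * (exp (-2 * Real.pi * b * y) *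
        transform b l₁ l₂ (bigQ b / 4) Ψ x y)) = fun x : ℝ => exp (-2 * Real.pi * b * y) *
          exp (-2 * Real.pi * b * x) * transform b l₁ l₂ (bigQ b / 4) Ψ (x + (0 : ℝ) * I) y := by
      funext x
      rw [ofReal_zero, zero_mul, add_zero]
      ring
    rw [e]
    exact this

end LoweringIdentity

/-! ### The relations for E and F. -/

section Intertwining

variable {b l₁ l₂ s ε : ℝ} {f : ℝ → ℝ → ℂ} {Ψ : ℝ → ℂ → ℂ}

/-- The binding constraint is Q/2 + Im z + s < Q with Im z up to b. The height s is half of the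
available room Q/2 - b. -/
theorem exists_admissiblePair_raising (hb0 : 0 < b) (hb1 : b < 1) :
    ∃ ε s, 0 < ε ∧ 0 < s ∧ s < bigQ b / 2 - b ∧ ∀ x y : ℂ, 0 ≤ x.im → 0 ≤ y.im →
      x.im + y.im ≤ b → AdmissiblePair b ε s x y := by
  have hb2 := b_lt_half_bigQ hb0 hb1
  obtain ⟨ε, hε, h1, h2⟩ : ∃ ε, 0 < ε ∧ ε ≤ (bigQ b / 2 - b) / 2 ∧ ε ≤ 1 :=
    ⟨min ((bigQ b / 2 - b) / 2) 1, lt_min (by linarith) one_pos, min_le_left _ _, min_le_right _ _⟩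
  refine ⟨ε, (bigQ b / 2 - b) / 2, hε, by linarith, by linarith, fun x y hx hy hxy => ?_⟩
  refine ⟨⟨hε, ?_, ?_, ?_, ?_, ?_, ?_, ?_, ?_, ?_, ?_⟩, ?_⟩ <;>
    (try simp only [add_im]) <;> try linarith
  · rw [abs_of_nonneg hx]; linarith
  · rw [abs_of_nonneg (by linarith)]; linarith
  · rw [abs_of_nonneg (by linarith)]; linarith

/-- The binding constraints are s + Im y > 0 with Im y down to -b, and s < Q/2. The height s is the
midpoint of the interval from b to Q/2. -/
theorem exists_admissiblePair_lowering (hb0 : 0 < b) (hb1 : b < 1) :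
    ∃ ε s, 0 < ε ∧ b < s ∧ s < bigQ b / 2 ∧ ∀ x y : ℂ, x.im ≤ 0 → y.im ≤ 0 →
      -b ≤ x.im + y.im → AdmissiblePair b ε s x y := by
  have hb2 := b_lt_half_bigQ hb0 hb1
  obtain ⟨ε, hε, h1, h2⟩ : ∃ ε, 0 < ε ∧ ε ≤ (bigQ b / 2 - b) / 2 ∧ ε ≤ 1 :=
    ⟨min ((bigQ b / 2 - b) / 2) 1, lt_min (by linarith) one_pos, min_le_left _ _, min_le_right _ _⟩
  refine ⟨ε, (bigQ b / 2 + b) / 2, hε, by linarith, by linarith, fun x y hx hy hxy => ?_⟩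
  refine ⟨⟨hε, ?_, ?_, ?_, ?_, ?_, ?_, ?_, ?_, ?_, ?_⟩, ?_⟩ <;>
    (try simp only [add_im]) <;> try linarith
  · rw [abs_of_nonpos hx]; linarith
  · rw [abs_of_nonneg (by linarith)]; linarith
  · rw [abs_of_nonpos (by linarith)]; linarith

/-- Both shifts, x ↦ x + ib and y ↦ y + ib, evaluate the test function at the same point x + y + ib.
It factors out, and the kernel identity remains. -/
theorem transformIntegrand_raising (hb0 : 0 < b) (hb1 : b < 1) (hs : 0 < s)
    (hs' : s < bigQ b / 2 - b) {Ψ' : ℝ → ℂ → ℂ} {x y : ℝ}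
    (h : ∀ α, Ψ' α (x + y) = qNum b (bigQ b / (2 * b) + I / b * (α - (x + y))) *
      Ψ α (x + y + b * I)) (p : ℝ × ℝ) :
    transformIntegrand b l₁ l₂ s Ψ' x y p =
      qNum b (bigQ b / (2 * b) + I / b * (l₁ - x)) *
        transformIntegrand b l₁ l₂ s Ψ (x + b * I) y p +
      exp (-2 * Real.pi * b * x) * (qNum b (bigQ b / (2 * b) + I / b * (l₂ - y)) *
        transformIntegrand b l₁ l₂ s Ψ x (y + b * I) p) := by
  have key := kernel_identity_raising hb0 hb1 l₁ l₂ p.1 x y (r := p.2 - s * I)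
    (by simpa using hs) (by simp; linarith)
  have e1 : (x + b * I + y : ℂ) = x + y + b * I := by ring
  have e2 : (x + (y + b * I) : ℂ) = x + y + b * I := by ring
  unfold transformIntegrand
  rw [h, e1, e2, qNum_E hb0, qNum_E hb0, qNum_E hb0]
  linear_combination (-qConst b * Ψ p.1 (x + y + b * I)) * key

theorem continuous_qNum_affine (b l σ : ℝ) :
    Continuous fun x : ℝ => qNum b (bigQ b / (2 * b) + I / b * (l + σ * x)) :=
  continuous_qNum b (by fun_prop)

theorem intertwines_E (hb0 : 0 < b) (hb1 : b < 1) (l₁ l₂ : ℝ) :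
    Intertwines b l₁ l₂ (GraphE b) (CoprodE b l₁ l₂) := by
  intro f hf
  obtain ⟨Ψ, hΨ⟩ := exists_entireExtension hf
  have hg := qNum_mul_mem_testSpace hb0 hΨ ((-1 : ℝ) : ℂ) (b * I)
  have hmul : ∀ l x : ℂ, l + ((-1 : ℝ) : ℂ) * x = l - x := fun l x => by push_cast; ring
  simp_rw [hmul] at hg
  obtain ⟨Ψ', hΨ'⟩ := exists_entireExtension hg
  obtain ⟨ε, s, hε, hs, hs', hadm⟩ := exists_admissiblePair_raising hb0 hb1
  have hs2 : s < bigQ b / 2 := by linarith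
  have hab : |b| ≤ 2 := by rw [abs_of_pos hb0]; linarith
  have hnum : ∀ l x : ℝ, ‖qNum b (bigQ b / (2 * b) + I / b * (l - x))‖ ≤
      ‖qConst b‖ * 2 * Real.exp (Real.pi * b * |l|) * Real.exp (Real.pi * b * |x|) := by
    intro l x
    rw [← hmul]
    exact norm_qNum_le_exp_abs hb0 l (-1) x (by simp)
  have hnumc : ∀ l : ℝ, Continuous fun x : ℝ => qNum b (bigQ b / (2 * b) + I / b * (l - x)) := by
    intro l
    simp_rw [← hmul]
    exact continuous_qNum_affine b l (-1)
  refine ⟨_, hg, fun α _ => ⟨memLp_slice hg α, _, shiftGraph_slice hΨ α hab, fun _ => rfl⟩, ?_⟩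
  have hF : cgTransform b l₁ l₂ f = fun x y : ℝ => transform b l₁ l₂ s Ψ x y := by
    funext x y
    exact cgTransform_eq hb0 hb1 l₁ l₂ hs hs2 hΨ x y
  have hG := fun x y : ℝ => cgTransform_eq hb0 hb1 l₁ l₂ hs hs2 hΨ' x y
  have hfst : ∀ (x : ℂ) (y : ℝ), x.im ∈ Set.uIcc 0 b → AdmissiblePair b ε s x y := by
    intro x y hx
    rw [Set.uIcc_of_le hb0.le] at hx
    exact hadm x y hx.1 (by simp) (by simpa using hx.2)
  have hsnd : ∀ (x : ℝ) (y : ℂ), y.im ∈ Set.uIcc 0 b → AdmissiblePair b ε s x y := by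
    intro x y hy
    rw [Set.uIcc_of_le hb0.le] at hy
    exact hadm x y (by simp) hy.1 (by simpa using hy.2)
  have hfst' : ∀ x y : ℝ, AdmissiblePair b ε s (x + b * I) y := fun x y => hfst _ y (by simp)
  have hsnd' : ∀ x y : ℝ, AdmissiblePair b ε s x (y + b * I) := fun x y => hsnd x _ (by simp)
  have hsnd0 : ∀ x y : ℝ, AdmissiblePair b ε s (x + (0 : ℝ) * I) (y + b * I) := fun x y => by
    simpa using hsnd' x y
  rw [hF]
  refine ⟨fun x y => qNum b (bigQ b / (2 * b) + I / b * (l₁ - x)) *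
      transform b l₁ l₂ s Ψ (x + b * I) y,
    fun x y => qNum b (bigQ b / (2 * b) + I / b * (l₂ - y)) *
      transform b l₁ l₂ s Ψ x (y + b * I),
    fun x y => exp (-2 * Real.pi * b * x) * (qNum b (bigQ b / (2 * b) + I / b * (l₂ - y)) *
      transform b l₁ l₂ s Ψ x (y + b * I)),
    fun y => ⟨?_, _, shiftGraph_transform_first hb0 hb1 hε hΨ (fun x => hfst x y), fun _ => rfl⟩,
    fun x => ⟨?_, _, shiftGraph_transform_second hb0 hb1 hε hΨ (hsnd x), fun _ => rfl⟩,
    fun y => ⟨?_, ?_, fun _ => rfl⟩, fun x y => ?_⟩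
  · exact memLp_transform_first hb0 hb1 hε hΨ (fun x => hfst' x y) (hnumc l₁) (hnum l₁)
  · exact memLp_transform_second hb0 hb1 hε hΨ (hsnd' x) (hnumc l₂) (hnum l₂)
  · simpa using memLp_transform_first (l₁ := l₁) (l₂ := l₂) hb0 hb1 hε hΨ (fun x => hsnd0 x y)
      (e := fun _ => qNum b (bigQ b / (2 * b) + I / b * (l₂ - y))) continuous_const
      (K := ‖qNum b (bigQ b / (2 * b) + I / b * (l₂ - y))‖) (κ' := 0) (by simp)
  · have := memLp_transform_first (l₁ := l₁) (l₂ := l₂) hb0 hb1 hε hΨ (fun x => hsnd0 x y)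
      (e := fun x => qNum b (bigQ b / (2 * b) + I / b * (l₂ - y)) * exp (-2 * Real.pi * b * x))
      (by fun_prop) (K := ‖qNum b (bigQ b / (2 * b) + I / b * (l₂ - y))‖)
      (κ' := |-2 * Real.pi * b|) (fun x => by
        have hk := norm_exp_real_le (-2 * Real.pi * b) x
        push_cast at hk
        rw [norm_mul]
        gcongr
        simpa using hk)
    refine (memLp_congr_ae (Eventually.of_forall fun x => ?_)).1 this
    simp only [ofReal_zero, zero_mul, add_zero]
    ring
  · rw [hG]
    dsimp only
    unfold transform
    rw [← integral_const_mul, ← integral_const_mul, ← integral_const_mul, ← integral_add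
      ((integrable_transformIntegrand hb0 hb1 hΨ (hfst' x y)).const_mul _)
      (((integrable_transformIntegrand hb0 hb1 hΨ (hsnd' x y)).const_mul _).const_mul _)]
    refine integral_congr_ae (Eventually.of_forall fun p => ?_)
    refine transformIntegrand_raising hb0 hb1 hs hs' (fun α => ?_) p
    have := hΨ'.coe α (x + y)
    push_cast at this
    exact this

theorem transformIntegrand_lowering (hb0 : 0 < b) (hb1 : b < 1) (hs : b < s)
    (hs' : s < bigQ b / 2) {Ψ' : ℝ → ℂ → ℂ} {x y : ℝ}
    (h : ∀ α, Ψ' α (x + y) = qNum b (bigQ b / (2 * b) + I / b * (α + (x + y))) *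
      Ψ α (x + y - b * I)) (α u : ℝ) :
    qNum b (bigQ b / (2 * b) + I / b * (l₂ + y)) *
        transformIntegrand b l₁ l₂ s Ψ x (y - b * I) (α, u) +
      exp (2 * Real.pi * b * y) * (qNum b (bigQ b / (2 * b) + I / b * (l₁ + x)) *
        transformIntegrand b l₁ l₂ s Ψ (x - b * I) y (α, u)) -
      transformIntegrand b l₁ l₂ s Ψ' x y (α, u) =
    qConst b * Ψ α (x + y - b * I) * (contourPrefactor b l₁ l₂ y (x + y) α /
      twoSin b (bigQ b / 2 + I * (-α + (x + y)))) *
      (loweringPrimitive b l₁ l₂ x y α (u - s * I + b * I) -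
        loweringPrimitive b l₁ l₂ x y α (u - s * I)) := by
  have key := kernel_identity_lowering hb0 hb1 l₁ l₂ α x y (r := u - s * I)
    (by simpa using hs) (by simpa using hs')
  have e1 : (x - b * I + y : ℂ) = x + y - b * I := by ring
  have e2 : (x + (y - b * I) : ℂ) = x + y - b * I := by ring
  have e3 : exp (2 * Real.pi * b * y) = expB b (2 * y) := by unfold expB; ring_nf
  unfold transformIntegrand
  rw [h, e1, e2, e3, qNum_E hb0, qNum_E hb0, qNum_E hb0]
  linear_combination (qConst b * Ψ α (x + y - b * I)) * key

/-- The relation fails for the integrands. The defect vanishes only after integration over r,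
separately for each α. -/
theorem intertwines_F (hb0 : 0 < b) (hb1 : b < 1) (l₁ l₂ : ℝ) :
    Intertwines b l₁ l₂ (GraphF b) (CoprodF b l₁ l₂) := by
  intro f hf
  obtain ⟨Ψ, hΨ⟩ := exists_entireExtension hf
  have hg := qNum_mul_mem_testSpace hb0 hΨ ((1 : ℝ) : ℂ) ((-b : ℝ) * I)
  have hmul : ∀ x : ℂ, ((1 : ℝ) : ℂ) * x = x := fun x => by simp
  simp_rw [hmul] at hg
  obtain ⟨Ψ', hΨ'⟩ := exists_entireExtension hg
  obtain ⟨ε, s, hε, hs, hs', hadm⟩ := exists_admissiblePair_lowering hb0 hb1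
  have hs0 : 0 < s := by linarith
  have hab : |(-b)| ≤ 2 := by rw [abs_neg, abs_of_pos hb0]; linarith
  have hnum : ∀ l x : ℝ, ‖qNum b (bigQ b / (2 * b) + I / b * (l + x))‖ ≤
      ‖qConst b‖ * 2 * Real.exp (Real.pi * b * |l|) * Real.exp (Real.pi * b * |x|) := by
    intro l x
    have := norm_qNum_le_exp_abs hb0 l 1 x (by simp)
    rwa [hmul] at this
  have hnumc : ∀ l : ℝ, Continuous fun x : ℝ => qNum b (bigQ b / (2 * b) + I / b * (l + x)) :=
    fun l => continuous_qNum b (by fun_prop)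
  refine ⟨_, hg, fun α _ => ⟨memLp_slice hg α, _, shiftGraph_slice hΨ α hab, fun _ => rfl⟩, ?_⟩
  have hF : cgTransform b l₁ l₂ f = fun x y : ℝ => transform b l₁ l₂ s Ψ x y := by
    funext x y
    exact cgTransform_eq hb0 hb1 l₁ l₂ hs0 hs' hΨ x y
  have hG := fun x y : ℝ => cgTransform_eq hb0 hb1 l₁ l₂ hs0 hs' hΨ' x y
  have hfst : ∀ (x : ℂ) (y : ℝ), x.im ∈ Set.uIcc 0 (-b) → AdmissiblePair b ε s x y := by
    intro x y hx
    rw [Set.uIcc_of_ge (by linarith)] at hx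
    exact hadm x y hx.2 (by simp) (by simpa using hx.1)
  have hsnd : ∀ (x : ℝ) (y : ℂ), y.im ∈ Set.uIcc 0 (-b) → AdmissiblePair b ε s x y := by
    intro x y hy
    rw [Set.uIcc_of_ge (by linarith)] at hy
    exact hadm x y (by simp) hy.2 (by simpa using hy.1)
  have hfst' : ∀ x y : ℝ, AdmissiblePair b ε s (x + (-b : ℝ) * I) y := fun x y => hfst _ y (by simp)
  have hsnd' : ∀ x y : ℝ, AdmissiblePair b ε s x (y + (-b : ℝ) * I) := fun x y => hsnd x _ (by simp)
  have hreal : ∀ x y : ℝ, AdmissiblePair b ε s x y := fun x y => hsnd x y (by simp)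
  have hfst0 : ∀ x y : ℝ, AdmissiblePair b ε s (x + (-b : ℝ) * I) (y + (0 : ℝ) * I) :=
    fun x y => by simpa using hfst' x y
  rw [hF]
  refine ⟨fun x y => qNum b (bigQ b / (2 * b) + I / b * (l₂ + y)) *
      transform b l₁ l₂ s Ψ x (y + (-b : ℝ) * I),
    fun x y => qNum b (bigQ b / (2 * b) + I / b * (l₁ + x)) *
      transform b l₁ l₂ s Ψ (x + (-b : ℝ) * I) y,
    fun x y => exp (2 * Real.pi * b * y) * (qNum b (bigQ b / (2 * b) + I / b * (l₁ + x)) *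
      transform b l₁ l₂ s Ψ (x + (-b : ℝ) * I) y),
    fun x => ⟨?_, _, shiftGraph_transform_second hb0 hb1 hε hΨ (hsnd x), fun _ => rfl⟩,
    fun y => ⟨?_, _, shiftGraph_transform_first hb0 hb1 hε hΨ (fun x => hfst x y), fun _ => rfl⟩,
    fun x => ⟨?_, ?_, fun y => ?_⟩, fun x y => ?_⟩
  · exact memLp_transform_second hb0 hb1 hε hΨ (hsnd' x) (hnumc l₂) (hnum l₂)
  · exact memLp_transform_first hb0 hb1 hε hΨ (fun x => hfst' x y) (hnumc l₁) (hnum l₁)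
  · have := memLp_transform_second (l₁ := l₁) (l₂ := l₂) hb0 hb1 hε hΨ (hfst0 x)
      (e := fun y => qNum b (bigQ b / (2 * b) + I / b * (l₁ + x)) * exp (2 * Real.pi * b * y))
      (by fun_prop) (K := ‖qNum b (bigQ b / (2 * b) + I / b * (l₁ + x))‖)
      (κ' := |2 * Real.pi * b|) (fun y => by
        have hk := norm_exp_real_le (2 * Real.pi * b) y
        push_cast at hk
        rw [norm_mul]
        gcongr
        simpa using hk)
    refine (memLp_congr_ae (Eventually.of_forall fun y => ?_)).1 this
    simp only [ofReal_zero, zero_mul, add_zero]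
    ring
  · simpa using memLp_transform_second (l₁ := l₁) (l₂ := l₂) hb0 hb1 hε hΨ (hfst0 x)
      (e := fun _ => qNum b (bigQ b / (2 * b) + I / b * (l₁ + x))) continuous_const
      (K := ‖qNum b (bigQ b / (2 * b) + I / b * (l₁ + x))‖) (κ' := 0) (by simp)
  -- The graph of K⁻¹ is that of K with its entries exchanged, so multiplying back by e^{-2πby} is
  -- what has to be checked.
  · dsimp only
    rw [← mul_assoc (exp _), ← Complex.exp_add]
    simp
  · rw [hG]
    have hsub : ∀ w : ℂ, w + (-b : ℝ) * I = w - b * I := fun w => by push_cast; ring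
    simp_rw [hsub] at hfst' hsnd' ⊢
    have i1 := (integrable_transformIntegrand (l₁ := l₁) (l₂ := l₂) hb0 hb1 hΨ (hsnd' x y)).const_mul
      (qNum b (bigQ b / (2 * b) + I / b * (l₂ + y)))
    have i2 := ((integrable_transformIntegrand (l₁ := l₁) (l₂ := l₂) hb0 hb1 hΨ
      (hfst' x y)).const_mul (qNum b (bigQ b / (2 * b) + I / b * (l₁ + x)))).const_mul
        (exp (2 * Real.pi * b * y))
    have i3 := integrable_transformIntegrand (l₁ := l₁) (l₂ := l₂) hb0 hb1 hΨ' (hreal x y)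
    rw [eq_comm, ← sub_eq_zero]
    unfold transform
    rw [← integral_const_mul, ← integral_const_mul, ← integral_const_mul, ← integral_add' i1 i2,
      ← integral_sub' (i1.add i2) i3]
    -- Fubini with r innermost: for fixed α the defect is a factor independent of r times a
    -- difference of `loweringPrimitive`.
    refine (integral_prod _ ((i1.add i2).sub i3)).trans ?_
    refine (integral_congr_ae (Eventually.of_forall fun α => ?_)).trans (integral_zero _ _)
    have hval : ∀ α : ℝ, Ψ' α (x + y) = qNum b (bigQ b / (2 * b) + I / b * (α + (x + y))) *
        Ψ α (x + y - b * I) := by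
      intro α
      have := hΨ'.coe α (x + y)
      simp only [hsub] at this
      push_cast at this
      exact this
    refine (integral_congr_ae (Eventually.of_forall fun u =>
      transformIntegrand_lowering hb0 hb1 hs hs' hval α u)).trans ?_
    rw [integral_const_mul, integral_loweringPrimitive_sub hb0 hb1 l₁ l₂ x y α hs hs', mul_zero]

end Intertwining

end SplitReal

theorem theorem3p5 (b : ℝ) (hb0 : 0 < b) (hb1 : b < 1) (hb : Irrational (b ^ 2))
    (l₁ l₂ : ℝ) (hl₁ : 0 ≤ l₁) (hl₂ : 0 ≤ l₂) :
    -- the kernel arises from the compact coefficients by the replacement rule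
    (∀ x y α : ℝ, 0 < α → ∀ r : ℂ, -(SplitReal.bigQ b / 2) < r.im → r.im < 0 →
      SplitReal.cgReplaced b l₁ l₂ x α (x + y) r =
        SplitReal.cgPrefactor b l₁ l₂ y α (x + y) *
          SplitReal.cgIntegrand b l₁ l₂ x y α (x + y) r) ∧
    -- the contour integral converges absolutely and does not depend on the contour
    (∀ x y z α : ℝ, 0 < α → ∀ s : ℝ, 0 < s → s < SplitReal.bigQ b / 2 →
      Integrable (fun u : ℝ =>
        SplitReal.cgIntegrand b l₁ l₂ x y α z ((u : ℂ) - s * Complex.I)) ∧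
      SplitReal.cgDensity b l₁ l₂ x y α z =
        SplitReal.cgPrefactor b l₁ l₂ y α z *
          ∫ u : ℝ, SplitReal.cgIntegrand b l₁ l₂ x y α z ((u : ℂ) - s * Complex.I)) ∧
    -- the integral transformation is defined on the test space
    (∀ f ∈ SplitReal.testSpace, ∀ x y : ℝ,
      IntegrableOn (fun α : ℝ => ∫ z : ℝ, SplitReal.cgDensity b l₁ l₂ x y α z * f α z
        ∂(Measure.dirac (x + y))) (Set.Ioi 0)) ∧
    -- it intertwines the actions of `K`, `E` and `F`
    SplitReal.Intertwines b l₁ l₂ (fun _ => SplitReal.GraphK b) (SplitReal.CoprodK b) ∧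
    SplitReal.Intertwines b l₁ l₂ (SplitReal.GraphE b) (SplitReal.CoprodE b l₁ l₂) ∧
    SplitReal.Intertwines b l₁ l₂ (SplitReal.GraphF b) (SplitReal.CoprodF b l₁ l₂) := by
  refine ⟨fun x y α _ r hr₁ hr₂ => SplitReal.cgReplaced_eq hb0 hb1 l₁ l₂ x y α hr₁ hr₂,
    fun x y z α _ s hs hs' => SplitReal.contour_convergence hb0 hb1 l₁ l₂ x y z α hs hs',
    fun f hf x y => SplitReal.integrableOn_density hb0 hb1 l₁ l₂ hf x y,
    SplitReal.intertwines_K hb0 hb1 l₁ l₂, SplitReal.intertwines_E hb0 hb1 l₁ l₂,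
    SplitReal.intertwines_F hb0 hb1 l₁ l₂⟩
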